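/- Let $d\ge 1$, let $s>d/2$ and $p\ge 1$ be integers, let $\nu>0$, $\gamma\ge 0$, $c>0$, and let $\mathbb T^d=\mathbb R^d/2\pi\mathbb Z^d$. Write $L^2=L^2(\mathbb T^d;\mathbb C)$, $H^r=H^r(\mathbb T^d;\mathbb C)$, $B(z)=ic|z|^{2p}z$, and $J_T=[0,T]$. Let $\chi:\mathbb T^d\to[0,\infty)$ be smooth and not identically zero, let $h\in L^2_{\rm loc}([0,\infty);H^{s-1})$, and consider $$\partial_t u-(\nu+i)\Delta u+\gamma u+ic|u|^{2p}u=h(t,x)+\chi(x)\eta(t,x),\qquad u(0)=u_0. \tag{$*$}$$ Let $\mathcal X_T=C(J_T;H^s)\cap L^2(J_T;H^{s+1})$, let $\Lambda=\{x\in\mathbb T^d:\chi(x)=\max\chi\}$, and let $\mathcal O$ be the interior of $\Lambda$. Let $\mathcal H\subset H^{s+2}$ be a finite-dimensional complex subspace that is invariant under complex conjugation and contains the constant function $1$. Put $\mathcal H'_0=\mathcal H$, $\mathcal H'_j=\operatorname{span}\{B(\zeta):\zeta\in\mathcal H'_{j-1}\}$ for $j\ge1$, and $\mathcal H'_\infty=\bigcup_{j\ge0}\mathcal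 H'_j$. For measurable $A\subset\mathbb T^d$, call $\mathcal H$ $A$-saturating if the restrictions to $A$ of the elements of $\mathcal H'_\infty$ are dense in $L^2(A;\mathbb C)$. **Theorem 3.5.** Assume that $\mathcal O\ne\emptyset$ and that $\mathcal H$ is $\mathcal O$-saturating. If $\Lambda\setminus\mathcal O$ has positive Lebesgue measure, assume in addition that $\mathcal H$ is $\Lambda$-saturating. Then $(*)$ is approximately controllable on $\mathcal O$ in small time by $\mathcal H$-valued control: for any $\varepsilon>0$, $T_0>0$, $u_0\in H^s$ and $u_1\in L^2$, there are a time $T\in(0,T_0)$ and a control $\eta\in L^2(J_T;\mathcal H)$ such that $(*)$ has a unique solution $u$ in $\mathcal X_T$, and $$\|u(T)-u_0-u_1\mathbb 1_{\mathcal O}\|_{L^2}<\varepsilon .$$ -/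

import Mathlib

open MeasureTheory Set Filter Topology
open scoped ENNReal

namespace CGL

instance instTwoPiPos : Fact (0 < 2 * Real.pi) := ⟨Real.two_pi_pos⟩

/-- The torus `ℝ^d / 2πℤ^d`. Its `volume` is Lebesgue measure, of total mass `(2π)^d`. -/
abbrev Torus (d : ℕ) : Type := Fin d → AddCircle (2 * Real.pi)

/-- The space `L²(𝕋^d; ℂ)`. -/
abbrev L2T (d : ℕ) : Type := Lp ℂ 2 (volume : Measure (Torus d))

/-- The projection `ℝ^d → 𝕋^d`. -/
noncomputable def torusMk (d : ℕ) (x : Fin d → ℝ) : Torus d := fun i => (x i : AddCircle (2 * Real.pi))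

/-- A function on the torus is smooth if its periodic lift to `ℝ^d` is `C^∞`. -/
def TorusSmooth {d : ℕ} (f : Torus d → ℝ) : Prop :=
  ContDiff ℝ ((⊤ : ℕ∞) : WithTop ℕ∞) (fun x : Fin d → ℝ => f (torusMk d x))

/-- The character `x ↦ exp(i⟨k, x⟩)`. -/
noncomputable def torusChar {d : ℕ} (k : Fin d → ℤ) (x : Torus d) : ℂ :=
  ∏ i, fourier (k i) (x i)

/-- The Fourier coefficient `(2π)^{-d} ∫ f(x) exp(-i⟨k, x⟩) dx`. -/
noncomputable def coeff {d : ℕ} (f : Torus d → ℂ) (k : Fin d → ℤ) : ℂ :=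
  (((2 * Real.pi) ^ d : ℝ) : ℂ)⁻¹ * ∫ x, f x * (starRingEnd ℂ) (torusChar k x)

/-- `|k|² = k₁² + ⋯ + k_d²`, so that `-Δ exp(i⟨k, x⟩) = |k|² exp(i⟨k, x⟩)`. -/
noncomputable def freqSq {d : ℕ} (k : Fin d → ℤ) : ℝ := ∑ i, ((k i : ℝ)) ^ 2

/-- The `H^r` norm `(∑_k (1 + |k|²)^r |f̂(k)|²)^{1/2}`, with the value `∞` off `H^r`. -/
noncomputable def sobolevENorm {d : ℕ} (r : ℕ) (f : L2T d) : ℝ≥0∞ :=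
  (∑' k : Fin d → ℤ, ENNReal.ofReal ((1 + freqSq k) ^ r) * ‖coeff f k‖ₑ ^ 2) ^ (1 / 2 : ℝ)

/-- `f ∈ H^r(𝕋^d; ℂ)`. -/
def MemSobolev {d : ℕ} (r : ℕ) (f : L2T d) : Prop := sobolevENorm r f < ∞

/-- `f ∈ L²([0, T]; H^r)`. -/
def MemL2Sobolev {d : ℕ} (T : ℝ) (r : ℕ) (f : ℝ → L2T d) : Prop :=
  AEStronglyMeasurable f (volume.restrict (Icc 0 T)) ∧
    ∫⁻ t in Icc 0 T, sobolevENorm r (f t) ^ 2 < ∞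

/-- `f ∈ C([0, T]; H^r)`. -/
def MemCSobolev {d : ℕ} (T : ℝ) (r : ℕ) (f : ℝ → L2T d) : Prop :=
  (∀ t ∈ Icc 0 T, MemSobolev r (f t)) ∧
    ∀ t₀ ∈ Icc 0 T, Tendsto (fun t => sobolevENorm r (f t - f t₀)) (𝓝[Icc 0 T] t₀) (𝓝 0)

/-- The space `C([0, T]; H^s) ∩ L²([0, T]; H^{s+1})` (only the values on `[0, T]` matter). -/
def MemX {d : ℕ} (T : ℝ) (s : ℕ) (u : ℝ → L2T d) : Prop :=
  MemCSobolev T s u ∧ MemL2Sobolev T (s + 1) u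

/-- The nonlinear term `B(z) = i c |z|^{2p} z`, applied pointwise. -/
noncomputable def nonlin (c : ℝ) (p : ℕ) (z : ℂ) : ℂ :=
  Complex.I * (c : ℂ) * ((‖z‖ ^ (2 * p) : ℝ) : ℂ) * z

/-- `u` is a solution on `[0, T]`, in the space `MemX T s`, of
`∂ₜu - (ν + i)Δu + γu + ic|u|^{2p}u = f`, `u(0) = u₀`.
The equation holds in the sense of distributions. As the exponentials `exp(i⟨k, x⟩)` span a
dense set of test functions, it is written, integrated in time, as the family of equations for
the Fourier coefficients; the symbol of `L = -(ν + i)Δ + γ` is `(ν + i)|k|² + γ`. -/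
structure IsSolution {d : ℕ} (ν γ c : ℝ) (p s : ℕ) (T : ℝ) (u₀ : L2T d)
    (f : ℝ → Torus d → ℂ) (u : ℝ → L2T d) : Prop where
  mem : MemX T s u
  init : u 0 = u₀
  eqn : ∀ k : Fin d → ℤ, ∀ t ∈ Icc 0 T,
    coeff (u t) k = coeff u₀ k +
      ∫ τ in (0 : ℝ)..t,
        (-((((ν : ℂ) + Complex.I) * (freqSq k : ℂ) + (γ : ℂ)) * coeff (u τ) k)
          - coeff (fun x => nonlin c p (u τ x)) k + coeff (f τ) k)

/-- The source term `h(t, x) + χ(x) η(t, x)`. -/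
noncomputable def source {d : ℕ} (χ : Torus d → ℝ) (h η : ℝ → L2T d) (t : ℝ) (x : Torus d) : ℂ :=
  h t x + (χ x : ℂ) * η t x

/-- `u` is, on `[0, T]`, the unique solution for the source term `f`. -/
def IsUniqueSolution {d : ℕ} (ν γ c : ℝ) (p s : ℕ) (T : ℝ) (u₀ : L2T d)
    (f : ℝ → Torus d → ℂ) (u : ℝ → L2T d) : Prop :=
  IsSolution ν γ c p s T u₀ f u ∧
    ∀ v : ℝ → L2T d, IsSolution ν γ c p s T u₀ f v → ∀ t ∈ Icc 0 T, v t = u t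

/-- `η ∈ L²([0, T]; H)` for a finite-dimensional subspace `H` of `L²`. -/
def MemL2Sub {d : ℕ} (H : Submodule ℂ (L2T d)) (T : ℝ) (η : ℝ → L2T d) : Prop :=
  MemLp η 2 (volume.restrict (Icc 0 T)) ∧ ∀ᵐ t ∂(volume.restrict (Icc 0 T)), η t ∈ H

/-- The level set `Λ = {x | χ(x) = max χ}`. -/
def maxSet {d : ℕ} (χ : Torus d → ℝ) : Set (Torus d) := {x | χ x = ⨆ y, χ y}

/-- The spaces `H'_0 = H`, `H'_j = span {B(ζ) | ζ ∈ H'_{j-1}}`. -/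
noncomputable def satSeq {d : ℕ} (c : ℝ) (p : ℕ) (H : Submodule ℂ (L2T d)) : ℕ → Submodule ℂ (L2T d)
  | 0 => H
  | j + 1 => Submodule.span ℂ
      {g : L2T d | ∃ ζ ∈ satSeq c p H j, (g : Torus d → ℂ) =ᵐ[volume] fun x => nonlin c p (ζ x)}

/-- The restrictions to `A` of the elements of `⋃_j H'_j` are dense in `L²(A; ℂ)`. -/
def IsSaturatingOn {d : ℕ} (c : ℝ) (p : ℕ) (H : Submodule ℂ (L2T d)) (A : Set (Torus d)) : Prop :=
  Dense {w : Lp ℂ 2 ((volume : Measure (Torus d)).restrict A) |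
    ∃ j : ℕ, ∃ g ∈ satSeq c p H j,
      (w : Torus d → ℂ) =ᵐ[(volume : Measure (Torus d)).restrict A] (g : Torus d → ℂ)}

/-- Approximate controllability of `∂ₜu - (ν + i)Δu + γu + ic|u|^{2p}u = h + χη` on `O` in small
time by `H`-valued control. -/
def ApproxControllableOn {d : ℕ} (ν γ c : ℝ) (p s : ℕ) (χ : Torus d → ℝ) (h : ℝ → L2T d)
    (H : Submodule ℂ (L2T d)) (O : Set (Torus d)) : Prop :=
  ∀ ε : ℝ, 0 < ε → ∀ T₀ : ℝ, 0 < T₀ → ∀ u₀ : L2T d, MemSobolev s u₀ → ∀ u₁ : L2T d,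
    ∃ T ∈ Ioo 0 T₀, ∃ η : ℝ → L2T d, MemL2Sobolev T (s - 1) η ∧ MemL2Sub H T η ∧
      ∃ u : ℝ → L2T d, IsUniqueSolution ν γ c p s T u₀ (source χ h η) u ∧
        eLpNorm (fun x => u T x - u₀ x - O.indicator (fun y => u₁ y) x) 2 volume
          < ENNReal.ofReal ε

end CGL

namespace CGL

/-! ### Cauchy–Schwarz and square-summable sequences -/

/-! Call a displacement g attainable (`Steer`) if, from every state v and every starting time, the
system can be brought arbitrarily close to v + g in H^s in arbitrarily short time. In so short a
time only large quantities matter, and two scalings exploit this. A constant control ζ/δ acting for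
time δ moves the state by about χζ, while diffusion, nonlinearity and h contribute o(1): this is
`steer_control`. If instead the state is first shifted to v + Mg and left without control for time
M^{-(2p+1)}, the homogeneity of B makes the nonlinearity contribute about -B(g), every other term
being o(1) as M grows (`exists_traj_nonlin`); shifting back by -Mg leaves v - B(g). So if all
complex multiples of g are attainable, -B(g) is too, and since |μ|^{2p}μ takes every complex value,
so are all multiples of B(g) (`Steer.smul_nonlin`). Attainable displacements add up, by
concatenation.

Starting from the functions χζ with ζ in H, and using B(χ^n ζ) = χ^{(2p+1)n} B(ζ), which holds
because χ ≥ 0, one obtains that for g in H'_m all multiples of χ^n g with n = (2p+1)^m are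
attainable (`lifted_of_mem_satSeq`). Divide by (max χ)^n: the functions (χ / max χ)^n g converge in
L² to g on Λ and to 0 elsewhere (`tendsto_eLpNorm_pow_mul`). To let n grow with g fixed, g must lie
in all later spaces H'_m; this holds because 1 is in each of them, and the linear part of B(1 + tz)
in t recovers z by polarization (`mem_satSeq_succ`). Saturation then chooses g so that its
restriction to Λ, extended by 0, is close to u₁ on 𝒪 and to 0 elsewhere (`exists_near_indicator`).

The analysis is done on weighted Fourier coefficients: an element of H^r is a sequence in ℓ², and
for 2r > d it represents a continuous function through `Phi`. The nonlinearity is a polynomial in u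
and its conjugate, hence locally Lipschitz because H^r is then an algebra (`tsum_coeff_mul_le`,
`norm_nonlinE_sub_le`). Trajectories are fixed points of the Duhamel formula over short times
(`exists_mild`), and their uniqueness follows from Gronwall's inequality (`IsModeSol.unique`). -/

theorem lintegral_mul_sq_le {α : Type*} [MeasurableSpace α] (μ : Measure α) {f g : α → ℝ≥0∞}
    (hf : AEMeasurable f μ) (hg : AEMeasurable g μ) :
    (∫⁻ x, f x * g x ∂μ) ^ 2 ≤ (∫⁻ x, f x ^ 2 ∂μ) * ∫⁻ x, g x ^ 2 ∂μ := by
  have h := ENNReal.lintegral_mul_le_Lp_mul_Lq μ Real.HolderConjugate.two_two hf hg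
  have h2 := pow_le_pow_left' h 2
  have e : ∀ a : ℝ≥0∞, (a ^ (1 / (2 : ℝ))) ^ 2 = a := fun a => by
    rw [← ENNReal.rpow_natCast, ← ENNReal.rpow_mul]; norm_num
  rw [mul_pow, e, e] at h2
  simpa using h2

theorem tsum_mul_sq_le {ι : Type*} (f g : ι → ℝ≥0∞) :
    (∑' i, f i * g i) ^ 2 ≤ (∑' i, f i ^ 2) * ∑' i, g i ^ 2 := by
  let _ : MeasurableSpace ι := ⊤
  have := lintegral_mul_sq_le (Measure.count : Measure ι) (f := f) (g := g)
    (measurable_from_top.aemeasurable) (measurable_from_top.aemeasurable)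
  simpa [lintegral_count' measurable_from_top] using this

/-- The space of square-summable families, which carries the (weighted) Fourier coefficients. -/
abbrev ESeq (d : ℕ) : Type := lp (fun _ : Fin d → ℤ => ℂ) 2

theorem enorm_sq_eq_tsum {d : ℕ} (A : ESeq d) : ‖A‖ₑ ^ 2 = ∑' k, ‖A k‖ₑ ^ 2 := by
  have h := lp.norm_rpow_eq_tsum (p := 2) (by norm_num) A
  have hs := (memℓp_gen_iff (p := 2) (by norm_num)).1 (lp.memℓp A)
  simp only [ENNReal.toReal_ofNat, Real.rpow_two] at h hs
  have : ‖A‖ₑ ^ 2 = ENNReal.ofReal (‖A‖ ^ 2) := by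
    rw [ENNReal.ofReal_pow (norm_nonneg _), ofReal_norm]
  rw [this, h, ENNReal.ofReal_tsum_of_nonneg (fun k => by positivity) hs]
  congr 1; ext k
  rw [ENNReal.ofReal_pow (norm_nonneg _), ofReal_norm]

theorem memℓp_two_of_tsum_ne_top {d : ℕ} {f : (Fin d → ℤ) → ℂ} (h : ∑' k, ‖f k‖ₑ ^ 2 ≠ ∞) :
    Memℓp f 2 := by
  rw [memℓp_gen_iff (by norm_num)]
  simp only [ENNReal.toReal_ofNat, Real.rpow_two]
  have := ENNReal.summable_toReal h
  simpa using this

/-- The element of `ESeq d` with the given coordinates (zero if they are not square-summable). -/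
noncomputable def ofSeq {d : ℕ} (f : (Fin d → ℤ) → ℂ) : ESeq d :=
  open Classical in if h : Memℓp f 2 then ⟨f, h⟩ else 0

theorem ofSeq_apply {d : ℕ} {f : (Fin d → ℤ) → ℂ} (h : ∑' k, ‖f k‖ₑ ^ 2 ≠ ∞) (k : Fin d → ℤ) :
    ofSeq f k = f k := by
  rw [ofSeq, dif_pos (memℓp_two_of_tsum_ne_top h)]

theorem norm_le_of_tsum_le {d : ℕ} {A : ESeq d} {C : ℝ} (hC : 0 ≤ C)
    (h : ∑' k, ‖A k‖ₑ ^ 2 ≤ ENNReal.ofReal C ^ 2) : ‖A‖ ≤ C := by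
  rw [← enorm_sq_eq_tsum, ← ofReal_norm, ← ENNReal.ofReal_pow (norm_nonneg _),
    ← ENNReal.ofReal_pow hC, ENNReal.ofReal_le_ofReal_iff (by positivity)] at h
  exact (abs_le_of_sq_le_sq' h hC).2

theorem ESeq.tsum_ne_top {d : ℕ} (A : ESeq d) : ∑' k, ‖A k‖ₑ ^ 2 ≠ ∞ := by
  rw [← enorm_sq_eq_tsum]; finiteness

/-! ### The weights -/

/-- The weight `(1 + |k|²)^{1/2}`. -/
noncomputable def wt {d : ℕ} (k : Fin d → ℤ) : ℝ := Real.sqrt (1 + freqSq k)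

theorem freqSq_nonneg {d : ℕ} (k : Fin d → ℤ) : 0 ≤ freqSq k :=
  Finset.sum_nonneg fun _ _ => sq_nonneg _

theorem wt_sq {d : ℕ} (k : Fin d → ℤ) : wt k ^ 2 = 1 + freqSq k :=
  Real.sq_sqrt (by have := freqSq_nonneg k; positivity)

theorem one_le_wt {d : ℕ} (k : Fin d → ℤ) : 1 ≤ wt k := by
  rw [wt, Real.one_le_sqrt]; have := freqSq_nonneg k; linarith

theorem wt_pos {d : ℕ} (k : Fin d → ℤ) : 0 < wt k := zero_lt_one.trans_le (one_le_wt k)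

theorem wt_ne_zero {d : ℕ} (k : Fin d → ℤ) : (wt k : ℂ) ≠ 0 :=
  Complex.ofReal_ne_zero.2 (wt_pos k).ne'

theorem freqSq_neg {d : ℕ} (k : Fin d → ℤ) : freqSq (-k) = freqSq k := by simp [freqSq]

theorem wt_neg {d : ℕ} (k : Fin d → ℤ) : wt (-k) = wt k := by rw [wt, freqSq_neg, wt]

theorem wt_le_two_mul_max {d : ℕ} (k j : Fin d → ℤ) : wt k ≤ 2 * max (wt (k - j)) (wt j) := by
  have h : freqSq k ≤ 2 * freqSq (k - j) + 2 * freqSq j := by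
    simp only [freqSq, Finset.mul_sum, ← Finset.sum_add_distrib]
    refine Finset.sum_le_sum fun i _ => ?_
    push_cast [Pi.sub_apply]
    nlinarith [sq_nonneg ((k i : ℝ) - 2 * j i)]
  have h1 := wt_sq k
  have h2 := wt_sq (k - j)
  have h3 := wt_sq j
  have p1 := wt_pos (k - j)
  have p2 := wt_pos j
  set m := max (wt (k - j)) (wt j) with hm
  have m1 : wt (k - j) ^ 2 ≤ m ^ 2 := pow_le_pow_left₀ p1.le (le_max_left _ _) 2
  have m2 : wt j ^ 2 ≤ m ^ 2 := pow_le_pow_left₀ p2.le (le_max_right _ _) 2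
  have mp : 0 < m := p1.trans_le (le_max_left _ _)
  refine abs_le_of_sq_le_sq' (a := wt k) (b := 2 * m) ?_ (by positivity) |>.2
  nlinarith

theorem norm_le_wt {d : ℕ} (k : Fin d → ℤ) : ‖fun i => (k i : ℝ)‖ ≤ wt k := by
  rw [pi_norm_le_iff_of_nonneg (wt_pos k).le]
  intro i
  refine Real.le_sqrt_of_sq_le ?_
  rw [Real.norm_eq_abs, sq_abs]
  have : ((k i : ℝ)) ^ 2 ≤ freqSq k :=
    Finset.single_le_sum (f := fun i => ((k i : ℝ)) ^ 2) (fun _ _ => sq_nonneg _)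
      (Finset.mem_univ i)
  linarith

theorem summable_wt_inv {d n : ℕ} (hn : d < n) : Summable fun k : Fin d → ℤ => (wt k)⁻¹ ^ n := by
  let b := Pi.basisFun ℝ (Fin d)
  let L : Submodule ℤ (Fin d → ℝ) := Submodule.span ℤ (Set.range b)
  have hfr : Module.finrank ℤ L = d := by
    rw [ZLattice.rank ℝ L]; simp
  have hmem : ∀ k : Fin d → ℤ, (fun i => (k i : ℝ)) ∈ L := by
    intro k
    have : (fun i => (k i : ℝ)) = ∑ i, k i • b i := by
      ext j
      simp [b, Pi.single_apply]
    rw [this]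
    exact Submodule.sum_mem _ fun i _ => Submodule.smul_mem _ _ (Submodule.subset_span ⟨i, rfl⟩)
  have hs := ZLattice.summable_norm_pow_inv L n (by rw [hfr]; exact hn)
  let φ : (Fin d → ℤ) → L := fun k => ⟨_, hmem k⟩
  have hφ : Function.Injective φ := by
    intro k l hkl
    have := congrArg Subtype.val hkl
    ext i
    simpa [φ] using congrFun this i
  refine Summable.of_norm_bounded_eventually (hs.comp_injective hφ) ?_
  -- At k = 0 the lattice term 0⁻¹ ^ n is 0 while the weight is 1, so the comparison holds only off
  -- the origin.
  have : {(0 : Fin d → ℤ)}ᶜ ∈ (cofinite : Filter (Fin d → ℤ)) := (Set.finite_singleton _).compl_mem_cofinite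
  filter_upwards [this] with k hk
  have hk' : 0 < ‖φ k‖ := by
    rw [norm_pos_iff]
    intro h0
    apply hk
    have h1 : φ 0 = 0 := by ext i; simp [φ]
    exact hφ (h0.trans h1.symm)
  rw [norm_pow, norm_inv, Real.norm_of_nonneg (wt_pos k).le]
  exact pow_le_pow_left₀ (inv_nonneg.2 (wt_pos k).le) (inv_anti₀ hk' (norm_le_wt k)) n

/-- `∑_k (1 + |k|²)^{-r}`. -/
noncomputable def wtSum (d r : ℕ) : ℝ≥0∞ := ∑' k : Fin d → ℤ, ENNReal.ofReal ((wt k)⁻¹ ^ r) ^ 2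

theorem wtSum_ne_top {d r : ℕ} (hr : d < 2 * r) : wtSum d r ≠ ∞ := by
  have : ∀ k : Fin d → ℤ, ENNReal.ofReal ((wt k)⁻¹ ^ r) ^ 2 = ENNReal.ofReal ((wt k)⁻¹ ^ (2 * r)) := by
    intro k
    rw [← ENNReal.ofReal_pow (by have := wt_pos k; positivity), ← pow_mul, mul_comm]
  simp only [wtSum, this]
  exact (summable_wt_inv hr).tsum_ofReal_ne_top

/-! ### Characters of the torus and Fourier coefficients -/

/-- The character `x ↦ exp(i⟨k, x⟩)` as a continuous map. -/
noncomputable def charC {d : ℕ} (k : Fin d → ℤ) : C(Torus d, ℂ) where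
  toFun := torusChar k
  continuous_toFun := by unfold torusChar; fun_prop

theorem charC_apply {d : ℕ} (k : Fin d → ℤ) (x : Torus d) : charC k x = torusChar k x := rfl

theorem torusChar_add {d : ℕ} (k l : Fin d → ℤ) (x : Torus d) :
    torusChar (k + l) x = torusChar k x * torusChar l x := by
  simp only [torusChar, Pi.add_apply, fourier_add, Finset.prod_mul_distrib]

theorem torusChar_neg {d : ℕ} (k : Fin d → ℤ) (x : Torus d) :
    torusChar (-k) x = starRingEnd ℂ (torusChar k x) := by
  simp only [torusChar, Pi.neg_apply, fourier_neg, map_prod]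

theorem torusChar_zero {d : ℕ} (x : Torus d) : torusChar 0 x = 1 := by
  simp [torusChar]

theorem norm_torusChar {d : ℕ} (k : Fin d → ℤ) (x : Torus d) : ‖torusChar k x‖ = 1 := by
  simp [torusChar, norm_prod, fourier_apply, Circle.norm_coe]

theorem norm_charC_le {d : ℕ} (k : Fin d → ℤ) : ‖(charC k : C(Torus d, ℂ))‖ ≤ 1 :=
  (ContinuousMap.norm_le _ zero_le_one).2 fun x => (norm_torusChar k x).le

theorem continuous_torusChar {d : ℕ} (k : Fin d → ℤ) : Continuous (torusChar k : Torus d → ℂ) :=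
  (charC k).continuous

theorem torusChar_single {d : ℕ} (i : Fin d) (x : Torus d) :
    torusChar (Pi.single i 1) x = fourier 1 (x i) := by
  classical
  rw [torusChar, Finset.prod_eq_single i]
  · simp
  · intro j _ hj
    rw [Pi.single_eq_of_ne hj, fourier_zero]
  · simp

theorem integral_fourier_circle (n : ℤ) :
    ∫ x : AddCircle (2 * Real.pi), fourier n x = if n = 0 then ((2 * Real.pi : ℝ) : ℂ) else 0 := by
  have h := congrFun (fourierCoeff_fourier (T := 2 * Real.pi) n) 0
  simp only [fourierCoeff, AddCircle.integral_haarAddCircle, neg_zero, fourier_zero, one_smul] at h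
  rw [inv_smul_eq_iff₀ (by positivity)] at h
  rw [h, Pi.single_apply]
  by_cases hn : n = 0
  · simp [hn]
  · simp [hn, Ne.symm hn]

theorem integral_torusChar {d : ℕ} (k : Fin d → ℤ) :
    ∫ x : Torus d, torusChar k x = if k = 0 then (((2 * Real.pi) ^ d : ℝ) : ℂ) else 0 := by
  simp only [torusChar]
  rw [MeasureTheory.integral_fintype_prod_volume_eq_prod (fun i (y : AddCircle (2 * Real.pi)) => fourier (k i) y)]
  simp only [integral_fourier_circle]
  split_ifs with h
  · subst h; simp
  · obtain ⟨i, hi⟩ := Function.ne_iff.mp h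
    exact Finset.prod_eq_zero (Finset.mem_univ i) (if_neg hi)

/-- Stone–Weierstrass: the characters are closed under products and conjugation, so their span is a
star subalgebra, and the characters `Pi.single i 1` separate points coordinate by coordinate. -/
theorem span_charC_closure_eq_top (d : ℕ) :
    (Submodule.span ℂ (range (charC (d := d)))).topologicalClosure = ⊤ := by
  classical
  let S : StarSubalgebra ℂ C(Torus d, ℂ) :=
    { toSubalgebra := Algebra.adjoin ℂ (range charC)
      star_mem' := by
        change Algebra.adjoin ℂ (range charC) ≤ star (Algebra.adjoin ℂ (range charC))
        refine Algebra.adjoin_le ?_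
        rintro _ ⟨n, rfl⟩
        refine Algebra.subset_adjoin ⟨-n, ?_⟩
        ext1 x
        simp only [charC_apply, torusChar_neg, starRingEnd_apply, ContinuousMap.star_apply] }
  have hS : S.toSubalgebra.toSubmodule = Submodule.span ℂ (range charC) := by
    apply Algebra.adjoin_eq_span_of_subset
    refine .trans (fun x ↦ Submonoid.closure_induction (fun _ ↦ id) ⟨0, ?_⟩ ?_)
      Submodule.subset_span
    · ext z
      simp [charC_apply, torusChar_zero]
    · rintro _ _ _ _ ⟨m, rfl⟩ ⟨n, rfl⟩
      refine ⟨m + n, ?_⟩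
      ext z
      simp [charC_apply, torusChar_add]
  have hsep : S.SeparatesPoints := by
    intro x y hxy
    rw [Ne, funext_iff, not_forall] at hxy
    obtain ⟨i, hi⟩ := hxy
    refine ⟨_, ⟨charC (Pi.single i 1), Algebra.subset_adjoin ⟨Pi.single i 1, rfl⟩, rfl⟩, ?_⟩
    dsimp only
    rw [charC_apply, charC_apply, torusChar_single, torusChar_single, fourier_one, fourier_one]
    intro h
    exact hi (AddCircle.injective_toCircle (by positivity) (Circle.ext h))
  rw [← hS]
  exact congr_arg (Subalgebra.toSubmodule <| StarSubalgebra.toSubalgebra ·)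
    (ContinuousMap.starSubalgebra_topologicalClosure_eq_top_of_separatesPoints _ hsep)

/-- The inclusion of continuous functions into `L²`. -/
noncomputable def toL2 (d : ℕ) : C(Torus d, ℂ) →L[ℂ] L2T d := ContinuousMap.toLp 2 volume ℂ

theorem coeFn_toL2 {d : ℕ} (f : C(Torus d, ℂ)) : toL2 d f =ᵐ[volume] f :=
  ContinuousMap.coeFn_toLp volume f

theorem coeff_congr {d : ℕ} {f g : Torus d → ℂ} (h : f =ᵐ[volume] g) (k : Fin d → ℤ) :
    coeff f k = coeff g k := by
  rw [coeff, coeff]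
  congr 1
  exact integral_congr_ae (h.mono fun x hx => by simp only [hx])

theorem coeff_eq_inner {d : ℕ} (f : L2T d) (k : Fin d → ℤ) :
    coeff f k = (((2 * Real.pi) ^ d : ℝ) : ℂ)⁻¹ * inner ℂ (toL2 d (charC k)) f := by
  rw [coeff, L2.inner_def]
  congr 1
  refine integral_congr_ae ?_
  filter_upwards [coeFn_toL2 (charC k)] with x hx
  rw [hx, charC_apply, RCLike.inner_apply]

/-- Uniform density of trigonometric polynomials passes to L², so nothing nonzero is orthogonal to
all characters. This is how functions are identified with their coordinates throughout. -/
theorem L2T.ext_coeff {d : ℕ} {f g : L2T d} (h : ∀ k, coeff f k = coeff g k) : f = g := by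
  have hd : (Submodule.span ℂ (range (toL2 d ∘ charC))).topologicalClosure = ⊤ := by
    simpa only [Submodule.map_span, ContinuousLinearMap.coe_coe, ← range_comp, toL2] using
      (ContinuousMap.toLp_denseRange ℂ volume ℂ (p := 2)
        (by norm_num)).topologicalClosure_map_submodule (span_charC_closure_eq_top d)
  rw [Submodule.topologicalClosure_eq_top_iff] at hd
  rw [← sub_eq_zero, ← Submodule.mem_bot ℂ, ← hd, Submodule.mem_orthogonal']
  intro u hu
  refine Submodule.span_induction ?_ (inner_zero_right _) ?_ ?_ hu
  · rintro _ ⟨k, rfl⟩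
    have hk := h k
    rw [coeff_eq_inner, coeff_eq_inner] at hk
    have hk' := mul_left_cancel₀ (inv_ne_zero (Complex.ofReal_ne_zero.2 (by positivity))) hk
    rw [inner_eq_zero_symm, Function.comp_apply, inner_sub_right, hk', sub_self]
  · intro a b _ _ ha hb
    rw [inner_add_right, ha, hb, add_zero]
  · intro c a _ ha
    rw [inner_smul_right, ha, mul_zero]

theorem integrable_L2T {d : ℕ} (f : L2T d) : Integrable f volume :=
  (Lp.memLp f).integrable (by norm_num)

theorem integrable_mul_torusChar {d : ℕ} {f : Torus d → ℂ} (hf : Integrable f) (k : Fin d → ℤ) :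
    Integrable fun x => f x * starRingEnd ℂ (torusChar k x) := by
  refine hf.mul_bdd (c := 1) ?_ (ae_of_all _ fun x => ?_)
  · exact (Complex.continuous_conj.comp (continuous_torusChar k)).aestronglyMeasurable
  · rw [RCLike.norm_conj, norm_torusChar]

theorem coeff_add {d : ℕ} {f g : Torus d → ℂ} (hf : Integrable f) (hg : Integrable g)
    (k : Fin d → ℤ) : coeff (fun x => f x + g x) k = coeff f k + coeff g k := by
  simp only [coeff, add_mul]
  rw [integral_add (integrable_mul_torusChar hf k) (integrable_mul_torusChar hg k), mul_add]

theorem coeff_const_mul {d : ℕ} (a : ℂ) (f : Torus d → ℂ) (k : Fin d → ℤ) :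
    coeff (fun x => a * f x) k = a * coeff f k := by
  simp only [coeff, mul_assoc, integral_const_mul]
  ring

theorem coeff_conj {d : ℕ} (f : Torus d → ℂ) (k : Fin d → ℤ) :
    coeff (fun x => starRingEnd ℂ (f x)) k = starRingEnd ℂ (coeff f (-k)) := by
  simp only [coeff, map_mul, ← integral_conj, torusChar_neg, RCLike.conj_conj, map_inv₀,
    Complex.conj_ofReal]

theorem coeff_torusChar {d : ℕ} (k l : Fin d → ℤ) :
    coeff (torusChar k) l = if k = l then 1 else 0 := by
  rw [coeff]
  have : ∀ x : Torus d, torusChar k x * starRingEnd ℂ (torusChar l x) = torusChar (k - l) x := by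
    intro x
    rw [sub_eq_add_neg, torusChar_add, torusChar_neg]
  simp only [this, integral_torusChar, sub_eq_zero]
  split_ifs
  · rw [inv_mul_cancel₀]
    exact_mod_cast (by positivity : ((2 * Real.pi) ^ d : ℝ) ≠ 0)
  · simp

theorem coeff_torusChar_mul {d : ℕ} (j : Fin d → ℤ) (g : Torus d → ℂ) (k : Fin d → ℤ) :
    coeff (fun x => torusChar j x * g x) k = coeff g (k - j) := by
  simp only [coeff]
  congr 2
  ext x
  rw [sub_eq_add_neg, torusChar_add, torusChar_neg, map_mul, RCLike.conj_conj]
  ring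

theorem coeff_toL2 {d : ℕ} (f : C(Torus d, ℂ)) (k : Fin d → ℤ) : coeff (toL2 d f) k = coeff f k :=
  coeff_congr (coeFn_toL2 f) k

theorem continuous_coeff_L2 {d : ℕ} (k : Fin d → ℤ) : Continuous fun f : L2T d => coeff f k := by
  simp only [coeff_eq_inner]
  fun_prop

theorem norm_coeff_le {d : ℕ} {f : Torus d → ℂ} {C : ℝ} (h : ∀ x, ‖f x‖ ≤ C) (k : Fin d → ℤ) :
    ‖coeff f k‖ ≤ C := by
  have hv : volume.real (univ : Set (Torus d)) = (2 * Real.pi) ^ d := by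
    rw [Measure.real, volume_pi, Measure.pi_univ]
    simp [AddCircle.measure_univ, Real.pi_pos.le]
  have h1 : ‖∫ x, f x * starRingEnd ℂ (torusChar k x)‖ ≤ C * volume.real (univ : Set (Torus d)) := by
    refine norm_integral_le_of_norm_le_const (ae_of_all _ fun x => ?_)
    rw [norm_mul, RCLike.norm_conj, norm_torusChar, mul_one]
    exact h x
  rw [coeff, norm_mul, norm_inv, Complex.norm_real, Real.norm_of_nonneg (by positivity)]
  rw [hv] at h1
  rw [inv_mul_le_iff₀ (by positivity)]
  exact h1.trans_eq (mul_comm _ _)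

theorem continuousMap_ext_coeff {d : ℕ} {f g : C(Torus d, ℂ)} (h : ∀ k, coeff f k = coeff g k) :
    f = g := by
  have : toL2 d f = toL2 d g := L2T.ext_coeff fun k => by rw [coeff_toL2, coeff_toL2, h]
  exact ContinuousMap.toLp_injective (p := 2) (𝕜 := ℂ) volume this

/-! ### The Sobolev space `H^r` in Fourier coordinates -/

/-- The Fourier coefficient as a continuous linear functional. -/
noncomputable def coeffCLM {d : ℕ} (k : Fin d → ℤ) : L2T d →L[ℂ] ℂ :=
  ((((2 * Real.pi) ^ d : ℝ) : ℂ)⁻¹) • innerSL ℂ (toL2 d (charC k))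

theorem coeffCLM_apply {d : ℕ} (k : Fin d → ℤ) (f : L2T d) : coeffCLM k f = coeff f k := by
  simp [coeffCLM, coeff_eq_inner]

theorem enorm_div_wt {d : ℕ} (r : ℕ) (z : ℂ) (k : Fin d → ℤ) :
    ‖z / (wt k : ℂ) ^ r‖ₑ = ‖z‖ₑ * ENNReal.ofReal ((wt k)⁻¹ ^ r) := by
  rw [div_eq_mul_inv, enorm_mul, ← inv_pow, enorm_pow, ← Complex.ofReal_inv,
    ENNReal.ofReal_pow (inv_nonneg.2 (wt_pos k).le), ← ofReal_norm (((wt k)⁻¹ : ℝ) : ℂ),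
    Complex.norm_real, Real.norm_of_nonneg (inv_nonneg.2 (wt_pos k).le)]

theorem tsum_enorm_div_wt_sq_le {d : ℕ} (r : ℕ) (A : ESeq d) :
    (∑' k, ‖A k / (wt k : ℂ) ^ r‖ₑ) ^ 2 ≤ ‖A‖ₑ ^ 2 * wtSum d r := by
  simp only [enorm_div_wt]
  rw [enorm_sq_eq_tsum]
  exact tsum_mul_sq_le _ _

theorem tsum_enorm_div_wt_ne_top {d r : ℕ} (hr : d < 2 * r) (A : ESeq d) :
    ∑' k, ‖A k / (wt k : ℂ) ^ r‖ₑ ≠ ∞ := by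
  intro h
  have h1 := tsum_enorm_div_wt_sq_le r A
  rw [h] at h1
  have h2 := wtSum_ne_top hr
  have : ‖A‖ₑ ^ 2 * wtSum d r ≠ ∞ := by finiteness
  exact this (top_le_iff.1 (by simpa using h1))

theorem summable_norm_div_wt {d r : ℕ} (hr : d < 2 * r) (A : ESeq d) :
    Summable fun k => ‖A k / (wt k : ℂ) ^ r‖ := by
  have := ENNReal.summable_toReal (tsum_enorm_div_wt_ne_top hr A)
  simpa using this

/-- The function whose Fourier coefficients are `A k / (1 + |k|²)^{r/2}`. -/
noncomputable def Phi {d : ℕ} (r : ℕ) (A : ESeq d) : C(Torus d, ℂ) :=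
  ∑' k, (A k / (wt k : ℂ) ^ r) • charC k

theorem norm_smul_charC_le {d : ℕ} (z : ℂ) (k : Fin d → ℤ) : ‖z • (charC k : C(Torus d, ℂ))‖ ≤ ‖z‖ := by
  rw [norm_smul]
  exact mul_le_of_le_one_right (norm_nonneg _) (norm_charC_le k)

theorem hasSum_Phi {d r : ℕ} (hr : d < 2 * r) (A : ESeq d) :
    HasSum (fun k => (A k / (wt k : ℂ) ^ r) • charC k) (Phi r A) :=
  (Summable.of_norm_bounded (summable_norm_div_wt hr A) fun k =>
    norm_smul_charC_le _ k).hasSum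

/-- The convolution formula. Only one factor is expanded: f ↦ coeff (f g) k is continuous for
uniform convergence, so it can be applied termwise to the series of `Phi r A`. The case g = 1 gives
`coeff_Phi`. -/
theorem coeff_Phi_mul {d r : ℕ} (hr : d < 2 * r) (A : ESeq d) (g : C(Torus d, ℂ)) (k : Fin d → ℤ) :
    HasSum (fun j => (A j / (wt j : ℂ) ^ r) * coeff g (k - j)) (coeff (Phi r A * g) k) := by
  let F : C(Torus d, ℂ) →L[ℂ] ℂ :=
    (coeffCLM k).comp ((toL2 d).comp ((ContinuousLinearMap.mul ℂ C(Torus d, ℂ)).flip g))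
  have hF : ∀ f, F f = coeff (f * g : C(Torus d, ℂ)) k := fun f => by
    simp [F, coeffCLM_apply, coeff_toL2, mul_comm]
  have h := (hasSum_Phi hr A).mapL F
  rw [hF] at h
  convert h using 2 with j
  rw [map_smul, hF, smul_eq_mul]
  congr 1
  exact (coeff_torusChar_mul j g k).symm

theorem coeff_Phi {d r : ℕ} (hr : d < 2 * r) (A : ESeq d) (k : Fin d → ℤ) :
    coeff (Phi r A) k = A k / (wt k : ℂ) ^ r := by
  have h := (coeff_Phi_mul hr A 1 k).tsum_eq
  have h1 : ∀ l : Fin d → ℤ, coeff (1 : C(Torus d, ℂ)) l = if l = 0 then 1 else 0 := by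
    intro l
    have : ((1 : C(Torus d, ℂ)) : Torus d → ℂ) = torusChar 0 := by
      ext x; simp [torusChar_zero]
    rw [this, coeff_torusChar]
    simp only [eq_comm]
  simp only [h1, sub_eq_zero, mul_ite, mul_one, mul_zero] at h
  rw [tsum_ite_eq'] at h
  exact h.symm

theorem Phi_injective {d r : ℕ} (hr : d < 2 * r) : Function.Injective (Phi (d := d) r) := by
  intro A B h
  ext k
  have h1 := coeff_Phi hr A k
  rw [h, coeff_Phi hr B k] at h1
  exact ((div_left_inj' (pow_ne_zero r (wt_ne_zero k))).1 h1).symm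

theorem Phi_add {d r : ℕ} (hr : d < 2 * r) (A B : ESeq d) : Phi r (A + B) = Phi r A + Phi r B := by
  rw [Phi, ← ((hasSum_Phi hr A).add (hasSum_Phi hr B)).tsum_eq]
  congr 1; ext1 k
  simp only [lp.coeFn_add, Pi.add_apply, add_div, add_smul]

theorem Phi_smul {d r : ℕ} (hr : d < 2 * r) (z : ℂ) (A : ESeq d) : Phi r (z • A) = z • Phi r A := by
  rw [Phi, ← ((hasSum_Phi hr A).const_smul z).tsum_eq]
  congr 1; ext1 k
  simp only [lp.coeFn_smul, Pi.smul_apply, smul_eq_mul, smul_smul, mul_div_assoc]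

theorem Phi_sub {d r : ℕ} (hr : d < 2 * r) (A B : ESeq d) : Phi r (A - B) = Phi r A - Phi r B := by
  rw [eq_sub_iff_add_eq, ← Phi_add hr, sub_add_cancel]

theorem norm_Phi_le {d r : ℕ} (hr : d < 2 * r) (A : ESeq d) :
    ‖Phi r A‖ ≤ Real.sqrt (wtSum d r).toReal * ‖A‖ := by
  have h0 : ‖Phi r A‖ ≤ ∑' k, ‖A k / (wt k : ℂ) ^ r‖ :=
    tsum_of_norm_bounded (summable_norm_div_wt hr A).hasSum fun k => norm_smul_charC_le _ k
  refine h0.trans ?_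
  have h1 := ENNReal.toReal_mono (by have := wtSum_ne_top hr; finiteness)
    (tsum_enorm_div_wt_sq_le r A)
  rw [ENNReal.toReal_mul, ENNReal.toReal_pow, ENNReal.toReal_pow,
    ENNReal.tsum_toReal_eq (fun k => by finiteness)] at h1
  simp only [toReal_enorm] at h1
  refine abs_le_of_sq_le_sq' (a := ∑' k, ‖A k / (wt k : ℂ) ^ r‖) ?_ (by positivity) |>.2
  rw [mul_pow, Real.sq_sqrt ENNReal.toReal_nonneg]
  linarith

/-- The continuous linear embedding of `H^r`, in Fourier coordinates, into `C(𝕋^d)`. -/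
noncomputable def PhiCLM {d r : ℕ} (hr : d < 2 * r) : ESeq d →L[ℂ] C(Torus d, ℂ) :=
  LinearMap.mkContinuous
    { toFun := Phi r, map_add' := Phi_add hr, map_smul' := Phi_smul hr } _ (norm_Phi_le hr)

/-- The coordinates in `H^r` of a function on the torus. -/
noncomputable def enc {d : ℕ} (r : ℕ) (f : Torus d → ℂ) : ESeq d :=
  ofSeq fun k => (wt k : ℂ) ^ r * coeff f k

theorem coeff_enc {d r : ℕ} {f : Torus d → ℂ} (h : ∑' k, ‖(wt k : ℂ) ^ r * coeff f k‖ₑ ^ 2 ≠ ∞)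
    (k : Fin d → ℤ) : enc r f k / (wt k : ℂ) ^ r = coeff f k := by
  rw [enc, ofSeq_apply h, mul_div_cancel_left₀ _ (pow_ne_zero r (wt_ne_zero k))]

theorem Phi_enc {d r : ℕ} (hr : d < 2 * r) {f : C(Torus d, ℂ)}
    (h : ∑' k, ‖(wt k : ℂ) ^ r * coeff f k‖ₑ ^ 2 ≠ ∞) : Phi r (enc r f) = f :=
  continuousMap_ext_coeff fun k => by rw [coeff_Phi hr, coeff_enc h]

theorem toL2_Phi_enc {d r : ℕ} (hr : d < 2 * r) {f : L2T d}
    (h : ∑' k, ‖(wt k : ℂ) ^ r * coeff f k‖ₑ ^ 2 ≠ ∞) : toL2 d (Phi r (enc r f)) = f :=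
  L2T.ext_coeff fun k => by rw [coeff_toL2, coeff_Phi hr, coeff_enc h]

/-! ### The algebra property -/

/-- One of k - j and j carries at least half the weight of k, so the factor wt k ^ r is absorbed by
one of the two inverse weights. -/
theorem kernel_le {d : ℕ} (r : ℕ) (k j : Fin d → ℤ) :
    wt k ^ r * ((wt j)⁻¹ ^ r * (wt (k - j))⁻¹ ^ r) ≤
      2 ^ r * ((wt j)⁻¹ ^ r + (wt (k - j))⁻¹ ^ r) := by
  have p1 := wt_pos j
  have p2 := wt_pos (k - j)
  have h1 : wt k ^ r ≤ 2 ^ r * (wt (k - j) ^ r + wt j ^ r) := by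
    refine (pow_le_pow_left₀ (wt_pos k).le (wt_le_two_mul_max k j) r).trans ?_
    rw [mul_pow]
    gcongr
    rcases max_cases (wt (k - j)) (wt j) with ⟨h, _⟩ | ⟨h, _⟩ <;> rw [h]
    · exact le_add_of_nonneg_right (by positivity)
    · exact le_add_of_nonneg_left (by positivity)
  refine (mul_le_mul_of_nonneg_right h1 (by positivity)).trans_eq ?_
  simp only [inv_pow]
  field_simp

/-- The constant in the algebra property of `H^r`. -/
noncomputable def mulConst (d r : ℕ) : ℝ := Real.sqrt ((2 ^ r) ^ 2 * 4 * (wtSum d r).toReal)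

theorem mulConst_nonneg (d r : ℕ) : 0 ≤ mulConst d r := Real.sqrt_nonneg _

theorem tsum_kernel_le {d r : ℕ} (hr : d < 2 * r) (k : Fin d → ℤ) :
    ∑' j, ENNReal.ofReal (wt k ^ r * ((wt j)⁻¹ ^ r * (wt (k - j))⁻¹ ^ r)) ^ 2 ≤
      ENNReal.ofReal (mulConst d r) ^ 2 := by
  have hb : ∀ j, ENNReal.ofReal (wt k ^ r * ((wt j)⁻¹ ^ r * (wt (k - j))⁻¹ ^ r)) ^ 2 ≤
      ENNReal.ofReal ((2 ^ r) ^ 2 * 2) * (ENNReal.ofReal ((wt j)⁻¹ ^ r) ^ 2 +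
        ENNReal.ofReal ((wt (k - j))⁻¹ ^ r) ^ 2) := by
    intro j
    have p0 := wt_pos k
    have p1 := wt_pos j
    have p2 := wt_pos (k - j)
    rw [← ENNReal.ofReal_pow (by positivity), ← ENNReal.ofReal_pow (by positivity),
      ← ENNReal.ofReal_pow (by positivity), ← ENNReal.ofReal_add (by positivity) (by positivity),
      ← ENNReal.ofReal_mul (by positivity)]
    refine ENNReal.ofReal_le_ofReal ?_
    refine (pow_le_pow_left₀ (by positivity) (kernel_le r k j) 2).trans ?_
    rw [mul_pow, mul_assoc]
    gcongr
    nlinarith [sq_nonneg ((wt j)⁻¹ ^ r - (wt (k - j))⁻¹ ^ r)]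
  have hsub : ∑' j, ENNReal.ofReal ((wt (k - j))⁻¹ ^ r) ^ 2 = wtSum d r :=
    (Equiv.subLeft k).tsum_eq (fun j => ENNReal.ofReal ((wt j)⁻¹ ^ r) ^ 2)
  refine (ENNReal.tsum_le_tsum hb).trans ?_
  -- Both sums equal `wtSum d r`, the second after j ↦ k - j; together with the 2 from (a + b)² ≤
  -- 2(a² + b²) they produce the 4 in `mulConst`.
  rw [ENNReal.tsum_mul_left, ENNReal.tsum_add,
    hsub, ← wtSum,
    ← ENNReal.ofReal_pow (mulConst_nonneg d r), mulConst, Real.sq_sqrt (by positivity),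
    ENNReal.ofReal_mul (p := (2 ^ r) ^ 2 * 4) (by positivity),
    ENNReal.ofReal_toReal (wtSum_ne_top hr), ← two_mul, ← mul_assoc]
  refine le_of_eq ?_
  congr 1
  rw [← ENNReal.ofReal_ofNat 2, ← ENNReal.ofReal_mul (by positivity)]
  ring_nf

/-- Cauchy–Schwarz in the convolution variable separates the kernel, square-summable uniformly in k
because 2r > d, from |A j|² |B (k - j)|², whose double sum factorizes. -/
theorem tsum_coeff_mul_le {d r : ℕ} (hr : d < 2 * r) (A B : ESeq d) :
    ∑' k, ‖(wt k : ℂ) ^ r * coeff (Phi r A * Phi r B : C(Torus d, ℂ)) k‖ₑ ^ 2 ≤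
      ENNReal.ofReal (mulConst d r * ‖A‖ * ‖B‖) ^ 2 := by
  have hk : ∀ k, ‖(wt k : ℂ) ^ r * coeff (Phi r A * Phi r B : C(Torus d, ℂ)) k‖ₑ ^ 2 ≤
      ENNReal.ofReal (mulConst d r) ^ 2 * ∑' j, ‖A j‖ₑ ^ 2 * ‖B (k - j)‖ₑ ^ 2 := by
    intro k
    have h1 : ‖(wt k : ℂ) ^ r * coeff (Phi r A * Phi r B : C(Torus d, ℂ)) k‖ₑ ≤
        ∑' j, ENNReal.ofReal (wt k ^ r * ((wt j)⁻¹ ^ r * (wt (k - j))⁻¹ ^ r)) *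
          (‖A j‖ₑ * ‖B (k - j)‖ₑ) := by
      rw [← (coeff_Phi_mul hr A (Phi r B) k).tsum_eq, enorm_mul]
      refine (mul_le_mul_right enorm_tsum_le_tsum_enorm _).trans_eq ?_
      rw [← ENNReal.tsum_mul_left]
      congr 1; ext1 j
      rw [coeff_Phi hr, enorm_mul, enorm_div_wt, enorm_div_wt, enorm_pow,
        ← ofReal_norm (wt k : ℂ), Complex.norm_real, Real.norm_of_nonneg (wt_pos k).le,
        ENNReal.ofReal_mul (pow_nonneg (wt_pos k).le r),
        ENNReal.ofReal_mul (pow_nonneg (inv_nonneg.2 (wt_pos j).le) r),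
        ENNReal.ofReal_pow (wt_pos k).le]
      ring
    refine (pow_le_pow_left' h1 2).trans ((tsum_mul_sq_le _ _).trans ?_)
    simp only [mul_pow (‖A _‖ₑ)]
    exact mul_le_mul_left (tsum_kernel_le hr k) _
  refine (ENNReal.tsum_le_tsum hk).trans_eq ?_
  rw [ENNReal.tsum_mul_left, ENNReal.tsum_comm]
  have : ∀ j, ∑' k, ‖A j‖ₑ ^ 2 * ‖B (k - j)‖ₑ ^ 2 = ‖A j‖ₑ ^ 2 * ‖B‖ₑ ^ 2 := fun j => by
    rw [ENNReal.tsum_mul_left, enorm_sq_eq_tsum]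
    congr 1
    exact (Equiv.subRight j).tsum_eq (fun k => ‖B k‖ₑ ^ 2)
  simp only [this]
  rw [ENNReal.tsum_mul_right, ← enorm_sq_eq_tsum,
    ENNReal.ofReal_mul (by have := mulConst_nonneg d r; positivity),
    ENNReal.ofReal_mul (mulConst_nonneg d r), ofReal_norm, ofReal_norm]
  ring

/-- The product of two elements of `H^r`, in Fourier coordinates. -/
noncomputable def mulE {d : ℕ} (r : ℕ) (A B : ESeq d) : ESeq d :=
  enc r (Phi r A * Phi r B : C(Torus d, ℂ))

theorem Phi_mulE {d r : ℕ} (hr : d < 2 * r) (A B : ESeq d) :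
    Phi r (mulE r A B) = Phi r A * Phi r B :=
  Phi_enc hr (ne_top_of_le_ne_top (by finiteness) (tsum_coeff_mul_le hr A B))

theorem norm_mulE_le {d r : ℕ} (hr : d < 2 * r) (A B : ESeq d) :
    ‖mulE r A B‖ ≤ mulConst d r * ‖A‖ * ‖B‖ := by
  have h := tsum_coeff_mul_le hr A B
  refine norm_le_of_tsum_le (by have := mulConst_nonneg d r; positivity) ?_
  simp only [mulE, enc, ofSeq_apply (ne_top_of_le_ne_top (by finiteness) h)]
  exact h

/-- Complex conjugation on `H^r`, in Fourier coordinates. -/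
noncomputable def conjE {d : ℕ} (r : ℕ) (A : ESeq d) : ESeq d := enc r (star (Phi r A) : C(Torus d, ℂ))

theorem tsum_coeff_conj {d r : ℕ} (hr : d < 2 * r) (A : ESeq d) :
    ∑' k, ‖(wt k : ℂ) ^ r * coeff (star (Phi r A) : C(Torus d, ℂ)) k‖ₑ ^ 2 = ‖A‖ₑ ^ 2 := by
  rw [enorm_sq_eq_tsum, ← (Equiv.neg (Fin d → ℤ)).tsum_eq (fun k => ‖A k‖ₑ ^ 2)]
  congr 1; ext1 k
  have h := coeff_conj (Phi r A) k
  change coeff (star (Phi r A) : C(Torus d, ℂ)) k = _ at h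
  rw [h, coeff_Phi hr, wt_neg, map_div₀, map_pow, Complex.conj_ofReal,
    mul_div_cancel₀ _ (pow_ne_zero r (wt_ne_zero k)), Equiv.neg_apply, RCLike.enorm_conj]

theorem Phi_conjE {d r : ℕ} (hr : d < 2 * r) (A : ESeq d) : Phi r (conjE r A) = star (Phi r A) :=
  Phi_enc (f := star (Phi r A)) hr (by rw [tsum_coeff_conj hr]; finiteness)

theorem norm_conjE_le {d r : ℕ} (hr : d < 2 * r) (A : ESeq d) : ‖conjE r A‖ ≤ ‖A‖ := by
  have h := tsum_coeff_conj hr A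
  refine norm_le_of_tsum_le (norm_nonneg _) ?_
  simp only [conjE, enc, ofSeq_apply (ne_top_of_le_ne_top (by finiteness) h.le)]
  rw [ofReal_norm, h]

/-! ### The nonlinearity -/

theorem mulE_sub_left {d r : ℕ} (hr : d < 2 * r) (A B C : ESeq d) :
    mulE r (A - B) C = mulE r A C - mulE r B C :=
  Phi_injective hr (by simp only [Phi_mulE hr, Phi_sub hr, sub_mul])

theorem mulE_sub_right {d r : ℕ} (hr : d < 2 * r) (A B C : ESeq d) :
    mulE r C (A - B) = mulE r C A - mulE r C B :=
  Phi_injective hr (by simp only [Phi_mulE hr, Phi_sub hr, mul_sub])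

theorem conjE_sub {d r : ℕ} (hr : d < 2 * r) (A B : ESeq d) :
    conjE r (A - B) = conjE r A - conjE r B :=
  Phi_injective hr (by simp only [Phi_conjE hr, Phi_sub hr, star_sub])

/-- The function `|z|^{2n} z` on `H^r`, in Fourier coordinates. -/
noncomputable def powE {d : ℕ} (r : ℕ) (A : ESeq d) : ℕ → ESeq d
  | 0 => A
  | n + 1 => mulE r (mulE r A (conjE r A)) (powE r A n)

theorem Phi_powE {d r : ℕ} (hr : d < 2 * r) (A : ESeq d) (n : ℕ) (x : Torus d) :
    Phi r (powE r A n) x = ((‖Phi r A x‖ ^ (2 * n) : ℝ) : ℂ) * Phi r A x := by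
  induction n with
  | zero => simp [powE]
  | succ n ih =>
    rw [powE, Phi_mulE hr, ContinuousMap.mul_apply, ih, Phi_mulE hr, ContinuousMap.mul_apply,
      Phi_conjE hr, ContinuousMap.star_apply, ← starRingEnd_apply, Complex.mul_conj,
      Complex.normSq_eq_norm_sq]
    push_cast
    ring

/-- The nonlinear term on `H^r`, in Fourier coordinates. -/
noncomputable def nonlinE {d : ℕ} (r : ℕ) (c : ℝ) (p : ℕ) (A : ESeq d) : ESeq d :=
  (Complex.I * (c : ℂ)) • powE r A p

theorem Phi_nonlinE {d r : ℕ} (hr : d < 2 * r) (c : ℝ) (p : ℕ) (A : ESeq d) (x : Torus d) :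
    Phi r (nonlinE r c p A) x = nonlin c p (Phi r A x) := by
  rw [nonlinE, Phi_smul hr, ContinuousMap.smul_apply, Phi_powE hr, nonlin, smul_eq_mul]
  ring

/-- Telescoping the product. The bound is homogeneous of degree 2n in the two states, with a
constant valid for all of them; the scaling by M in `exists_traj_nonlin` depends on this. -/
theorem norm_powE_sub_le {d r : ℕ} (hr : d < 2 * r) (n : ℕ) :
    ∃ C : ℝ, 0 ≤ C ∧ ∀ A B : ESeq d,
      ‖powE r A n - powE r B n‖ ≤ C * (‖A‖ + ‖B‖) ^ (2 * n) * ‖A - B‖ := by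
  set K := mulConst d r with hK
  have hK0 : 0 ≤ K := mulConst_nonneg d r
  have hq : ∀ A : ESeq d, ‖mulE r A (conjE r A)‖ ≤ K * ‖A‖ ^ 2 := fun A => by
    refine (norm_mulE_le hr _ _).trans ?_
    rw [sq, ← mul_assoc]
    gcongr
    exact norm_conjE_le hr A
  have hq2 : ∀ A B : ESeq d, ‖mulE r A (conjE r A) - mulE r B (conjE r B)‖ ≤
      K * (‖A‖ + ‖B‖) * ‖A - B‖ := fun A B => by
    have : mulE r A (conjE r A) - mulE r B (conjE r B) =
        mulE r A (conjE r (A - B)) + mulE r (A - B) (conjE r B) := by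
      rw [conjE_sub hr, mulE_sub_left hr, mulE_sub_right hr]; abel
    rw [this]
    refine (norm_add_le _ _).trans ?_
    have h1 := (norm_mulE_le hr A (conjE r (A - B))).trans
      (mul_le_mul_of_nonneg_left (norm_conjE_le hr (A - B)) (by positivity))
    have h2 := (norm_mulE_le hr (A - B) (conjE r B)).trans
      (mul_le_mul_of_nonneg_left (norm_conjE_le hr B) (by positivity))
    rw [← hK] at h1 h2
    linarith
  induction n with
  | zero => exact ⟨1, zero_le_one, fun A B => by simp [powE]⟩
  | succ n ih =>
    obtain ⟨C, hC, h⟩ := ih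
    have h0 : powE r (0 : ESeq d) n = 0 := by
      refine Phi_injective hr ?_
      ext x
      have hz : Phi r (0 : ESeq d) = 0 := by simpa using Phi_smul hr 0 (0 : ESeq d)
      rw [Phi_powE hr, hz]; simp
    have hb : ∀ B : ESeq d, ‖powE r B n‖ ≤ C * ‖B‖ ^ (2 * n) * ‖B‖ := fun B => by
      simpa [h0] using h B 0
    refine ⟨2 * K ^ 2 * C, by positivity, fun A B => ?_⟩
    have : powE r A (n + 1) - powE r B (n + 1) =
        mulE r (mulE r A (conjE r A)) (powE r A n - powE r B n) +
        mulE r (mulE r A (conjE r A) - mulE r B (conjE r B)) (powE r B n) := by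
      rw [powE, powE, mulE_sub_left hr, mulE_sub_right hr]; abel
    rw [this]
    refine (norm_add_le _ _).trans ?_
    set M := ‖A‖ + ‖B‖ with hM
    set D := ‖A - B‖
    have hA : ‖A‖ ≤ M := by simp [hM]
    have hB : ‖B‖ ≤ M := by simp [hM]
    have h1 : ‖mulE r (mulE r A (conjE r A)) (powE r A n - powE r B n)‖ ≤
        K * (K * M ^ 2) * (C * M ^ (2 * n) * D) := by
      refine (norm_mulE_le hr _ _).trans ?_
      gcongr
      · exact (hq A).trans (by gcongr)
      · exact h A B
    have h2 : ‖mulE r (mulE r A (conjE r A) - mulE r B (conjE r B)) (powE r B n)‖ ≤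
        K * (K * M * D) * (C * M ^ (2 * n) * M) := by
      refine (norm_mulE_le hr _ _).trans ?_
      gcongr
      · exact hq2 A B
      · exact (hb B).trans (by gcongr)
    refine (add_le_add h1 h2).trans_eq ?_
    ring

theorem norm_nonlinE_sub_le {d r : ℕ} (hr : d < 2 * r) (c : ℝ) (p : ℕ) :
    ∃ C : ℝ, 0 ≤ C ∧ ∀ A B : ESeq d,
      ‖nonlinE r c p A - nonlinE r c p B‖ ≤ C * (‖A‖ + ‖B‖) ^ (2 * p) * ‖A - B‖ := by
  obtain ⟨C, hC, h⟩ := norm_powE_sub_le (d := d) hr p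
  refine ⟨|c| * C, by positivity, fun A B => ?_⟩
  rw [nonlinE, nonlinE, ← smul_sub, norm_smul, norm_mul, Complex.norm_I, one_mul,
    Complex.norm_real, Real.norm_eq_abs, mul_assoc, mul_assoc, ← mul_assoc C]
  exact mul_le_mul_of_nonneg_left (h A B) (abs_nonneg c)

theorem nonlin_mul (c : ℝ) (p : ℕ) (μ z : ℂ) :
    nonlin c p (μ * z) = ((‖μ‖ ^ (2 * p) : ℝ) : ℂ) * μ * nonlin c p z := by
  simp only [nonlin, norm_mul, mul_pow]
  push_cast
  ring

theorem nonlinE_smul {d r : ℕ} (hr : d < 2 * r) (c : ℝ) (p : ℕ) (μ : ℂ) (A : ESeq d) :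
    nonlinE r c p (μ • A) = (((‖μ‖ ^ (2 * p) : ℝ) : ℂ) * μ) • nonlinE r c p A := by
  refine Phi_injective hr ?_
  ext x
  simp only [Phi_nonlinE hr, Phi_smul hr, ContinuousMap.smul_apply, smul_eq_mul, nonlin_mul]

theorem nonlinE_zero {d r : ℕ} (hr : d < 2 * r) (c : ℝ) (p : ℕ) :
    nonlinE r c p (0 : ESeq d) = 0 := by
  have := nonlinE_smul hr c p 0 (0 : ESeq d)
  simpa using this

theorem continuous_nonlinE {d r : ℕ} (hr : d < 2 * r) (c : ℝ) (p : ℕ) :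
    Continuous (nonlinE (d := d) r c p) := by
  obtain ⟨C, hC, h⟩ := norm_nonlinE_sub_le (d := d) hr c p
  refine continuous_iff_continuousAt.2 fun B => ?_
  rw [ContinuousAt, tendsto_iff_norm_sub_tendsto_zero]
  refine squeeze_zero (fun _ => norm_nonneg _) (fun A => h A B) ?_
  have : Continuous fun A : ESeq d => C * (‖A‖ + ‖B‖) ^ (2 * p) * ‖A - B‖ := by fun_prop
  have h2 := this.tendsto B
  simpa using h2

/-! ### The scalar Duhamel formula -/

/-- The Duhamel integral of the scalar equation `y' = -l y + f`. -/
noncomputable def duhamel (l : ℂ) (a : ℝ) (f : ℝ → ℂ) (t : ℝ) : ℂ :=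
  ∫ τ in a..t, Complex.exp (-l * (t - τ : ℝ)) * f τ

theorem norm_exp_symb (l : ℂ) (t : ℝ) : ‖Complex.exp (-l * (t : ℝ))‖ = Real.exp (-l.re * t) := by
  rw [Complex.norm_exp]; simp

theorem duhamel_eq (l : ℂ) (a : ℝ) (f : ℝ → ℂ) (t : ℝ) :
    duhamel l a f t = Complex.exp (-l * t) * ∫ τ in a..t, Complex.exp (l * τ) * f τ := by
  rw [duhamel, ← intervalIntegral.integral_const_mul]
  congr 1; ext τ
  rw [← mul_assoc, ← Complex.exp_add]
  congr 2
  push_cast; ring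

theorem intervalIntegrable_exp_mul {f : ℝ → ℂ} {a b : ℝ} (hf : IntervalIntegrable f volume a b)
    (l : ℂ) : IntervalIntegrable (fun τ : ℝ => Complex.exp (l * τ) * f τ) volume a b :=
  hf.continuousOn_mul (by fun_prop)

theorem continuousOn_duhamel {f : ℝ → ℂ} {a b : ℝ} (hab : a ≤ b)
    (hf : IntervalIntegrable f volume a b) (l : ℂ) :
    ContinuousOn (duhamel l a f) (Icc a b) := by
  have h : ContinuousOn (fun t => ∫ τ in a..t, Complex.exp (l * τ) * f τ) (Icc a b) := by
    have := intervalIntegral.continuousOn_primitive_interval' (intervalIntegrable_exp_mul hf l) left_mem_uIcc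
    rwa [uIcc_of_le hab] at this
  have h2 : duhamel l a f = fun t : ℝ => Complex.exp (-l * t) *
      ∫ τ in a..t, Complex.exp (l * τ) * f τ := funext fun t => duhamel_eq l a f t
  rw [h2]
  exact ContinuousOn.mul (by fun_prop) h

theorem integral_exp_kernel (l : ℂ) (s t : ℝ) :
    ∫ τ in s..t, l * Complex.exp (-l * (τ - s : ℝ)) = 1 - Complex.exp (-l * (t - s : ℝ)) := by
  have h : ∀ τ ∈ uIcc s t, HasDerivAt (fun τ : ℝ => -Complex.exp (-l * (τ - s : ℝ)))
      (l * Complex.exp (-l * (τ - s : ℝ))) τ := by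
    intro τ _
    have h1 : HasDerivAt (fun τ : ℝ => -l * ((τ - s : ℝ) : ℂ)) (-l * 1) τ := by
      have := ((hasDerivAt_id τ).sub_const s).ofReal_comp
      exact (by simpa using this.const_mul (-l))
    have h2 := h1.cexp.neg
    exact h2.congr_deriv (by ring)
  rw [intervalIntegral.integral_eq_sub_of_hasDerivAt h
    (Continuous.intervalIntegrable (by fun_prop) _ _)]
  simp
  ring

/-- Fubini on the triangle σ ≤ τ, the inner integral being 1 - exp(-l(t - σ)). Since f is only
integrable, this takes the place of differentiating the Duhamel integral. -/
theorem integral_duhamel {f : ℝ → ℂ} {a t : ℝ} (hat : a ≤ t)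
    (hf : IntervalIntegrable f volume a t) (l : ℂ) :
    ∫ τ in a..t, l * duhamel l a f τ = (∫ τ in a..t, f τ) - duhamel l a f t := by
  set μ : Measure ℝ := volume.restrict (Ioc a t) with hμ
  have hfi : Integrable f μ := (intervalIntegrable_iff_integrableOn_Ioc_of_le hat).1 hf
  let K : ℝ → ℝ → ℂ := fun τ σ => if σ ≤ τ then l * Complex.exp (-l * (τ - σ : ℝ)) else 0
  have hKm : Measurable (Function.uncurry K) := by
    refine Measurable.ite (measurableSet_le measurable_snd measurable_fst) ?_ measurable_const
    exact Continuous.measurable (by fun_prop)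
  have hK : ∀ σ ∈ Ioc a t, ∀ τ ∈ Ioc a t, ‖K τ σ‖ ≤ ‖l‖ * Real.exp (|l.re| * (t - a)) := by
    intro σ hσ τ hτ
    simp only [K]
    split_ifs with h
    · rw [norm_mul, norm_exp_symb]
      refine mul_le_mul_of_nonneg_left (Real.exp_le_exp.2 ?_) (norm_nonneg _)
      refine mul_le_mul ((neg_le_abs l.re)) ?_ (by linarith) (abs_nonneg _)
      linarith [hσ.1, hτ.2]
    · rw [norm_zero]; positivity
  have hint : Integrable (Function.uncurry fun τ σ => K τ σ * f σ) (μ.prod μ) := by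
    have h1 : Integrable (fun z : ℝ × ℝ => f z.2) (μ.prod μ) := hfi.comp_snd μ
    refine h1.bdd_mul (c := ‖l‖ * Real.exp (|l.re| * (t - a))) hKm.aestronglyMeasurable ?_
    rw [hμ, Measure.prod_restrict]
    filter_upwards [ae_restrict_mem (measurableSet_Ioc.prod measurableSet_Ioc)] with z hz
    exact hK z.2 hz.2 z.1 hz.1
  have hswap := integral_integral_swap hint
  have hL : ∫ τ, ∫ σ, K τ σ * f σ ∂μ ∂μ = ∫ τ in a..t, l * duhamel l a f τ := by
    rw [intervalIntegral.integral_of_le hat]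
    refine setIntegral_congr_fun measurableSet_Ioc fun τ hτ => ?_
    rw [duhamel, intervalIntegral.integral_of_le hτ.1.le, ← integral_const_mul, hμ,
      ← integral_indicator measurableSet_Ioc, ← integral_indicator measurableSet_Ioc]
    congr 1; ext σ
    by_cases h1 : σ ∈ Ioc a τ
    · have h2 : σ ∈ Ioc a t := ⟨h1.1, h1.2.trans hτ.2⟩
      rw [indicator_of_mem h1, indicator_of_mem h2]
      simp only [K, if_pos h1.2]; ring
    · rw [indicator_of_notMem h1]
      by_cases h2 : σ ∈ Ioc a t
      · rw [indicator_of_mem h2]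
        have : ¬ σ ≤ τ := fun h => h1 ⟨h2.1, h⟩
        simp only [K, if_neg this, zero_mul]
      · rw [indicator_of_notMem h2]
  have hR : ∫ σ, ∫ τ, K τ σ * f σ ∂μ ∂μ = (∫ τ in a..t, f τ) - duhamel l a f t := by
    have h2 : IntervalIntegrable (fun τ : ℝ => Complex.exp (-l * (t - τ : ℝ)) * f τ) volume a t :=
      hf.continuousOn_mul (by fun_prop)
    rw [duhamel, ← intervalIntegral.integral_sub hf h2, intervalIntegral.integral_of_le hat]
    refine setIntegral_congr_fun measurableSet_Ioc fun σ hσ => ?_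
    rw [integral_mul_const]
    have : ∫ τ, K τ σ ∂μ = 1 - Complex.exp (-l * (t - σ : ℝ)) := by
      rw [← integral_exp_kernel, intervalIntegral.integral_of_le hσ.2, hμ,
        ← integral_Icc_eq_integral_Ioc (x := σ), ← integral_indicator measurableSet_Icc, ← integral_indicator measurableSet_Ioc]
      congr 1; ext τ
      by_cases h1 : τ ∈ Icc σ t
      · have h2 : τ ∈ Ioc a t := ⟨hσ.1.trans_le h1.1, h1.2⟩
        rw [indicator_of_mem h1, indicator_of_mem h2]
        simp only [K, if_pos h1.1]
      · rw [indicator_of_notMem h1]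
        by_cases h2 : τ ∈ Ioc a t
        · rw [indicator_of_mem h2]
          have : ¬ σ ≤ τ := fun h => h1 ⟨h, h2.2⟩
          simp only [K, if_neg this]
        · rw [indicator_of_notMem h2]
    rw [this]; ring
  rw [← hL, ← hR, hswap]

/-- The mild solution of `y' = -l y + f`, `y(a) = v`, solves the equation integrated in time. -/
theorem mild_eq_integral {f : ℝ → ℂ} {a t : ℝ} (hat : a ≤ t)
    (hf : IntervalIntegrable f volume a t) (l v : ℂ) :
    Complex.exp (-l * (t - a : ℝ)) * v + duhamel l a f t =
      v + ∫ τ in a..t, (-(l * (Complex.exp (-l * (τ - a : ℝ)) * v + duhamel l a f τ)) + f τ) := by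
  have hD : IntervalIntegrable (fun τ => l * duhamel l a f τ) volume a t := by
    refine ContinuousOn.intervalIntegrable ?_
    rw [uIcc_of_le hat]
    exact continuousOn_const.mul (continuousOn_duhamel hat hf l)
  have hE : IntervalIntegrable (fun τ : ℝ => l * Complex.exp (-l * (τ - a : ℝ)) * v) volume a t :=
    Continuous.intervalIntegrable (by fun_prop) _ _
  have : (fun τ : ℝ => -(l * (Complex.exp (-l * (τ - a : ℝ)) * v + duhamel l a f τ)) + f τ) =
      fun τ => f τ - l * duhamel l a f τ - l * Complex.exp (-l * (τ - a : ℝ)) * v := by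
    ext τ; ring
  rw [this, intervalIntegral.integral_sub (hf.sub hD) hE, intervalIntegral.integral_sub hf hD,
    integral_duhamel hat hf, intervalIntegral.integral_mul_const, integral_exp_kernel]
  ring

/-! ### Estimates for the scalar Duhamel formula -/

theorem enorm_duhamel_le (l : ℂ) {a t : ℝ} (hat : a ≤ t) (f : ℝ → ℂ) :
    ‖duhamel l a f t‖ₑ ≤
      ∫⁻ τ in Ioc a t, ENNReal.ofReal (Real.exp (-l.re * (t - τ))) * ‖f τ‖ₑ := by
  rw [duhamel, intervalIntegral.integral_of_le hat]
  refine (enorm_integral_le_lintegral_enorm _).trans_eq ?_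
  congr 1; ext τ
  rw [enorm_mul, ← ofReal_norm, norm_exp_symb]

/-- No smoothing is used here, only that the kernel has modulus at most 1. The factor b - a makes
forcing terms valued in H^s negligible over short times. -/
theorem enorm_duhamel_sq_le_length_mul {l : ℂ} (hl : 0 ≤ l.re) {a b t : ℝ} (ht : t ∈ Icc a b)
    {f : ℝ → ℂ} (hf : AEStronglyMeasurable f (volume.restrict (Icc a b))) :
    ‖duhamel l a f t‖ₑ ^ 2 ≤ ENNReal.ofReal (b - a) * ∫⁻ τ in Icc a b, ‖f τ‖ₑ ^ 2 := by
  have hsub : Ioc a t ⊆ Icc a b := fun x hx => ⟨hx.1.le, hx.2.trans ht.2⟩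
  have h1 : ‖duhamel l a f t‖ₑ ≤ ∫⁻ τ in Icc a b, 1 * ‖f τ‖ₑ := by
    refine (enorm_duhamel_le l ht.1 f).trans ?_
    refine (setLIntegral_mono' measurableSet_Ioc fun τ hτ => ?_).trans (lintegral_mono_set hsub)
    gcongr
    rw [← ENNReal.ofReal_one]
    refine ENNReal.ofReal_le_ofReal ?_
    rw [Real.exp_le_one_iff]
    nlinarith [hτ.2]
  refine (pow_le_pow_left' h1 2).trans ((lintegral_mul_sq_le _ (by fun_prop) hf.enorm).trans ?_)
  simp

/-- The heat kernel of a Fourier mode. -/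
noncomputable def modeKernel (m t : ℝ) : ℝ≥0∞ :=
  if 0 ≤ t then ENNReal.ofReal (Real.exp (-m * t)) else 0

theorem measurable_modeKernel (m : ℝ) : Measurable (modeKernel m) :=
  Measurable.ite measurableSet_Ici (by fun_prop) measurable_const

theorem modeKernel_le_one {m : ℝ} (hm : 0 ≤ m) (t : ℝ) : modeKernel m t ≤ 1 := by
  unfold modeKernel
  split_ifs with h
  · rw [← ENNReal.ofReal_one]
    refine ENNReal.ofReal_le_ofReal ?_
    rw [Real.exp_le_one_iff]; nlinarith
  · exact zero_le_one

theorem lintegral_modeKernel {m : ℝ} (hm : 0 < m) : ∫⁻ t, modeKernel m t = ENNReal.ofReal m⁻¹ := by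
  have h1 : ∫⁻ t, modeKernel m t = ∫⁻ t in Ici 0, ENNReal.ofReal (Real.exp (-m * t)) := by
    rw [← lintegral_indicator measurableSet_Ici]
    congr 1
  have h2 : IntegrableOn (fun t => Real.exp (-m * t)) (Ioi 0) := integrableOn_exp_mul_Ioi (by linarith) 0
  rw [h1, setLIntegral_congr Ioi_ae_eq_Ici.symm,
    ← ofReal_integral_eq_lintegral_ofReal h2 (ae_of_all _ fun t => (Real.exp_pos _).le),
    integral_exp_mul_Ioi (by linarith)]
  congr 1
  simp

theorem lintegral_modeKernel_sub {m : ℝ} (hm : 0 < m) (t : ℝ) :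
    ∫⁻ τ, modeKernel m (t - τ) = ENNReal.ofReal m⁻¹ := by
  rw [← lintegral_modeKernel hm]
  exact lintegral_sub_left_eq_self _ t

/-- Cauchy–Schwarz after splitting the decaying kernel into two square roots; the first contributes
the total mass 1/m. As m grows like the squared weight, this gains one derivative pointwise in time.
-/
theorem enorm_duhamel_sq_le {l : ℂ} {m M : ℝ} (hm : 0 < m) {a b t : ℝ} (hba : b ≤ a + 1)
    (ht : t ∈ Icc a b)
    (hl : ∀ σ ∈ Icc (0 : ℝ) 1, Real.exp (-l.re * σ) ≤ M * Real.exp (-m * σ))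
    {f : ℝ → ℂ} (hf : AEStronglyMeasurable f (volume.restrict (Icc a b))) :
    ‖duhamel l a f t‖ₑ ^ 2 ≤ ENNReal.ofReal M ^ 2 * ENNReal.ofReal m⁻¹ *
      ∫⁻ τ in Icc a b, modeKernel m (t - τ) * ‖f τ‖ₑ ^ 2 := by
  have hM : 0 ≤ M := by
    have := hl 0 (by simp)
    simp only [mul_zero, Real.exp_zero, mul_one] at this
    linarith
  have hsub : Ioc a t ⊆ Icc a b := fun x hx => ⟨hx.1.le, hx.2.trans ht.2⟩
  have hh : ∀ x : ℝ≥0∞, x ^ (1 / 2 : ℝ) * x ^ (1 / 2 : ℝ) = x := fun x => by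
    rw [← ENNReal.rpow_add_of_nonneg _ _ (by norm_num) (by norm_num)]; norm_num
  have h1 : ‖duhamel l a f t‖ₑ ≤ ENNReal.ofReal M * ∫⁻ τ in Icc a b,
      (modeKernel m (t - τ)) ^ (1 / 2 : ℝ) * ((modeKernel m (t - τ)) ^ (1 / 2 : ℝ) * ‖f τ‖ₑ) := by
    refine (enorm_duhamel_le l ht.1 f).trans ?_
    rw [← lintegral_const_mul' _ _ (by finiteness)]
    refine (setLIntegral_mono' measurableSet_Ioc fun τ hτ => ?_).trans (lintegral_mono_set hsub)
    rw [← mul_assoc (_ ^ (1 / 2 : ℝ)), hh, ← mul_assoc]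
    gcongr
    rw [modeKernel, if_pos (by linarith [hτ.2]), ← ENNReal.ofReal_mul hM]
    exact ENNReal.ofReal_le_ofReal (hl _ ⟨by linarith [hτ.2], by linarith [hτ.1, ht.2]⟩)
  have hmk : Measurable fun τ => (modeKernel m (t - τ)) ^ (1 / 2 : ℝ) :=
    ((measurable_modeKernel m).comp (measurable_const.sub measurable_id)).pow_const _
  refine (pow_le_pow_left' h1 2).trans ?_
  rw [mul_pow, mul_assoc]
  gcongr
  refine (lintegral_mul_sq_le _ hmk.aemeasurable (hmk.aemeasurable.mul hf.enorm)).trans ?_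
  have h2 : ∀ τ, ((modeKernel m (t - τ)) ^ (1 / 2 : ℝ)) ^ 2 = modeKernel m (t - τ) := fun τ => by
    rw [sq, hh]
  simp only [Pi.mul_apply, mul_pow, h2]
  gcongr
  rw [← lintegral_modeKernel_sub hm t]
  exact setLIntegral_le_lintegral _ _

theorem enorm_duhamel_sq_le_sup {l : ℂ} {m M : ℝ} (hm : 0 < m) {a b t : ℝ} (hba : b ≤ a + 1)
    (ht : t ∈ Icc a b)
    (hl : ∀ σ ∈ Icc (0 : ℝ) 1, Real.exp (-l.re * σ) ≤ M * Real.exp (-m * σ))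
    {f : ℝ → ℂ} (hf : AEStronglyMeasurable f (volume.restrict (Icc a b))) :
    ‖duhamel l a f t‖ₑ ^ 2 ≤ ENNReal.ofReal M ^ 2 * ENNReal.ofReal m⁻¹ *
      ∫⁻ τ in Icc a b, ‖f τ‖ₑ ^ 2 := by
  refine (enorm_duhamel_sq_le hm hba ht hl hf).trans ?_
  gcongr with τ
  exact mul_le_of_le_one_left' (modeKernel_le_one hm.le _)

/-- Young's inequality: integrating the previous estimate in t yields a second factor 1/m, hence a
gain of two derivatives in L² of time. -/
theorem lintegral_duhamel_sq_le {l : ℂ} {m M : ℝ} (hm : 0 < m) {a b : ℝ} (hba : b ≤ a + 1)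
    (hl : ∀ σ ∈ Icc (0 : ℝ) 1, Real.exp (-l.re * σ) ≤ M * Real.exp (-m * σ))
    {f : ℝ → ℂ} (hf : AEStronglyMeasurable f (volume.restrict (Icc a b))) :
    ∫⁻ t in Icc a b, ‖duhamel l a f t‖ₑ ^ 2 ≤ (ENNReal.ofReal M * ENNReal.ofReal m⁻¹) ^ 2 *
      ∫⁻ τ in Icc a b, ‖f τ‖ₑ ^ 2 := by
  refine (setLIntegral_mono' measurableSet_Icc fun t ht =>
    enorm_duhamel_sq_le hm hba ht hl hf).trans ?_
  rw [lintegral_const_mul' _ _ (by finiteness), mul_pow, sq (ENNReal.ofReal m⁻¹), ← mul_assoc,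
    mul_assoc (_ * _) (ENNReal.ofReal m⁻¹)]
  gcongr
  have hmk : Measurable fun z : ℝ × ℝ => modeKernel m (z.1 - z.2) :=
    (measurable_modeKernel m).comp (measurable_fst.sub measurable_snd)
  rw [lintegral_lintegral_swap]
  · rw [← lintegral_const_mul' _ _ (by finiteness)]
    refine lintegral_mono fun τ => ?_
    have hmτ : Measurable fun t => modeKernel m (t - τ) :=
      (measurable_modeKernel m).comp (measurable_id.sub measurable_const)
    rw [lintegral_mul_const'' _ hmτ.aemeasurable]
    gcongr
    rw [← lintegral_modeKernel hm]
    refine (setLIntegral_le_lintegral _ _).trans_eq ?_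
    exact lintegral_sub_right_eq_self _ τ
  · exact hmk.aemeasurable.mul (hf.enorm.pow_const 2).comp_snd

/-! ### The linear equation in `H^s` -/

/-- The symbol `(ν + i)|k|² + γ` of the linear part. -/
noncomputable def symb {d : ℕ} (ν γ : ℝ) (k : Fin d → ℤ) : ℂ :=
  ((ν : ℂ) + Complex.I) * (freqSq k : ℂ) + (γ : ℂ)

theorem symb_re {d : ℕ} (ν γ : ℝ) (k : Fin d → ℤ) : (symb ν γ k).re = ν * freqSq k + γ := by
  simp [symb]

theorem symb_re_nonneg {d : ℕ} {ν γ : ℝ} (hν : 0 < ν) (hγ : 0 ≤ γ) (k : Fin d → ℤ) :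
    0 ≤ (symb ν γ k).re := by
  rw [symb_re]; have := freqSq_nonneg k; positivity

/-- On [0, 1] the factor exp ν pays for replacing |k|² by 1 + |k|². The mode k = 0, not damped when
γ = 0, is thereby treated like the others; this is why time intervals have length at most 1. -/
theorem exp_symb_le {d : ℕ} {ν γ : ℝ} (hν : 0 < ν) (hγ : 0 ≤ γ) (k : Fin d → ℤ) :
    ∀ σ ∈ Icc (0 : ℝ) 1,
      Real.exp (-(symb ν γ k).re * σ) ≤ Real.exp ν * Real.exp (-(ν * wt k ^ 2) * σ) := by
  intro σ hσ
  rw [← Real.exp_add, Real.exp_le_exp, symb_re, wt_sq]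
  nlinarith [mul_nonneg hγ hσ.1, mul_nonneg hν.le (sub_nonneg.2 hσ.2)]

theorem mode_pos {d : ℕ} {ν : ℝ} (hν : 0 < ν) (k : Fin d → ℤ) : 0 < ν * wt k ^ 2 := by
  have := wt_pos k; positivity

theorem ofReal_mode_inv {d : ℕ} {ν : ℝ} (hν : 0 < ν) (k : Fin d → ℤ) :
    ENNReal.ofReal (ν * wt k ^ 2)⁻¹ = ENNReal.ofReal ν⁻¹ * ENNReal.ofReal (wt k)⁻¹ ^ 2 := by
  have := wt_pos k
  rw [mul_inv, ENNReal.ofReal_mul (by positivity), ← ENNReal.ofReal_pow (by positivity), inv_pow]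

theorem ofReal_wt_mul_inv {d : ℕ} (k : Fin d → ℤ) :
    ENNReal.ofReal (wt k) * ENNReal.ofReal (wt k)⁻¹ = 1 := by
  rw [← ENNReal.ofReal_mul (wt_pos k).le, mul_inv_cancel₀ (wt_pos k).ne', ENNReal.ofReal_one]

/-- Dominated convergence for the series of squared differences of the coordinates, with majorant 4
· bnd. -/
theorem continuousOn_of_coord {d : ℕ} {g : ℝ → ESeq d} {S : Set ℝ} {bnd : (Fin d → ℤ) → ℝ≥0∞}
    (hg : ∀ k, ContinuousOn (fun t => g t k) S) (hb : ∀ t ∈ S, ∀ k, ‖g t k‖ₑ ^ 2 ≤ bnd k)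
    (hs : ∑' k, bnd k ≠ ∞) : ContinuousOn g S := by
  intro t₀ ht₀
  have hbk : ∀ k, bnd k ≠ ∞ := fun k => ENNReal.ne_top_of_tsum_ne_top hs k
  have hreal : ∀ t ∈ S, ∀ k, ‖g t k‖ ^ 2 ≤ (bnd k).toReal := fun t ht k => by
    have := ENNReal.toReal_mono (hbk k) (hb t ht k)
    simpa using this
  have hn : ∀ A : ESeq d, ‖A‖ ^ 2 = ∑' k, ‖A k‖ ^ 2 := fun A => by
    have h := lp.norm_rpow_eq_tsum (p := 2) (by norm_num) A
    simpa using h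
  rw [ContinuousWithinAt, tendsto_iff_norm_sub_tendsto_zero]
  have h2 : Tendsto (fun t => ‖g t - g t₀‖ ^ 2) (𝓝[S] t₀) (𝓝 0) := by
    simp only [hn]
    have h0 : (0 : ℝ) = ∑' _ : Fin d → ℤ, (0 : ℝ) := by simp
    rw [h0]
    refine tendsto_tsum_of_dominated_convergence
      ((ENNReal.summable_toReal hs).mul_left 4) (fun k => ?_) ?_
    · have h1 : Tendsto (fun t => g t k) (𝓝[S] t₀) (𝓝 (g t₀ k)) := hg k t₀ ht₀
      have h3 := ((h1.sub_const (g t₀ k)).norm).pow 2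
      simpa using h3
    · filter_upwards [self_mem_nhdsWithin] with t ht k
      rw [Real.norm_of_nonneg (by positivity), lp.coeFn_sub, Pi.sub_apply]
      have h1 := hreal t ht k
      have h3 := hreal t₀ ht₀ k
      have h4 := norm_sub_le (g t k) (g t₀ k)
      nlinarith [norm_nonneg (g t k), norm_nonneg (g t₀ k), norm_nonneg (g t k - g t₀ k),
        sq_nonneg (‖g t k‖ - ‖g t₀ k‖)]
  have h3 := h2.sqrt
  simpa [Real.sqrt_sq (norm_nonneg _)] using h3

/-- The norm of a forcing term in `L²([a, b]; H^{s-1})`, in the coordinates of `H^s`. -/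
noncomputable def forceNorm {d : ℕ} (a b : ℝ) (f : ℝ → (Fin d → ℤ) → ℂ) : ℝ≥0∞ :=
  ∑' k, ENNReal.ofReal (wt k)⁻¹ ^ 2 * ∫⁻ τ in Icc a b, ‖f τ k‖ₑ ^ 2

/-- Measurability on `[a, b]` of the modes of a forcing term. -/
def ForceMeas {d : ℕ} (a b : ℝ) (f : ℝ → (Fin d → ℤ) → ℂ) : Prop :=
  ∀ k, AEStronglyMeasurable (fun τ => f τ k) (volume.restrict (Icc a b))

theorem intervalIntegrable_of_sq {f : ℝ → ℂ} {a b : ℝ} (hab : a ≤ b)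
    (hf : AEStronglyMeasurable f (volume.restrict (Icc a b)))
    (h : ∫⁻ τ in Icc a b, ‖f τ‖ₑ ^ 2 ≠ ∞) : IntervalIntegrable f volume a b := by
  rw [intervalIntegrable_iff_integrableOn_Icc_of_le hab]
  refine ⟨hf, ?_⟩
  rw [hasFiniteIntegral_iff_enorm]
  have h1 := lintegral_mul_sq_le (volume.restrict (Icc a b)) (f := fun _ => 1) (by fun_prop) hf.enorm
  simp only [one_mul, one_pow, lintegral_const, Measure.restrict_apply_univ, Real.volume_Icc] at h1
  refine lt_top_iff_ne_top.2 fun h2 => ?_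
  rw [h2] at h1
  have : ENNReal.ofReal (b - a) * ∫⁻ τ in Icc a b, ‖f τ‖ₑ ^ 2 ≠ ∞ := by finiteness
  exact this (top_le_iff.1 (by simpa using h1))

theorem force_sq_ne_top {d : ℕ} {a b : ℝ} {f : ℝ → (Fin d → ℤ) → ℂ} (h : forceNorm a b f ≠ ∞)
    (k : Fin d → ℤ) : ∫⁻ τ in Icc a b, ‖f τ k‖ₑ ^ 2 ≠ ∞ := by
  have h1 := ENNReal.ne_top_of_tsum_ne_top h k
  intro h2
  rw [h2, ENNReal.mul_top] at h1
  · exact h1 rfl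
  · have := wt_pos k
    simpa using this

theorem force_intervalIntegrable {d : ℕ} {a b : ℝ} (hab : a ≤ b) {f : ℝ → (Fin d → ℤ) → ℂ}
    (hf : ForceMeas a b f) (h : forceNorm a b f ≠ ∞) (k : Fin d → ℤ) :
    IntervalIntegrable (fun τ => f τ k) volume a b :=
  intervalIntegrable_of_sq hab (hf k) (force_sq_ne_top h k)

/-- The Duhamel integral of a forcing term. -/
noncomputable def duhE {d : ℕ} (ν γ a : ℝ) (f : ℝ → (Fin d → ℤ) → ℂ) (t : ℝ) : ESeq d :=
  ofSeq fun k => duhamel (symb ν γ k) a (fun τ => f τ k) t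

section Duhamel

variable {d : ℕ} {ν γ a b : ℝ} (hν : 0 < ν) (hγ : 0 ≤ γ) (hab : a ≤ b) (hba : b ≤ a + 1)
  {f : ℝ → (Fin d → ℤ) → ℂ} (hf : ForceMeas a b f)

include hν hγ hba hf in
theorem duhamel_mode_le {t : ℝ} (ht : t ∈ Icc a b) (k : Fin d → ℤ) :
    ‖duhamel (symb ν γ k) a (fun τ => f τ k) t‖ₑ ^ 2 ≤
      ENNReal.ofReal (Real.exp ν) ^ 2 * ENNReal.ofReal ν⁻¹ *
        (ENNReal.ofReal (wt k)⁻¹ ^ 2 * ∫⁻ τ in Icc a b, ‖f τ k‖ₑ ^ 2) := by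
  refine (enorm_duhamel_sq_le_sup (mode_pos hν k) hba ht (exp_symb_le hν hγ k) (hf k)).trans_eq ?_
  rw [ofReal_mode_inv hν]; ring

include hν hγ hba hf in
theorem tsum_duhamel_le {t : ℝ} (ht : t ∈ Icc a b) :
    ∑' k, ‖duhamel (symb ν γ k) a (fun τ => f τ k) t‖ₑ ^ 2 ≤
      ENNReal.ofReal (Real.exp ν) ^ 2 * ENNReal.ofReal ν⁻¹ * forceNorm a b f := by
  rw [forceNorm, ← ENNReal.tsum_mul_left]
  exact ENNReal.tsum_le_tsum fun k => duhamel_mode_le hν hγ hba hf ht k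

include hν hγ hba hf in
theorem duhE_apply (h : forceNorm a b f ≠ ∞) {t : ℝ} (ht : t ∈ Icc a b) (k : Fin d → ℤ) :
    duhE ν γ a f t k = duhamel (symb ν γ k) a (fun τ => f τ k) t :=
  ofSeq_apply (f := fun k => duhamel (symb ν γ k) a (fun τ => f τ k) t)
    (ne_top_of_le_ne_top (by finiteness) (tsum_duhamel_le hν hγ hba hf ht)) k

include hν hγ hba hf in
theorem enorm_duhE_sq_le (h : forceNorm a b f ≠ ∞) {t : ℝ} (ht : t ∈ Icc a b) :
    ‖duhE ν γ a f t‖ₑ ^ 2 ≤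
      ENNReal.ofReal (Real.exp ν) ^ 2 * ENNReal.ofReal ν⁻¹ * forceNorm a b f := by
  rw [enorm_sq_eq_tsum]
  simp only [duhE_apply hν hγ hba hf h ht]
  exact tsum_duhamel_le hν hγ hba hf ht

include hν hγ hab hba hf in
theorem continuousOn_duhE (h : forceNorm a b f ≠ ∞) : ContinuousOn (duhE ν γ a f) (Icc a b) := by
  refine continuousOn_of_coord (bnd := fun k => ENNReal.ofReal (Real.exp ν) ^ 2 *
    ENNReal.ofReal ν⁻¹ * (ENNReal.ofReal (wt k)⁻¹ ^ 2 * ∫⁻ τ in Icc a b, ‖f τ k‖ₑ ^ 2)) ?_ ?_ ?_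
  · intro k
    exact (continuousOn_duhamel hab (force_intervalIntegrable hab hf h k) _).congr
      fun t ht => duhE_apply hν hγ hba hf h ht k
  · intro t ht k
    rw [duhE_apply hν hγ hba hf h ht]
    exact duhamel_mode_le hν hγ hba hf ht k
  · rw [ENNReal.tsum_mul_left, ← forceNorm]
    finiteness

include hν hγ hab hba hf in
-- Maximal regularity, mode by mode: the squared gain (1/m)² is ν⁻² times the weight to the power
-- -4, and turns the factor wt² of H^{s+1} into the wt⁻² in which the forcing is measured.
theorem lintegral_duhE_le (h : forceNorm a b f ≠ ∞) :
    ∫⁻ t in Icc a b, ∑' k, ENNReal.ofReal (wt k) ^ 2 * ‖duhE ν γ a f t k‖ₑ ^ 2 ≤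
      (ENNReal.ofReal (Real.exp ν) * ENNReal.ofReal ν⁻¹) ^ 2 * forceNorm a b f := by
  have h1 : ∫⁻ t in Icc a b, ∑' k, ENNReal.ofReal (wt k) ^ 2 * ‖duhE ν γ a f t k‖ₑ ^ 2 =
      ∫⁻ t in Icc a b, ∑' k, ENNReal.ofReal (wt k) ^ 2 *
        ‖duhamel (symb ν γ k) a (fun τ => f τ k) t‖ₑ ^ 2 :=
    setLIntegral_congr_fun measurableSet_Icc fun t ht => by
      simp only [duhE_apply hν hγ hba hf h ht]
  rw [h1, lintegral_tsum]
  · rw [forceNorm, ← ENNReal.tsum_mul_left]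
    refine ENNReal.tsum_le_tsum fun k => ?_
    rw [lintegral_const_mul' _ _ (by finiteness)]
    refine (mul_le_mul_right (lintegral_duhamel_sq_le (mode_pos hν k) hba (exp_symb_le hν hγ k)
      (hf k)) _).trans_eq ?_
    rw [ofReal_mode_inv hν]
    have := ofReal_wt_mul_inv k
    calc _ = (ENNReal.ofReal (Real.exp ν) * ENNReal.ofReal ν⁻¹) ^ 2 *
          ((ENNReal.ofReal (wt k) * ENNReal.ofReal (wt k)⁻¹) ^ 2 * (ENNReal.ofReal (wt k)⁻¹ ^ 2 *
            ∫⁻ τ in Icc a b, ‖f τ k‖ₑ ^ 2)) := by ring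
      _ = _ := by rw [this, one_pow, one_mul]
  · intro k
    have hc := (continuousOn_duhamel hab (force_intervalIntegrable hab hf h k)
      (symb ν γ k)).aestronglyMeasurable (μ := volume) measurableSet_Icc
    exact (hc.enorm.pow_const 2).const_mul _

end Duhamel

theorem lintegral_tsum_le_of_bound {d : ℕ} {a b R : ℝ} {f : ℝ → (Fin d → ℤ) → ℂ}
    (hf : ForceMeas a b f) (hR : ∀ τ ∈ Icc a b, ∑' k, ‖f τ k‖ₑ ^ 2 ≤ ENNReal.ofReal R ^ 2) :
    ∑' k, ∫⁻ τ in Icc a b, ‖f τ k‖ₑ ^ 2 ≤ ENNReal.ofReal R ^ 2 * ENNReal.ofReal (b - a) := by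
  rw [← lintegral_tsum fun k => ((hf k).enorm.pow_const 2)]
  refine (setLIntegral_mono' measurableSet_Icc hR).trans_eq ?_
  simp

theorem forceNorm_le_of_bound {d : ℕ} {a b R : ℝ} {f : ℝ → (Fin d → ℤ) → ℂ}
    (hf : ForceMeas a b f) (hR : ∀ τ ∈ Icc a b, ∑' k, ‖f τ k‖ₑ ^ 2 ≤ ENNReal.ofReal R ^ 2) :
    forceNorm a b f ≤ ENNReal.ofReal R ^ 2 * ENNReal.ofReal (b - a) := by
  refine (ENNReal.tsum_le_tsum fun k => ?_).trans (lintegral_tsum_le_of_bound hf hR)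
  refine mul_le_of_le_one_left' (pow_le_one' ?_ 2)
  rw [← ENNReal.ofReal_one]
  exact ENNReal.ofReal_le_ofReal (inv_le_one_of_one_le₀ (one_le_wt k))

theorem norm_duhE_le_of_bound {d : ℕ} {ν γ a b R : ℝ} (hν : 0 < ν) (hγ : 0 ≤ γ) (hR0 : 0 ≤ R)
    (hba : b ≤ a + 1) {f : ℝ → (Fin d → ℤ) → ℂ} (hf : ForceMeas a b f)
    (hR : ∀ τ ∈ Icc a b, ∑' k, ‖f τ k‖ₑ ^ 2 ≤ ENNReal.ofReal R ^ 2) {t : ℝ} (ht : t ∈ Icc a b) :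
    ‖duhE ν γ a f t‖ ≤ (b - a) * R := by
  have hab : 0 ≤ b - a := by linarith [ht.1, ht.2]
  have hfin : forceNorm a b f ≠ ∞ := ne_top_of_le_ne_top (by finiteness) (forceNorm_le_of_bound hf hR)
  refine norm_le_of_tsum_le (by positivity) ?_
  simp only [duhE_apply hν hγ hba hf hfin ht]
  refine (ENNReal.tsum_le_tsum fun k =>
    enorm_duhamel_sq_le_length_mul (symb_re_nonneg hν hγ k) ht (hf k)).trans ?_
  rw [ENNReal.tsum_mul_left]
  refine (mul_le_mul_right (lintegral_tsum_le_of_bound hf hR) _).trans_eq ?_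
  rw [ENNReal.ofReal_mul hab]
  ring

/-! ### The semigroup -/

/-- The semigroup generated by the linear part. -/
noncomputable def sgE {d : ℕ} (ν γ t : ℝ) (v : ESeq d) : ESeq d :=
  ofSeq fun k => Complex.exp (-symb ν γ k * (t : ℝ)) * v k

section Semigroup

variable {d : ℕ} {ν γ : ℝ} (hν : 0 < ν) (hγ : 0 ≤ γ)

include hν hγ in
theorem norm_exp_symb_le_one {t : ℝ} (ht : 0 ≤ t) (k : Fin d → ℤ) :
    ‖Complex.exp (-symb ν γ k * (t : ℝ))‖ ≤ 1 := by
  rw [norm_exp_symb, Real.exp_le_one_iff]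
  nlinarith [symb_re_nonneg hν hγ k]

include hν hγ in
theorem enorm_exp_mul_le {t : ℝ} (ht : 0 ≤ t) (v : ESeq d) (k : Fin d → ℤ) :
    ‖Complex.exp (-symb ν γ k * (t : ℝ)) * v k‖ₑ ^ 2 ≤ ‖v k‖ₑ ^ 2 := by
  refine pow_le_pow_left' ?_ 2
  rw [enorm_mul]
  refine mul_le_of_le_one_left' ?_
  rw [← ofReal_norm, ← ENNReal.ofReal_one]
  exact ENNReal.ofReal_le_ofReal (norm_exp_symb_le_one hν hγ ht k)

include hν hγ in
theorem sgE_apply {t : ℝ} (ht : 0 ≤ t) (v : ESeq d) (k : Fin d → ℤ) :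
    sgE ν γ t v k = Complex.exp (-symb ν γ k * (t : ℝ)) * v k :=
  ofSeq_apply (f := fun k => Complex.exp (-symb ν γ k * (t : ℝ)) * v k)
    (ne_top_of_le_ne_top v.tsum_ne_top
      (ENNReal.tsum_le_tsum fun k => enorm_exp_mul_le hν hγ ht v k)) k

include hν hγ in
theorem norm_sgE_le {t : ℝ} (ht : 0 ≤ t) (v : ESeq d) : ‖sgE ν γ t v‖ ≤ ‖v‖ := by
  refine norm_le_of_tsum_le (norm_nonneg _) ?_
  simp only [sgE_apply hν hγ ht]
  rw [ofReal_norm, enorm_sq_eq_tsum]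
  exact ENNReal.tsum_le_tsum fun k => enorm_exp_mul_le hν hγ ht v k

include hν hγ in
theorem sgE_add {t : ℝ} (ht : 0 ≤ t) (v w : ESeq d) :
    sgE ν γ t (v + w) = sgE ν γ t v + sgE ν γ t w := by
  ext k
  simp only [sgE_apply hν hγ ht, lp.coeFn_add, Pi.add_apply]
  ring

include hν hγ in
theorem sgE_zero (v : ESeq d) : sgE ν γ 0 v = v := by
  ext k
  simp [sgE_apply hν hγ le_rfl]

include hν hγ in
theorem continuousOn_sgE (a : ℝ) (v : ESeq d) :
    ContinuousOn (fun t => sgE ν γ (t - a) v) (Ici a) := by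
  refine continuousOn_of_coord (bnd := fun k => ‖v k‖ₑ ^ 2) ?_ ?_ v.tsum_ne_top
  · intro k
    have : ContinuousOn (fun t : ℝ => Complex.exp (-symb ν γ k * (t - a : ℝ)) * v k) (Ici a) := by
      fun_prop
    exact this.congr fun t ht => sgE_apply hν hγ (sub_nonneg.2 ht) v k
  · intro t ht k
    rw [sgE_apply hν hγ (sub_nonneg.2 ht)]
    exact enorm_exp_mul_le hν hγ (sub_nonneg.2 ht) v k

include hν hγ in
-- Parabolic smoothing: in each mode the weight wt² is compensated by the time integral of the
-- kernel, at most 1/(ν wt²).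
theorem lintegral_sgE_le {a b : ℝ} (hba : b ≤ a + 1) (v : ESeq d) :
    ∫⁻ t in Icc a b, ∑' k, ENNReal.ofReal (wt k) ^ 2 * ‖sgE ν γ (t - a) v k‖ₑ ^ 2 ≤
      ENNReal.ofReal (Real.exp ν) ^ 2 * ENNReal.ofReal ν⁻¹ * ‖v‖ₑ ^ 2 := by
  have h1 : ∫⁻ t in Icc a b, ∑' k, ENNReal.ofReal (wt k) ^ 2 * ‖sgE ν γ (t - a) v k‖ₑ ^ 2 ≤
      ∫⁻ t in Icc a b, ∑' k, ENNReal.ofReal (wt k) ^ 2 *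
        (ENNReal.ofReal (Real.exp ν) ^ 2 * modeKernel (ν * wt k ^ 2) (t - a) * ‖v k‖ₑ ^ 2) := by
    refine setLIntegral_mono' measurableSet_Icc fun t ht => ENNReal.tsum_le_tsum fun k => ?_
    have ht0 : 0 ≤ t - a := sub_nonneg.2 ht.1
    rw [sgE_apply hν hγ ht0, enorm_mul, mul_pow]
    gcongr
    have h2 : ‖Complex.exp (-symb ν γ k * (t - a : ℝ))‖ₑ ≤
        ENNReal.ofReal (Real.exp ν) * modeKernel (ν * wt k ^ 2) (t - a) := by
      rw [modeKernel, if_pos ht0, ← ENNReal.ofReal_mul (Real.exp_pos _).le, ← ofReal_norm,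
        norm_exp_symb]
      exact ENNReal.ofReal_le_ofReal (exp_symb_le hν hγ k _ ⟨ht0, by linarith [ht.2]⟩)
    refine (pow_le_pow_left' h2 2).trans ?_
    rw [mul_pow, sq (modeKernel _ _)]
    gcongr
    exact mul_le_of_le_one_left' (modeKernel_le_one (mode_pos hν k).le _)
  have hmk : ∀ k : Fin d → ℤ, Measurable fun t => modeKernel (ν * wt k ^ 2) (t - a) := fun k =>
    (measurable_modeKernel _).comp (measurable_id.sub measurable_const)
  refine h1.trans ?_
  rw [lintegral_tsum fun k => ((((hmk k).const_mul _).mul_const _).const_mul _).aemeasurable,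
    enorm_sq_eq_tsum, ← ENNReal.tsum_mul_left]
  refine ENNReal.tsum_le_tsum fun k => ?_
  rw [lintegral_const_mul' _ _ (by finiteness), lintegral_mul_const' _ _ (by finiteness),
    lintegral_const_mul' _ _ (by finiteness)]
  have h3 : ∫⁻ t in Icc a b, modeKernel (ν * wt k ^ 2) (t - a) ≤
      ENNReal.ofReal (ν * wt k ^ 2)⁻¹ := by
    rw [← lintegral_modeKernel (mode_pos hν k)]
    exact (setLIntegral_le_lintegral _ _).trans_eq
      (lintegral_sub_right_eq_self (modeKernel (ν * wt k ^ 2)) a)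
  refine (mul_le_mul_right (mul_le_mul_left (mul_le_mul_right h3 _) _) _).trans_eq ?_
  rw [ofReal_mode_inv hν]
  have := ofReal_wt_mul_inv k
  calc _ = ENNReal.ofReal (Real.exp ν) ^ 2 * ENNReal.ofReal ν⁻¹ *
        ((ENNReal.ofReal (wt k) * ENNReal.ofReal (wt k)⁻¹) ^ 2 * ‖v k‖ₑ ^ 2) := by ring
    _ = _ := by rw [this, one_pow, one_mul]

end Semigroup

/-! ### Local existence of mild solutions -/

section Sub

variable {d : ℕ} {ν γ a b : ℝ} (hν : 0 < ν) (hγ : 0 ≤ γ) (hab : a ≤ b) (hba : b ≤ a + 1)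
  {f g : ℝ → (Fin d → ℤ) → ℂ} (hf : ForceMeas a b f) (hg : ForceMeas a b g)
  (hf' : forceNorm a b f ≠ ∞) (hg' : forceNorm a b g ≠ ∞)

include hν hγ hab hba hf hg hf' hg' in
theorem duhE_sub_apply {t : ℝ} (ht : t ∈ Icc a b) (k : Fin d → ℤ) :
    duhE ν γ a f t k - duhE ν γ a g t k = duhamel (symb ν γ k) a (fun τ => f τ k - g τ k) t := by
  rw [duhE_apply hν hγ hba hf hf' ht, duhE_apply hν hγ hba hg hg' ht, duhamel, duhamel, duhamel,
    ← intervalIntegral.integral_sub]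
  · simp only [mul_sub]
  · exact ((force_intervalIntegrable hab hf hf' k).mono_set
      (by rw [uIcc_of_le ht.1, uIcc_of_le hab]; exact Icc_subset_Icc_right ht.2)).continuousOn_mul
      (by fun_prop)
  · exact ((force_intervalIntegrable hab hg hg' k).mono_set
      (by rw [uIcc_of_le ht.1, uIcc_of_le hab]; exact Icc_subset_Icc_right ht.2)).continuousOn_mul
      (by fun_prop)

include hν hγ hab hba hf hg hf' hg' in
theorem duhE_sub {t : ℝ} (ht : t ∈ Icc a b) :
    duhE ν γ a (fun τ k => f τ k - g τ k) t = duhE ν γ a f t - duhE ν γ a g t := by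
  have h := duhE_sub_apply hν hγ hab hba hf hg hf' hg' ht
  have h1 : ∑' k, ‖duhamel (symb ν γ k) a (fun τ => f τ k - g τ k) t‖ₑ ^ 2 ≠ ∞ := by
    simp only [← h]
    exact (duhE ν γ a f t - duhE ν γ a g t).tsum_ne_top
  ext k
  rw [duhE, ofSeq_apply h1, lp.coeFn_sub, Pi.sub_apply, h]

end Sub

theorem forceMeas_of_continuousOn {d : ℕ} {a b : ℝ} {g : ℝ → ESeq d} (hg : ContinuousOn g (Icc a b)) :
    ForceMeas a b fun τ k => g τ k := fun k =>
  ((lp.evalCLM ℂ (fun _ : Fin d → ℤ => ℂ) 2 k).continuous.comp_continuousOn hg).aestronglyMeasurable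
    measurableSet_Icc

theorem tsum_le_of_norm_le {d : ℕ} {A : ESeq d} {R : ℝ} (h : ‖A‖ ≤ R) :
    ∑' k, ‖A k‖ₑ ^ 2 ≤ ENNReal.ofReal R ^ 2 := by
  rw [← enorm_sq_eq_tsum, ← ofReal_norm]
  gcongr

theorem forceNorm_ne_top_of_continuousOn {d : ℕ} {a b : ℝ} {g : ℝ → ESeq d}
    (hg : ContinuousOn g (Icc a b)) : forceNorm a b (fun τ k => g τ k) ≠ ∞ := by
  obtain ⟨R, hR⟩ := isCompact_Icc.exists_bound_of_continuousOn hg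
  exact ne_top_of_le_ne_top (by finiteness) (forceNorm_le_of_bound (forceMeas_of_continuousOn hg)
    fun τ hτ => tsum_le_of_norm_le (hR τ hτ))

/-- The projection of `ℝ` onto `[a, b]`. -/
noncomputable def clip (a b t : ℝ) : ℝ := max a (min t b)

theorem continuous_clip (a b : ℝ) : Continuous (clip a b) := by unfold clip; fun_prop

theorem clip_mem {a b : ℝ} (hab : a ≤ b) (t : ℝ) : clip a b t ∈ Icc a b :=
  ⟨le_max_left _ _, max_le hab (min_le_right _ _)⟩

theorem clip_of_mem {a b t : ℝ} (ht : t ∈ Icc a b) : clip a b t = t := by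
  rw [clip, min_eq_left ht.2, max_eq_right ht.1]

/-- Picard iteration on the ball of radius R. The rough forcing f enters only through its Duhamel
integral, of size g, and cancels in differences; the H^s-valued term Q costs (b - a) q in size and
(b - a) L in contraction. -/
theorem exists_mild {d : ℕ} {ν γ a b : ℝ} (hν : 0 < ν) (hγ : 0 ≤ γ) (hab : a ≤ b)
    (hba : b ≤ a + 1) {f : ℝ → (Fin d → ℤ) → ℂ} (hf : ForceMeas a b f)
    (hf' : forceNorm a b f ≠ ∞) (v : ESeq d) (Q : ℝ → ESeq d → ESeq d)
    (hQ : Continuous (Function.uncurry Q)) {R q g L : ℝ} (hR0 : 0 ≤ R) (hq0 : 0 ≤ q) (hL0 : 0 ≤ L)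
    (hg : ∀ t ∈ Icc a b, ‖duhE ν γ a f t‖ ≤ g)
    (hq : ∀ t ∈ Icc a b, ∀ w, ‖w‖ ≤ R → ‖Q t w‖ ≤ q)
    (hL : ∀ t ∈ Icc a b, ∀ w w', ‖w‖ ≤ R → ‖w'‖ ≤ R → ‖Q t w - Q t w'‖ ≤ L * ‖w - w'‖)
    (hLb : (b - a) * L ≤ 1 / 2) (hR : ‖v‖ + g + (b - a) * q ≤ R) :
    ∃ W : ℝ → ESeq d, Continuous W ∧ (∀ t, ‖W t‖ ≤ R) ∧
      ∀ t ∈ Icc a b, W t = sgE ν γ (t - a) v + duhE ν γ a (fun τ k => f τ k - Q τ (W τ) k) t := by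
  classical
  have hQc : ∀ W : BoundedContinuousFunction ℝ (ESeq d), Continuous fun τ => Q τ (W τ) := fun W =>
    hQ.comp (continuous_id.prodMk W.continuous)
  have hfm : ∀ W : BoundedContinuousFunction ℝ (ESeq d), ForceMeas a b fun τ k => Q τ (W τ) k :=
    fun W => forceMeas_of_continuousOn (hQc W).continuousOn
  have hfn : ∀ W : BoundedContinuousFunction ℝ (ESeq d),
      forceNorm a b (fun τ k => Q τ (W τ) k) ≠ ∞ :=
    fun W => forceNorm_ne_top_of_continuousOn (hQc W).continuousOn
  let P : BoundedContinuousFunction ℝ (ESeq d) → ℝ → ESeq d := fun W t =>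
    sgE ν γ (t - a) v + duhE ν γ a f t - duhE ν γ a (fun τ k => Q τ (W τ) k) t
  have hP : ∀ W, ContinuousOn (P W) (Icc a b) := fun W =>
    (((continuousOn_sgE hν hγ a v).mono Icc_subset_Ici_self).add
      (continuousOn_duhE hν hγ hab hba hf hf')).sub
      (continuousOn_duhE hν hγ hab hba (hfm W) (hfn W))
  have hPb : ∀ W, ∃ C, ∀ t ∈ Icc a b, ‖P W t‖ ≤ C := fun W =>
    isCompact_Icc.exists_bound_of_continuousOn (hP W)
  choose C hC using hPb
  -- Time is frozen outside [a, b], so that the iteration takes place in the complete space of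
  -- bounded continuous functions on the line.
  let Γ : BoundedContinuousFunction ℝ (ESeq d) → BoundedContinuousFunction ℝ (ESeq d) := fun W =>
    BoundedContinuousFunction.ofNormedAddCommGroup (fun t => P W (clip a b t))
      ((hP W).comp_continuous (continuous_clip a b) (clip_mem hab)) (C W)
      fun t => hC W _ (clip_mem hab t)
  have hΓ : ∀ W t, Γ W t = P W (clip a b t) := fun W t => rfl
  let S : Set (BoundedContinuousFunction ℝ (ESeq d)) := Metric.closedBall 0 R
  have hS : ∀ W, W ∈ S ↔ ∀ t, ‖W t‖ ≤ R := fun W => by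
    rw [mem_closedBall_zero_iff, BoundedContinuousFunction.norm_le hR0]
  have hmaps : MapsTo Γ S S := by
    intro W hW
    rw [hS] at hW ⊢
    intro t
    have ht := clip_mem hab t
    rw [hΓ]
    have h1 := norm_sgE_le hν hγ (sub_nonneg.2 ht.1) v
    have h2 := hg _ ht
    have h3 := norm_duhE_le_of_bound hν hγ hq0 hba (hfm W)
      (fun τ hτ => tsum_le_of_norm_le (hq τ hτ _ (hW τ))) ht
    have h4 := norm_sub_le (sgE ν γ (clip a b t - a) v + duhE ν γ a f (clip a b t))
      (duhE ν γ a (fun τ k => Q τ (W τ) k) (clip a b t))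
    have h5 := norm_add_le (sgE ν γ (clip a b t - a) v) (duhE ν γ a f (clip a b t))
    simp only [P]
    linarith
  have hcontr : ContractingWith (1 / 2) (hmaps.restrict Γ S S) := by
    refine ⟨by norm_num, LipschitzWith.of_dist_le_mul fun W W' => ?_⟩
    have hW := (hS _).1 W.2
    have hW' := (hS _).1 W'.2
    rw [Subtype.dist_eq, Subtype.dist_eq, MapsTo.val_restrict_apply, MapsTo.val_restrict_apply]
    refine (BoundedContinuousFunction.dist_le (by positivity)).2 fun t => ?_
    have ht := clip_mem hab t
    set D := dist W.1 W'.1 with hD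
    rw [hΓ, hΓ, dist_eq_norm]
    have h1 : P W.1 (clip a b t) - P W'.1 (clip a b t) =
        duhE ν γ a (fun τ k => Q τ (W'.1 τ) k - Q τ (W.1 τ) k) (clip a b t) := by
      rw [duhE_sub hν hγ hab hba (hfm _) (hfm _) (hfn _) (hfn _) ht]
      simp only [P]; abel
    rw [h1]
    have hm : ForceMeas a b fun τ k => Q τ (W'.1 τ) k - Q τ (W.1 τ) k := fun k =>
      (hfm W'.1 k).sub (hfm W.1 k)
    have hD0 : 0 ≤ D := dist_nonneg
    refine (norm_duhE_le_of_bound hν hγ (R := L * D) (by positivity) hba hm (fun τ hτ => ?_) ht).trans ?_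
    · have h2 : ‖Q τ (W'.1 τ) - Q τ (W.1 τ)‖ ≤ L * D := by
        refine (hL τ hτ _ _ (hW' τ) (hW τ)).trans ?_
        gcongr
        rw [← dist_eq_norm, dist_comm]
        exact BoundedContinuousFunction.dist_coe_le_dist τ
      exact tsum_le_of_norm_le h2
    · rw [← mul_assoc]
      push_cast
      gcongr
  obtain ⟨W, hWS, hfix, -⟩ := ContractingWith.exists_fixedPoint'
    (Metric.isClosed_closedBall.isComplete) hmaps hcontr (x := 0)
    (Metric.mem_closedBall_self hR0) (edist_ne_top _ _)
  refine ⟨W, W.continuous, (hS W).1 hWS, fun t ht => ?_⟩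
  have h1 : Γ W t = W t := by rw [hfix]
  rw [← h1, hΓ, clip_of_mem ht, duhE_sub hν hγ hab hba hf (hfm W) hf' (hfn W) ht]
  simp only [P]; abel

/-! ### Solutions in Fourier coordinates -/

/-- `U` is a solution on `[a, b]` of the nonlinear equation with forcing term `F`, in the
Fourier coordinates of `H^s`. -/
structure IsModeSol {d : ℕ} (ν γ c : ℝ) (p s : ℕ) (a b : ℝ) (F : ℝ → (Fin d → ℤ) → ℂ)
    (U : ℝ → ESeq d) : Prop where
  cont : Continuous U
  reg : ∫⁻ t in Icc a b, ∑' k, ENNReal.ofReal (wt k) ^ 2 * ‖U t k‖ₑ ^ 2 ≠ ∞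
  eqn : ∀ k, ∀ t ∈ Icc a b, U t k = U a k +
    ∫ τ in a..t, (-(symb ν γ k * U τ k) - nonlinE s c p (U τ) k + F τ k)

theorem continuous_coord {d : ℕ} {U : ℝ → ESeq d} (hU : Continuous U) (k : Fin d → ℤ) :
    Continuous fun t => U t k :=
  (lp.evalCLM ℂ (fun _ : Fin d → ℤ => ℂ) 2 k).continuous.comp hU

theorem enorm_add_sq_le (x y : ℂ) : ‖x + y‖ₑ ^ 2 ≤ 2 * ‖x‖ₑ ^ 2 + 2 * ‖y‖ₑ ^ 2 := by
  have h : ∀ z : ℂ, ‖z‖ₑ ^ 2 = ENNReal.ofReal (‖z‖ ^ 2) := fun z => by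
    rw [ENNReal.ofReal_pow (norm_nonneg _), ofReal_norm]
  rw [h, h, h, ← ENNReal.ofReal_ofNat 2, ← ENNReal.ofReal_mul (by norm_num),
    ← ENNReal.ofReal_mul (by norm_num), ← ENNReal.ofReal_add (by positivity) (by positivity)]
  refine ENNReal.ofReal_le_ofReal ?_
  have := norm_add_le x y
  nlinarith [norm_nonneg x, norm_nonneg y, norm_nonneg (x + y), sq_nonneg (‖x‖ - ‖y‖)]

theorem lintegral_reg_add_ne_top {d : ℕ} {a b : ℝ} {U V : ℝ → (Fin d → ℤ) → ℂ}
    (hUm : ForceMeas a b U)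
    (hU : ∫⁻ t in Icc a b, ∑' k, ENNReal.ofReal (wt k) ^ 2 * ‖U t k‖ₑ ^ 2 ≠ ∞)
    (hV : ∫⁻ t in Icc a b, ∑' k, ENNReal.ofReal (wt k) ^ 2 * ‖V t k‖ₑ ^ 2 ≠ ∞) :
    ∫⁻ t in Icc a b, ∑' k, ENNReal.ofReal (wt k) ^ 2 * ‖U t k + V t k‖ₑ ^ 2 ≠ ∞ := by
  have h : ∫⁻ t in Icc a b, ∑' k, ENNReal.ofReal (wt k) ^ 2 * ‖U t k + V t k‖ₑ ^ 2 ≤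
      ∫⁻ t in Icc a b, (2 * (∑' k, ENNReal.ofReal (wt k) ^ 2 * ‖U t k‖ₑ ^ 2) +
        2 * ∑' k, ENNReal.ofReal (wt k) ^ 2 * ‖V t k‖ₑ ^ 2) := by
    refine lintegral_mono fun t => ?_
    rw [← ENNReal.tsum_mul_left, ← ENNReal.tsum_mul_left, ← ENNReal.tsum_add]
    refine ENNReal.tsum_le_tsum fun k => ?_
    refine (mul_le_mul_right (enorm_add_sq_le _ _) _).trans_eq ?_
    ring
  refine ne_top_of_le_ne_top ?_ h
  rw [lintegral_add_left', lintegral_const_mul' _ _ (by norm_num),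
    lintegral_const_mul' _ _ (by norm_num)]
  · finiteness
  · exact (AEMeasurable.tsum fun k => ((hUm k).enorm.pow_const 2).const_mul _).const_mul _

set_option maxHeartbeats 400000 in
-- The solution is sought as U = W + φ₀ + θ φ₁ with θ = (t - a)/δ, where φ₀ is a large part of the
-- initial state and φ₁ the displacement expected during time δ. Both phases of the control argument
-- are instances: φ₀ = 0 and fc = φ₁/δ for a strong control, φ₀ = Mg and fc = 0 for the free
-- evolution. The remainder W starts at v and stays bounded; q bounds what is left after the large
-- terms have cancelled.
theorem exists_modeSol {d s p : ℕ} (hs : d < 2 * s) {ν γ c a δ : ℝ} (hν : 0 < ν) (hγ : 0 ≤ γ)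
    (hδ : 0 < δ) (hδ1 : δ ≤ 1) {f : ℝ → (Fin d → ℤ) → ℂ} (hf : ForceMeas a (a + δ) f)
    (hf' : forceNorm a (a + δ) f ≠ ∞) (v φ₀ φ₁ l₀ l₁ fc : ESeq d)
    (hl₀ : ∀ k, l₀ k = symb ν γ k * φ₀ k) (hl₁ : ∀ k, l₁ k = symb ν γ k * φ₁ k)
    (hr₀ : ∑' k, ENNReal.ofReal (wt k) ^ 2 * ‖φ₀ k‖ₑ ^ 2 ≠ ∞)
    (hr₁ : ∑' k, ENNReal.ofReal (wt k) ^ 2 * ‖φ₁ k‖ₑ ^ 2 ≠ ∞)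
    {R q g L : ℝ} (hR0 : 0 ≤ R) (hq0 : 0 ≤ q) (hL0 : 0 ≤ L)
    (hg : ∀ t ∈ Icc a (a + δ), ‖duhE ν γ a f t‖ ≤ g)
    (hq : ∀ θ ∈ Icc (0 : ℝ) 1, ∀ w, ‖w‖ ≤ R → ‖l₀ + (θ : ℂ) • l₁ +
      nonlinE s c p (w + φ₀ + (θ : ℂ) • φ₁) + ((δ⁻¹ : ℝ) : ℂ) • φ₁ - fc‖ ≤ q)
    (hL : ∀ θ ∈ Icc (0 : ℝ) 1, ∀ w w', ‖w‖ ≤ R → ‖w'‖ ≤ R →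
      ‖nonlinE s c p (w + φ₀ + (θ : ℂ) • φ₁) - nonlinE s c p (w' + φ₀ + (θ : ℂ) • φ₁)‖ ≤
        L * ‖w - w'‖)
    (hLb : δ * L ≤ 1 / 2) (hR : ‖v‖ + g + δ * q ≤ R) :
    ∃ U : ℝ → ESeq d, IsModeSol ν γ c p s a (a + δ) (fun τ k => f τ k + fc k) U ∧
      U a = v + φ₀ ∧ ‖U (a + δ) - (sgE ν γ δ v + φ₀ + φ₁)‖ ≤ g + δ * q := by
  have hab : a ≤ a + δ := by linarith
  have hba : a + δ ≤ a + 1 := by linarith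
  have hθ : ∀ t ∈ Icc a (a + δ), (t - a) / δ ∈ Icc (0 : ℝ) 1 := fun t ht =>
    ⟨div_nonneg (by linarith [ht.1]) hδ.le, (div_le_one hδ).2 (by linarith [ht.2])⟩
  have hNc := continuous_nonlinE (d := d) hs c p
  -- Q collects what W must absorb: the linear operator applied to φ₀ + θ φ₁, the nonlinearity at U,
  -- the time derivative φ₁/δ of the profile, and the constant control fc with the opposite sign.
  obtain ⟨Q, hQ, hQe⟩ : ∃ Q : ℝ → ESeq d → ESeq d, Continuous (Function.uncurry Q) ∧
      ∀ t w, Q t w = l₀ + (((t - a) / δ : ℝ) : ℂ) • l₁ +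
        nonlinE s c p (w + φ₀ + (((t - a) / δ : ℝ) : ℂ) • φ₁) + ((δ⁻¹ : ℝ) : ℂ) • φ₁ - fc := by
    refine ⟨_, ?_, fun _ _ => rfl⟩
    have h1 : Continuous fun z : ℝ × ESeq d => (((z.1 - a) / δ : ℝ) : ℂ) := by fun_prop
    have h2 : Continuous fun z : ℝ × ESeq d => z.2 + φ₀ + (((z.1 - a) / δ : ℝ) : ℂ) • φ₁ :=
      (continuous_snd.add continuous_const).add (h1.smul continuous_const)
    exact (((continuous_const.add (h1.smul continuous_const)).add (hNc.comp h2)).add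
      continuous_const).sub continuous_const
  have hδa : a + δ - a = δ := by ring
  have hQq : ∀ t ∈ Icc a (a + δ), ∀ w, ‖w‖ ≤ R → ‖Q t w‖ ≤ q := fun t ht w hw => by
    rw [hQe]; exact hq _ (hθ t ht) w hw
  have hQL : ∀ t ∈ Icc a (a + δ), ∀ w w', ‖w‖ ≤ R → ‖w'‖ ≤ R →
      ‖Q t w - Q t w'‖ ≤ L * ‖w - w'‖ := fun t ht w w' hw hw' => by
    rw [hQe, hQe, sub_sub_sub_cancel_right, add_sub_add_right_eq_sub, add_sub_add_left_eq_sub]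
    exact hL _ (hθ t ht) w w' hw hw'
  obtain ⟨W, hWc, hWR, hW⟩ := exists_mild hν hγ hab hba hf hf' v Q hQ hR0 hq0 hL0 hg hQq hQL
    (by rwa [hδa]) (by rwa [hδa])
  have hQW : Continuous fun τ => Q τ (W τ) := hQ.comp (continuous_id.prodMk hWc)
  have hQm : ForceMeas a (a + δ) fun τ k => Q τ (W τ) k :=
    forceMeas_of_continuousOn hQW.continuousOn
  have hQn := forceNorm_ne_top_of_continuousOn (a := a) (b := a + δ) hQW.continuousOn
  have hdm : ForceMeas a (a + δ) fun τ k => f τ k - Q τ (W τ) k := fun k => (hf k).sub (hQm k)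
  have hsub : ∀ t ∈ Icc a (a + δ), duhE ν γ a (fun τ k => f τ k - Q τ (W τ) k) t =
      duhE ν γ a f t - duhE ν γ a (fun τ k => Q τ (W τ) k) t := fun t ht =>
    duhE_sub hν hγ hab hba hf hQm hf' hQn ht
  have hWk : ∀ t ∈ Icc a (a + δ), ∀ k, W t k = Complex.exp (-symb ν γ k * (t - a : ℝ)) * v k +
      duhamel (symb ν γ k) a (fun τ => f τ k - Q τ (W τ) k) t := fun t ht k => by
    rw [hW t ht, lp.coeFn_add, Pi.add_apply, sgE_apply hν hγ (sub_nonneg.2 ht.1), hsub t ht,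
      lp.coeFn_sub, Pi.sub_apply, duhE_sub_apply hν hγ hab hba hf hQm hf' hQn ht]
  have hWa : W a = v := by
    ext k
    rw [hWk a (left_mem_Icc.2 hab)]
    simp [duhamel]
  have hint : ∀ k, IntervalIntegrable (fun τ => f τ k - Q τ (W τ) k) volume a (a + δ) := fun k =>
    (force_intervalIntegrable hab hf hf' k).sub ((continuous_coord hQW k).intervalIntegrable _ _)
  let φ : ℝ → ESeq d := fun t => φ₀ + (((t - a) / δ : ℝ) : ℂ) • φ₁
  have hφc : Continuous φ := by
    have h1 : Continuous fun t : ℝ => (((t - a) / δ : ℝ) : ℂ) := by fun_prop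
    exact continuous_const.add (h1.smul continuous_const)
  refine ⟨fun t => W t + φ t, ⟨hWc.add hφc, ?_, ?_⟩, ?_, ?_⟩
  · refine lintegral_reg_add_ne_top (U := fun t k => W t k) (V := fun t k => φ t k)
      (forceMeas_of_continuousOn hWc.continuousOn) ?_ ?_
    · have h1 : ∫⁻ t in Icc a (a + δ), ∑' k, ENNReal.ofReal (wt k) ^ 2 * ‖W t k‖ₑ ^ 2 =
          ∫⁻ t in Icc a (a + δ), ∑' k, ENNReal.ofReal (wt k) ^ 2 *
            ‖sgE ν γ (t - a) v k + (duhE ν γ a f t k +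
              (-1 : ℂ) * duhE ν γ a (fun τ k => Q τ (W τ) k) t k)‖ₑ ^ 2 :=
        setLIntegral_congr_fun measurableSet_Icc fun t ht => by
          simp only [hW t ht, hsub t ht, lp.coeFn_add, lp.coeFn_sub, Pi.add_apply, Pi.sub_apply]
          congr 1; ext k; ring_nf
      rw [h1]
      refine lintegral_reg_add_ne_top (U := fun t k => sgE ν γ (t - a) v k)
        (V := fun t k => duhE ν γ a f t k + (-1 : ℂ) * duhE ν γ a (fun τ k => Q τ (W τ) k) t k)
        (forceMeas_of_continuousOn ((continuousOn_sgE hν hγ a v).mono Icc_subset_Ici_self))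
        (ne_top_of_le_ne_top (by finiteness) (lintegral_sgE_le hν hγ hba v)) ?_
      refine lintegral_reg_add_ne_top (U := fun t k => duhE ν γ a f t k)
        (V := fun t k => (-1 : ℂ) * duhE ν γ a (fun τ k => Q τ (W τ) k) t k)
        (forceMeas_of_continuousOn (continuousOn_duhE hν hγ hab hba hf hf'))
        (ne_top_of_le_ne_top (by finiteness) (lintegral_duhE_le hν hγ hab hba hf hf')) ?_
      simp only [neg_one_mul, enorm_neg]
      exact ne_top_of_le_ne_top (by finiteness) (lintegral_duhE_le hν hγ hab hba hQm hQn)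
    · have h1 : ∀ t ∈ Icc a (a + δ), ∑' k, ENNReal.ofReal (wt k) ^ 2 * ‖φ t k‖ₑ ^ 2 ≤
          2 * (∑' k, ENNReal.ofReal (wt k) ^ 2 * ‖φ₀ k‖ₑ ^ 2) +
            2 * ∑' k, ENNReal.ofReal (wt k) ^ 2 * ‖φ₁ k‖ₑ ^ 2 := by
        intro t ht
        rw [← ENNReal.tsum_mul_left, ← ENNReal.tsum_mul_left, ← ENNReal.tsum_add]
        refine ENNReal.tsum_le_tsum fun k => ?_
        simp only [φ, lp.coeFn_add, lp.coeFn_smul, Pi.add_apply, Pi.smul_apply, smul_eq_mul]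
        refine (mul_le_mul_right ((enorm_add_sq_le _ _).trans (add_le_add_right (mul_le_mul_right
          (pow_le_pow_left' (?_ : _ ≤ ‖φ₁ k‖ₑ) 2) 2) _)) _).trans_eq ?_
        · rw [enorm_mul]
          refine mul_le_of_le_one_left' ?_
          rw [← ofReal_norm, ← ENNReal.ofReal_one, Complex.norm_real,
            Real.norm_of_nonneg (hθ t ht).1]
          exact ENNReal.ofReal_le_ofReal (hθ t ht).2
        · ring
      refine ne_top_of_le_ne_top ?_ (setLIntegral_mono' measurableSet_Icc h1)
      rw [setLIntegral_const, Real.volume_Icc]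
      finiteness
  · intro k t ht
    have hta : a ≤ t := ht.1
    have hsubs : uIcc a t ⊆ uIcc a (a + δ) := by
      rw [uIcc_of_le ht.1, uIcc_of_le hab]; exact Icc_subset_Icc_right ht.2
    have hint' := (hint k).mono_set hsubs
    have h1 := mild_eq_integral hta hint' (symb ν γ k) (v k)
    rw [← hWk t ht] at h1
    have h2 : ∫ τ in a..t, (-(symb ν γ k * (Complex.exp (-symb ν γ k * (τ - a : ℝ)) * v k +
        duhamel (symb ν γ k) a (fun τ => f τ k - Q τ (W τ) k) τ)) + (f τ k - Q τ (W τ) k)) =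
        ∫ τ in a..t, (-(symb ν γ k * W τ k) + (f τ k - Q τ (W τ) k)) := by
      refine intervalIntegral.integral_congr fun τ hτ => ?_
      rw [uIcc_of_le hta] at hτ
      simp only [hWk τ ⟨hτ.1, hτ.2.trans ht.2⟩]
    rw [h2] at h1
    have h3 : ∫ _ in a..t, ((δ⁻¹ : ℝ) : ℂ) * φ₁ k = (((t - a) / δ : ℝ) : ℂ) * φ₁ k := by
      rw [intervalIntegral.integral_const, Complex.real_smul]
      push_cast; ring
    have h4 : ∀ τ, -(symb ν γ k * (W τ + φ τ) k) - nonlinE s c p (W τ + φ τ) k + (f τ k + fc k) =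
        (-(symb ν γ k * W τ k) + (f τ k - Q τ (W τ) k)) + ((δ⁻¹ : ℝ) : ℂ) * φ₁ k := by
      intro τ
      simp only [hQe, φ, lp.coeFn_add, lp.coeFn_sub, lp.coeFn_smul, Pi.add_apply, Pi.sub_apply,
        Pi.smul_apply, smul_eq_mul, hl₀, hl₁, add_assoc]
      ring
    simp only [h4]
    rw [intervalIntegral.integral_add _ (by simp), h3]
    · simp only [lp.coeFn_add, Pi.add_apply, φ, lp.coeFn_smul, Pi.smul_apply, smul_eq_mul, hWa,
        sub_self, zero_div, Complex.ofReal_zero, zero_mul, add_zero]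
      rw [h1]; ring
    · exact ((continuous_const.mul (continuous_coord hWc k)).neg.intervalIntegrable _ _).add hint'
  · simp [φ, hWa]
  · have hb := right_mem_Icc.2 hab
    have h1 : W (a + δ) + φ (a + δ) - (sgE ν γ δ v + φ₀ + φ₁) = duhE ν γ a f (a + δ) -
        duhE ν γ a (fun τ k => Q τ (W τ) k) (a + δ) := by
      rw [hW _ hb, hsub _ hb]
      simp only [φ, add_sub_cancel_left, div_self hδ.ne', Complex.ofReal_one, one_smul]
      abel
    rw [h1]
    refine (norm_sub_le _ _).trans (add_le_add (hg _ hb) ?_)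
    have := norm_duhE_le_of_bound hν hγ hq0 hba hQm
      (fun τ hτ => tsum_le_of_norm_le (hQq τ hτ _ (hWR τ))) hb
    rwa [hδa] at this

/-! ### The inclusion `H^{s+2} ⊂ H^s` and the linear operator -/

theorem enorm_div_wt_sq_le {d : ℕ} (A : ESeq d) (k : Fin d → ℤ) :
    ‖A k / (wt k : ℂ) ^ 2‖ₑ ^ 2 ≤ ‖A k‖ₑ ^ 2 := by
  refine pow_le_pow_left' ?_ 2
  rw [enorm_div_wt]
  refine mul_le_of_le_one_right' ?_
  rw [← ENNReal.ofReal_one]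
  exact ENNReal.ofReal_le_ofReal
    (pow_le_one₀ (inv_nonneg.2 (wt_pos k).le) (inv_le_one_of_one_le₀ (one_le_wt k)))

/-- The inclusion `H^{s+2} ⊂ H^s` in Fourier coordinates. -/
noncomputable def inclE {d : ℕ} (A : ESeq d) : ESeq d := ofSeq fun k => A k / (wt k : ℂ) ^ 2

theorem inclE_apply {d : ℕ} (A : ESeq d) (k : Fin d → ℤ) : inclE A k = A k / (wt k : ℂ) ^ 2 :=
  ofSeq_apply (f := fun k => A k / (wt k : ℂ) ^ 2)
    (ne_top_of_le_ne_top A.tsum_ne_top (ENNReal.tsum_le_tsum (enorm_div_wt_sq_le A))) k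

theorem Phi_inclE {d s : ℕ} (hs : d < 2 * s) (A : ESeq d) : Phi s (inclE A) = Phi (s + 2) A :=
  continuousMap_ext_coeff fun k => by
    rw [coeff_Phi hs, coeff_Phi (by omega), inclE_apply, div_div, ← pow_add, add_comm 2]

theorem inclE_smul {d : ℕ} (z : ℂ) (A : ESeq d) : inclE (z • A) = z • inclE A := by
  ext k
  simp only [inclE_apply, lp.coeFn_smul, Pi.smul_apply, smul_eq_mul, mul_div_assoc]

theorem inclE_add {d : ℕ} (A B : ESeq d) : inclE (A + B) = inclE A + inclE B := by
  ext k
  simp only [inclE_apply, lp.coeFn_add, Pi.add_apply, add_div]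

theorem inclE_nonlinE {d s : ℕ} (hs : d < 2 * s) (c : ℝ) (p : ℕ) (A : ESeq d) :
    inclE (nonlinE (s + 2) c p A) = nonlinE s c p (inclE A) := by
  refine Phi_injective hs ?_
  ext x
  rw [Phi_inclE hs, Phi_nonlinE (by omega), Phi_nonlinE hs, Phi_inclE hs]

theorem norm_symb_le {d : ℕ} {ν γ : ℝ} (hν : 0 < ν) (hγ : 0 ≤ γ) (k : Fin d → ℤ) :
    ‖symb ν γ k‖ ≤ (ν + 1 + γ) * wt k ^ 2 := by
  have h0 := freqSq_nonneg k
  have h1 : ‖(ν : ℂ) + Complex.I‖ ≤ ν + 1 := by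
    refine (norm_add_le _ _).trans_eq ?_
    rw [Complex.norm_real, Complex.norm_I, Real.norm_of_nonneg hν.le]
  refine (norm_add_le _ _).trans ?_
  rw [norm_mul, Complex.norm_real, Complex.norm_real, Real.norm_of_nonneg hγ,
    Real.norm_of_nonneg h0, wt_sq]
  nlinarith [mul_le_mul_of_nonneg_right h1 h0, mul_nonneg hγ h0]

/-- The linear operator `-(ν + i)Δ + γ : H^{s+2} → H^s` in Fourier coordinates. -/
noncomputable def linE {d : ℕ} (ν γ : ℝ) (A : ESeq d) : ESeq d :=
  ofSeq fun k => symb ν γ k * (A k / (wt k : ℂ) ^ 2)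

theorem linE_apply {d : ℕ} {ν γ : ℝ} (hν : 0 < ν) (hγ : 0 ≤ γ) (A : ESeq d) (k : Fin d → ℤ) :
    linE ν γ A k = symb ν γ k * inclE A k := by
  have h : ∀ k, ‖symb ν γ k * (A k / (wt k : ℂ) ^ 2)‖ₑ ^ 2 ≤
      ENNReal.ofReal (ν + 1 + γ) ^ 2 * ‖A k‖ₑ ^ 2 := fun k => by
    rw [← mul_pow]
    refine pow_le_pow_left' ?_ 2
    have h1 : ‖symb ν γ k * (A k / (wt k : ℂ) ^ 2)‖ ≤ (ν + 1 + γ) * ‖A k‖ := by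
      have hw := wt_pos k
      rw [norm_mul, norm_div, norm_pow, Complex.norm_real, Real.norm_of_nonneg hw.le]
      refine (mul_le_mul_of_nonneg_right (norm_symb_le hν hγ k) (by positivity)).trans_eq ?_
      field_simp
    rw [← ofReal_norm, ← ofReal_norm (A k), ← ENNReal.ofReal_mul (by positivity)]
    exact ENNReal.ofReal_le_ofReal h1
  rw [inclE_apply]
  refine ofSeq_apply (f := fun k => symb ν γ k * (A k / (wt k : ℂ) ^ 2))
    (ne_top_of_le_ne_top ?_ (ENNReal.tsum_le_tsum h)) k
  rw [ENNReal.tsum_mul_left]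
  have := A.tsum_ne_top
  finiteness

theorem tsum_wt_inclE_ne_top {d : ℕ} (A : ESeq d) :
    ∑' k, ENNReal.ofReal (wt k) ^ 2 * ‖inclE A k‖ₑ ^ 2 ≠ ∞ := by
  refine ne_top_of_le_ne_top A.tsum_ne_top (ENNReal.tsum_le_tsum fun k => ?_)
  rw [← mul_pow]
  refine pow_le_pow_left' ?_ 2
  rw [inclE_apply, enorm_div_wt, mul_left_comm]
  refine mul_le_of_le_one_right' ?_
  have hw := wt_pos k
  rw [← ENNReal.ofReal_mul hw.le, ← ENNReal.ofReal_one]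
  refine ENNReal.ofReal_le_ofReal ?_
  rw [sq, ← mul_assoc, mul_inv_cancel₀ hw.ne', one_mul]
  exact inv_le_one_of_one_le₀ (one_le_wt k)

/-! ### Trajectories and steering -/

/-- There is an `H`-valued simple control that steers the system from `v` at time `a` to `v'` at
time `b`. The map `κ` sends a value of the control to its Fourier coordinates in `H^s`. -/
def Traj {d : ℕ} (ν γ c : ℝ) (p s : ℕ) (f : ℝ → (Fin d → ℤ) → ℂ) (κ : L2T d → (Fin d → ℤ) → ℂ)
    (H : Submodule ℂ (L2T d)) (a b : ℝ) (v v' : ESeq d) : Prop :=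
  ∃ (η : SimpleFunc ℝ (L2T d)) (U : ℝ → ESeq d), (∀ t, η t ∈ H) ∧
    IsModeSol ν γ c p s a b (fun τ k => f τ k + κ (η τ) k) U ∧ U a = v ∧ U b = v'

/-- The displacement `g` can be realized approximately, in arbitrarily small time, from any
initial state and at any initial time. -/
def Steer {d : ℕ} (ν γ c : ℝ) (p s : ℕ) (f : ℝ → (Fin d → ℤ) → ℂ) (κ : L2T d → (Fin d → ℤ) → ℂ)
    (H : Submodule ℂ (L2T d)) (g : ESeq d) : Prop :=
  ∀ a : ℝ, 0 ≤ a → ∀ v : ESeq d, ∀ ε : ℝ, 0 < ε → ∀ T₀ : ℝ, 0 < T₀ →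
    ∃ T ∈ Ioo 0 T₀, ∃ v', ‖v' - v - g‖ < ε ∧ Traj ν γ c p s f κ H a (a + T) v v'

/-- Forcing terms in `L²_loc([0, ∞); H^{s-1})`, in the coordinates of `H^s`. -/
def LocForce {d : ℕ} (f : ℝ → (Fin d → ℤ) → ℂ) : Prop :=
  ∀ T : ℝ, 0 < T → ForceMeas 0 T f ∧ forceNorm 0 T f ≠ ∞

theorem LocForce.mono {d : ℕ} {f : ℝ → (Fin d → ℤ) → ℂ} (hf : LocForce f) {a b : ℝ} (ha : 0 ≤ a) :
    ForceMeas a b f ∧ forceNorm a b f ≠ ∞ := by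
  obtain ⟨h1, h2⟩ := hf (|b| + 1) (by positivity)
  have hsub : Icc a b ⊆ Icc 0 (|b| + 1) := Icc_subset_Icc ha (by linarith [le_abs_self b])
  refine ⟨fun k => (h1 k).mono_measure (Measure.restrict_mono hsub le_rfl),
    ne_top_of_le_ne_top h2 (ENNReal.tsum_le_tsum fun k => ?_)⟩
  gcongr

theorem LocForce.intervalIntegrable {d : ℕ} {f : ℝ → (Fin d → ℤ) → ℂ} (hf : LocForce f) {a b : ℝ}
    (ha : 0 ≤ a) (hab : a ≤ b) (k : Fin d → ℤ) : IntervalIntegrable (fun τ => f τ k) volume a b :=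
  force_intervalIntegrable hab (hf.mono ha).1 (hf.mono ha).2 k

theorem simpleFunc_intervalIntegrable {d : ℕ} (η : SimpleFunc ℝ (L2T d)) (κ : L2T d → ℂ) (a b : ℝ) :
    IntervalIntegrable (fun τ => κ (η τ)) volume a b := by
  have h : ∀ a b : ℝ, IntegrableOn (fun τ => κ (η τ)) (Ioc a b) volume := fun a b =>
    SimpleFunc.integrable_of_isFiniteMeasure (μ := volume.restrict (Ioc a b)) (η.map κ)
  exact ⟨h a b, h b a⟩

section

variable {d : ℕ} {ν γ c : ℝ} {p s : ℕ} {f : ℝ → (Fin d → ℤ) → ℂ}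
  {κ : L2T d → (Fin d → ℤ) → ℂ} {H : Submodule ℂ (L2T d)}

theorem modeSol_integrand (hs : d < 2 * s) (hf : LocForce f) {a b : ℝ} (ha : 0 ≤ a) (hab : a ≤ b)
    {U : ℝ → ESeq d} (hU : Continuous U) (η : SimpleFunc ℝ (L2T d)) (k : Fin d → ℤ) :
    IntervalIntegrable (fun τ => -(symb ν γ k * U τ k) - nonlinE s c p (U τ) k +
      (f τ k + κ (η τ) k)) volume a b := by
  have h1 : Continuous fun τ => -(symb ν γ k * U τ k) - nonlinE s c p (U τ) k :=
    (continuous_const.mul (continuous_coord hU k)).neg.sub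
      (continuous_coord ((continuous_nonlinE hs c p).comp hU) k)
  exact (h1.intervalIntegrable _ _).add
    ((hf.intervalIntegrable ha hab k).add (simpleFunc_intervalIntegrable η (κ · k) a b))

/-- Simple functions are stable under switching at time b, so the concatenated control is again
simple and `H`-valued. -/
theorem Traj.trans (hs : d < 2 * s) (hf : LocForce f) {a b e : ℝ} (ha : 0 ≤ a) (hab : a ≤ b)
    (hbe : b ≤ e) {v₁ v₂ v₃ : ESeq d} (h₁ : Traj ν γ c p s f κ H a b v₁ v₂)
    (h₂ : Traj ν γ c p s f κ H b e v₂ v₃) : Traj ν γ c p s f κ H a e v₁ v₃ := by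
  obtain ⟨η₁, U₁, hη₁, hU₁, ha₁, hb₁⟩ := h₁
  obtain ⟨η₂, U₂, hη₂, hU₂, ha₂, hb₂⟩ := h₂
  have hbU : U₂ b = U₁ b := ha₂.trans hb₁.symm
  obtain ⟨U, hUc, hUl, hUr⟩ : ∃ U : ℝ → ESeq d, Continuous U ∧ (∀ t ≤ b, U t = U₁ t) ∧
      ∀ t, b ≤ t → U t = U₂ t := by
    -- A formula for gluing that is visibly continuous: before b the bracket vanishes, after b the
    -- term U₁ b cancels U₂ b.
    refine ⟨fun t => U₁ (min t b) + (U₂ (max t b) - U₂ b), ?_, fun t ht => ?_, fun t ht => ?_⟩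
    · exact (hU₁.cont.comp (by fun_prop)).add ((hU₂.cont.comp (by fun_prop)).sub continuous_const)
    · simp [ht]
    · simp [ht, hbU]
  let η : SimpleFunc ℝ (L2T d) := SimpleFunc.piecewise (Iic b) measurableSet_Iic η₁ η₂
  have hηl : ∀ t ≤ b, η t = η₁ t := fun t ht => by
    rw [SimpleFunc.coe_piecewise]
    exact piecewise_eq_of_mem _ _ _ (show t ∈ Iic b from ht)
  have hηr : ∀ t, b < t → η t = η₂ t := fun t ht => by
    rw [SimpleFunc.coe_piecewise]
    exact piecewise_eq_of_notMem _ _ _ (show t ∉ Iic b from not_le.2 ht)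
  refine ⟨η, U, fun t => ?_, ⟨hUc, ?_, fun k t ht => ?_⟩, ?_, ?_⟩
  · rcases le_or_gt t b with h | h
    · rw [hηl t h]; exact hη₁ t
    · rw [hηr t h]; exact hη₂ t
  · have hsub : Icc a e ⊆ Icc a b ∪ Icc b e := Icc_subset_Icc_union_Icc
    refine ne_top_of_le_ne_top ?_ ((lintegral_mono_set hsub).trans (lintegral_union_le _ _ _))
    have e₁ : ∫⁻ t in Icc a b, ∑' k, ENNReal.ofReal (wt k) ^ 2 * ‖U t k‖ₑ ^ 2 =
        ∫⁻ t in Icc a b, ∑' k, ENNReal.ofReal (wt k) ^ 2 * ‖U₁ t k‖ₑ ^ 2 :=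
      setLIntegral_congr_fun measurableSet_Icc fun t ht => by simp only [hUl t ht.2]
    have e₂ : ∫⁻ t in Icc b e, ∑' k, ENNReal.ofReal (wt k) ^ 2 * ‖U t k‖ₑ ^ 2 =
        ∫⁻ t in Icc b e, ∑' k, ENNReal.ofReal (wt k) ^ 2 * ‖U₂ t k‖ₑ ^ 2 :=
      setLIntegral_congr_fun measurableSet_Icc fun t ht => by simp only [hUr t ht.1]
    rw [e₁, e₂]
    have := hU₁.reg
    have := hU₂.reg
    finiteness
  · have hleft : ∀ t ∈ Icc a b,
        ∫ τ in a..t, (-(symb ν γ k * U τ k) - nonlinE s c p (U τ) k + (f τ k + κ (η τ) k)) =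
        ∫ τ in a..t, (-(symb ν γ k * U₁ τ k) - nonlinE s c p (U₁ τ) k + (f τ k + κ (η₁ τ) k)) :=
      fun t ht => intervalIntegral.integral_congr fun τ hτ => by
        rw [uIcc_of_le ht.1] at hτ
        simp only [hUl τ (hτ.2.trans ht.2), hηl τ (hτ.2.trans ht.2)]
    rcases le_total t b with h | h
    · rw [hUl t h, hUl a hab, hleft t ⟨ht.1, h⟩]
      exact hU₁.eqn k t ⟨ht.1, h⟩
    · have h3 : ∫ τ in b..t, (-(symb ν γ k * U τ k) - nonlinE s c p (U τ) k +
            (f τ k + κ (η τ) k)) =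
          ∫ τ in b..t, (-(symb ν γ k * U₂ τ k) - nonlinE s c p (U₂ τ) k +
            (f τ k + κ (η₂ τ) k)) := by
        rw [intervalIntegral.integral_of_le h, intervalIntegral.integral_of_le h]
        refine setIntegral_congr_fun measurableSet_Ioc fun τ hτ => ?_
        simp only [hUr τ hτ.1.le, hηr τ hτ.1]
      rw [← intervalIntegral.integral_add_adjacent_intervals
        (modeSol_integrand hs hf ha hab hUc η k)
        (modeSol_integrand hs hf (ha.trans hab) h hUc η k), hleft b ⟨hab, le_rfl⟩, h3, hUr t h,
        hUl a hab, hU₂.eqn k t ⟨h, ht.2⟩, hbU, hU₁.eqn k b ⟨hab, le_rfl⟩, add_assoc]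
  · rw [hUl a hab, ha₁]
  · rw [hUr e hbe, hb₂]

theorem Steer.add (hs : d < 2 * s) (hf : LocForce f) {g₁ g₂ : ESeq d}
    (h₁ : Steer ν γ c p s f κ H g₁) (h₂ : Steer ν γ c p s f κ H g₂) :
    Steer ν γ c p s f κ H (g₁ + g₂) := by
  intro a ha v ε hε T₀ hT₀
  obtain ⟨T₁, hT₁, v₁, hv₁, htr₁⟩ := h₁ a ha v (ε / 2) (by positivity) (T₀ / 2) (by positivity)
  obtain ⟨T₂, hT₂, v₂, hv₂, htr₂⟩ := h₂ (a + T₁) (by linarith [hT₁.1]) v₁ (ε / 2) (by positivity)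
    (T₀ / 2) (by positivity)
  refine ⟨T₁ + T₂, ⟨by linarith [hT₁.1, hT₂.1], by linarith [hT₁.2, hT₂.2]⟩, v₂, ?_, ?_⟩
  · have : v₂ - v - (g₁ + g₂) = (v₂ - v₁ - g₂) + (v₁ - v - g₁) := by abel
    rw [this]
    exact (norm_add_le _ _).trans_lt (by linarith)
  · rw [← add_assoc]
    exact htr₁.trans hs hf ha (by linarith [hT₁.1]) (by linarith [hT₂.1]) htr₂

/-- Absolute continuity of the integral of the squared force norm makes δ₀ independent of the
starting time a in [0, A]. The uniformity matters because a phase may begin at a time known only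
after its length has been fixed. -/
theorem exists_duhE_small (hν : 0 < ν) (hγ : 0 ≤ γ) (hf : LocForce f) {A ε : ℝ} (hA : 0 ≤ A)
    (hε : 0 < ε) : ∃ δ₀ > 0, δ₀ ≤ 1 ∧ ∀ a ∈ Icc 0 A, ∀ δ ∈ Ioc 0 δ₀, ∀ t ∈ Icc a (a + δ),
      ‖duhE ν γ a f t‖ ≤ ε := by
  obtain ⟨hm, hn⟩ := hf (A + 1) (by linarith)
  set F : ℝ → ℝ≥0∞ := fun τ => ∑' k, ENNReal.ofReal (wt k)⁻¹ ^ 2 * ‖f τ k‖ₑ ^ 2 with hF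
  have hFn : ∀ a b, 0 ≤ a → b ≤ A + 1 → forceNorm a b f = ∫⁻ τ in Icc a b, F τ := by
    intro a b ha hb
    rw [lintegral_tsum, forceNorm]
    · congr 1; ext k
      rw [lintegral_const_mul' _ _ (by finiteness)]
    · intro k
      have h := (hm k).mono_measure (Measure.restrict_mono (Icc_subset_Icc ha hb) le_rfl)
      exact (h.enorm.pow_const 2).const_mul _
  have hfin : ∫⁻ τ, F τ ∂(volume.restrict (Icc 0 (A + 1))) ≠ ∞ := by
    rw [← hFn 0 (A + 1) le_rfl le_rfl]; exact hn
  set C : ℝ≥0∞ := ENNReal.ofReal (Real.exp ν) ^ 2 * ENNReal.ofReal ν⁻¹ with hC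
  have hC0 : C ≠ 0 := mul_ne_zero (pow_ne_zero _ (by simpa using Real.exp_pos ν)) (by simpa using hν)
  have hCt : C ≠ ∞ := by finiteness
  have hε' : ENNReal.ofReal ε ^ 2 / C ≠ 0 :=
    ENNReal.div_ne_zero.2 ⟨pow_ne_zero _ (by simpa using hε), hCt⟩
  obtain ⟨δ₁, hδ₁, h⟩ := exists_pos_setLIntegral_lt_of_measure_lt hfin hε'
  obtain ⟨δ₂, hδ₂, hlt⟩ : ∃ δ₂ : ℝ, 0 < δ₂ ∧ ENNReal.ofReal δ₂ < δ₁ := by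
    obtain ⟨x, hx0, hx1⟩ := ENNReal.lt_iff_exists_nnreal_btwn.1 hδ₁
    exact ⟨x, by simpa using hx0, by simpa using hx1⟩
  refine ⟨min δ₂ 1, lt_min hδ₂ one_pos, min_le_right _ _, fun a ha δ hδ t ht => ?_⟩
  have hδ1 : δ ≤ 1 := hδ.2.trans (min_le_right _ _)
  have hsub : Icc a (a + δ) ⊆ Icc 0 (A + 1) := Icc_subset_Icc ha.1 (by linarith [ha.2])
  have h1 := h (Icc a (a + δ)) (by
    refine (Measure.restrict_apply_le _ _).trans_lt ?_
    rw [Real.volume_Icc, add_sub_cancel_left]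
    exact (ENNReal.ofReal_le_ofReal (hδ.2.trans (min_le_left _ _))).trans_lt hlt)
  rw [Measure.restrict_restrict_of_subset hsub, ← hFn a _ ha.1 (by linarith [ha.2])] at h1
  obtain ⟨hm', hn'⟩ := hf.mono (b := a + δ) ha.1
  refine norm_le_of_tsum_le hε.le ?_
  rw [← enorm_sq_eq_tsum]
  refine (enorm_duhE_sq_le hν hγ (by linarith) hm' hn' ht).trans ?_
  refine (mul_le_mul_right h1.le _).trans_eq ?_
  rw [← hC, ENNReal.mul_div_cancel hC0 hCt]

theorem exists_sgE_small (hν : 0 < ν) (hγ : 0 ≤ γ) (v : ESeq d) {ε : ℝ} (hε : 0 < ε) :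
    ∃ δ₀ > 0, ∀ δ ∈ Ioc 0 δ₀, ‖sgE ν γ δ v - v‖ ≤ ε := by
  have h := continuousOn_sgE hν hγ 0 v 0 self_mem_Ici
  simp only [sub_zero] at h
  obtain ⟨δ₀, hδ₀, h1⟩ := Metric.continuousWithinAt_iff.1 h ε hε
  refine ⟨δ₀ / 2, by positivity, fun δ hδ => ?_⟩
  have h2 := h1 (x := δ) hδ.1.le (by
    rw [Real.dist_eq, sub_zero, abs_of_pos hδ.1]; linarith [hδ.2])
  rw [sgE_zero hν hγ, dist_eq_norm] at h2
  exact h2.le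

end

/-! ### Steering along the control space and along the nonlinearity -/

section

variable {d : ℕ} {ν γ c : ℝ} {p s : ℕ} {f : ℝ → (Fin d → ℤ) → ℂ}
  {κ : L2T d → (Fin d → ℤ) → ℂ} {H : Submodule ℂ (L2T d)}

/-- The control ζ/δ for time δ cancels the profile derivative exactly, and what remains in Q is
bounded independently of δ. The H^{s+2} lift G is needed in order to apply the linear operator to
the displacement. -/
theorem steer_control (hs : d < 2 * s) (hν : 0 < ν) (hγ : 0 ≤ γ) (hf : LocForce f)
    (hκ : ∀ (z : ℂ) (ζ : L2T d) k, κ (z • ζ) k = z * κ ζ k) {ζ : L2T d} (hζ : ζ ∈ H) {G : ESeq d}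
    (hG : ∀ k, κ ζ k = inclE G k) : Steer ν γ c p s f κ H (inclE G) := by
  intro a ha v ε hε T₀ hT₀
  obtain ⟨C, hC, hlip⟩ := norm_nonlinE_sub_le (d := d) hs c p
  set g := inclE G with hg
  set l := linE ν γ G with hl
  -- The extra 2 leaves 1 for the Duhamel integral of the force and 1 for δ q.
  set R := ‖v‖ + 2 with hR
  set q := ‖l‖ + C * (R + ‖g‖) ^ (2 * p) * (R + ‖g‖) with hq
  set L := C * (2 * (R + ‖g‖)) ^ (2 * p) with hL
  have hR0 : 0 ≤ R := by positivity
  have hq0 : 0 ≤ q := by positivity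
  have hL0 : 0 ≤ L := by positivity
  set ε' := min (ε / 4) 1 with hε'
  have hε'0 : 0 < ε' := by positivity
  obtain ⟨δ₁, hδ₁, hδ₁1, hduh⟩ := exists_duhE_small hν hγ hf ha hε'0
  obtain ⟨δ₂, hδ₂, hsg⟩ := exists_sgE_small hν hγ v hε'0
  obtain ⟨δ, hδ, hδle⟩ : ∃ δ : ℝ, 0 < δ ∧ δ ≤ δ₁ ∧ δ ≤ δ₂ ∧ δ < T₀ ∧ δ * q ≤ ε' ∧ δ * L ≤ 1 / 2 := by
    refine ⟨min (min δ₁ δ₂) (min (T₀ / 2) (min (ε' / (q + 1)) (1 / (2 * (L + 1))))), by positivity,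
      (min_le_left _ _).trans (min_le_left _ _), (min_le_left _ _).trans (min_le_right _ _), ?_, ?_, ?_⟩
    · refine lt_of_le_of_lt ((min_le_right _ _).trans (min_le_left _ _)) (by linarith)
    · refine (mul_le_mul_of_nonneg_right ((min_le_right _ _).trans
        ((min_le_right _ _).trans (min_le_left _ _))) hq0).trans ?_
      rw [div_mul_eq_mul_div, div_le_iff₀ (by positivity)]
      nlinarith
    · refine (mul_le_mul_of_nonneg_right ((min_le_right _ _).trans
        ((min_le_right _ _).trans (min_le_right _ _))) hL0).trans ?_
      rw [div_mul_eq_mul_div, div_le_div_iff₀ (by positivity) (by positivity)]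
      nlinarith
  obtain ⟨hd1, hd2, hdT, hdq, hdL⟩ := hδle
  obtain ⟨hm, hn⟩ := hf.mono (b := a + δ) ha
  have hθn : ∀ θ ∈ Icc (0 : ℝ) 1, ∀ A : ESeq d, ‖(θ : ℂ) • A‖ ≤ ‖A‖ := fun θ hθ A => by
    rw [norm_smul, Complex.norm_real, Real.norm_of_nonneg hθ.1]
    exact mul_le_of_le_one_left (norm_nonneg _) hθ.2
  have hz : inclE (0 : ESeq d) = 0 := by
    have := inclE_smul 0 (0 : ESeq d)
    simpa using this
  have hwn : ∀ θ ∈ Icc (0 : ℝ) 1, ∀ w : ESeq d, ‖w‖ ≤ R → ‖w + (θ : ℂ) • g‖ ≤ R + ‖g‖ :=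
    fun θ hθ w hw => (norm_add_le _ _).trans (add_le_add hw (hθn θ hθ g))
  have hε1 : ε' ≤ 1 := min_le_right _ _
  have hε4 : ε' ≤ ε / 4 := min_le_left _ _
  obtain ⟨U, hU, hUa, hUb⟩ := exists_modeSol (c := c) (p := p) hs hν hγ hδ (hd1.trans hδ₁1) hm hn v 0 g 0 l
    (((δ⁻¹ : ℝ) : ℂ) • g) (by simp) (fun k => linE_apply hν hγ G k) (by simp)
    (tsum_wt_inclE_ne_top G) hR0 hq0 hL0
    (fun t ht => hduh a ⟨ha, le_rfl⟩ δ ⟨hδ, hd1⟩ t ht)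
    (fun θ hθ w hw => by
      rw [add_sub_cancel_right, zero_add, add_zero]
      refine (norm_add_le _ _).trans (add_le_add (hθn θ hθ l) ?_)
      have h1 := hlip (w + (θ : ℂ) • g) 0
      rw [nonlinE_zero hs, sub_zero, sub_zero, norm_zero, add_zero] at h1
      refine h1.trans ?_
      have := hwn θ hθ w hw
      gcongr)
    (fun θ hθ w w' hw hw' => by
      have h1 := hlip (w + (θ : ℂ) • g) (w' + (θ : ℂ) • g)
      rw [add_sub_add_right_eq_sub] at h1
      simp only [add_zero]
      refine h1.trans ?_
      have h2 := hwn θ hθ w hw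
      have h3 := hwn θ hθ w' hw'
      have h4 : ‖w + (θ : ℂ) • g‖ + ‖w' + (θ : ℂ) • g‖ ≤ 2 * (R + ‖g‖) := by linarith
      rw [hL]
      gcongr)
    hdL (by linarith)
  refine ⟨δ, ⟨hδ, hdT⟩, U (a + δ), ?_, SimpleFunc.const ℝ (((δ⁻¹ : ℝ) : ℂ) • ζ), U, ?_, ?_, ?_, rfl⟩
  · have h1 := hsg δ ⟨hδ, hd2⟩
    have h2 : U (a + δ) - v - g = (U (a + δ) - (sgE ν γ δ v + 0 + g)) + (sgE ν γ δ v - v) := by abel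
    rw [h2]
    refine (norm_add_le _ _).trans_lt ?_
    linarith
  · intro t
    rw [SimpleFunc.const_apply]
    exact H.smul_mem _ hζ
  · have h1 : (fun τ k => f τ k + κ ((SimpleFunc.const ℝ (((δ⁻¹ : ℝ) : ℂ) • ζ)) τ) k) =
        fun τ k => f τ k + (((δ⁻¹ : ℝ) : ℂ) • g) k := by
      ext τ k
      rw [SimpleFunc.const_apply, hκ, hG]
      rfl
    rw [h1]
    exact hU
  · rw [hUa, add_zero]

set_option maxHeartbeats 1000000 in
-- With zero control and δ = M^{-(2p+1)}, homogeneity gives δ B(Mg) = B(g), while the other terms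
-- are of order M^{2p} and contribute O(1/M). The error e stands for the inaccuracy of the preceding
-- phase. As it is not known when M₀ is chosen, continuity of the semigroup is used only at v, and e
-- costs 2‖e‖.
theorem exists_traj_nonlin (hs : d < 2 * s) (hp : 1 ≤ p) (hν : 0 < ν) (hγ : 0 ≤ γ) (hf : LocForce f)
    (hκ : ∀ (z : ℂ) (ζ : L2T d) k, κ (z • ζ) k = z * κ ζ k) (G v : ESeq d) {A ε : ℝ} (hA : 0 ≤ A)
    (hε : 0 < ε) :
    ∃ M₀ : ℝ, 1 ≤ M₀ ∧ ∀ M, M₀ ≤ M → ∀ a ∈ Icc 0 A, ∀ e : ESeq d, ‖e‖ ≤ 1 → ∃ v',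
      ‖v' - (v + e + (M : ℂ) • inclE G - nonlinE s c p (inclE G))‖ ≤ ε + 2 * ‖e‖ ∧
      Traj ν γ c p s f κ H a (a + (M ^ (2 * p + 1))⁻¹) (v + e + (M : ℂ) • inclE G) v' := by
  obtain ⟨C, hC, hlip⟩ := norm_nonlinE_sub_le (d := d) hs c p
  set g := inclE G with hg
  set n := nonlinE s c p g with hn
  have hn2 : inclE (nonlinE (s + 2) c p G) = n := inclE_nonlinE hs c p G
  set l₀ := linE ν γ G with hl₀
  set l₁ := linE ν γ (-nonlinE (s + 2) c p G) with hl₁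
  have hneg : inclE (-nonlinE (s + 2) c p G) = -n := by
    rw [← neg_one_smul ℂ, inclE_smul, hn2, neg_one_smul]
  set R := ‖v‖ + 3 with hR
  set K := R + 2 * ‖g‖ + 2 * ‖n‖ with hK
  set B := ‖l₀‖ + ‖l₁‖ + C * (2 * K) ^ (2 * p) * K with hB
  set L := C * (2 * K) ^ (2 * p) with hL
  have hR0 : 0 ≤ R := by positivity
  have hK0 : 0 ≤ K := by positivity
  have hB0 : 0 ≤ B := by positivity
  have hL0 : 0 ≤ L := by positivity
  set ε' := min (ε / 4) 1 with hε'
  have hε'0 : 0 < ε' := by positivity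
  have hε1 : ε' ≤ 1 := min_le_right _ _
  have hε4 : ε' ≤ ε / 4 := min_le_left _ _
  obtain ⟨δ₁, hδ₁, hδ₁1, hduh⟩ := exists_duhE_small hν hγ hf hA hε'0
  obtain ⟨δ₂, hδ₂, hsg⟩ := exists_sgE_small hν hγ v hε'0
  refine ⟨1 + (B / ε' + 2 * L + 1 / δ₁ + 1 / δ₂), le_add_of_nonneg_right (by positivity),
    fun M hM a ha e he => ?_⟩
  have hb1 : 0 ≤ B / ε' := by positivity
  have hb2 : 0 < 1 / δ₁ := by positivity
  have hb3 : 0 < 1 / δ₂ := by positivity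
  have hM1 : 1 ≤ M := by linarith
  have hM0 : 0 < M := by linarith
  have hMB : B / M ≤ ε' := by
    rw [div_le_iff₀ hM0, mul_comm, ← div_le_iff₀ hε'0]; linarith
  have hML : L / M ≤ 1 / 2 := by
    rw [div_le_iff₀ hM0]; linarith
  set δ := (M ^ (2 * p + 1))⁻¹ with hδdef
  have hδ : 0 < δ := by positivity
  have hδM : δ ≤ 1 / M := by
    rw [hδdef, one_div]
    exact inv_anti₀ hM0 (le_self_pow₀ hM1 (by omega))
  have hd1 : δ ≤ δ₁ := hδM.trans (by rw [div_le_comm₀ hM0 hδ₁]; linarith)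
  have hd2 : δ ≤ δ₂ := hδM.trans (by rw [div_le_comm₀ hM0 hδ₂]; linarith)
  have hδpow : δ * M ^ (2 * p) = 1 / M := by
    rw [hδdef, pow_succ]; field_simp
  have hδinv : δ⁻¹ = M ^ (2 * p) * M := by rw [hδdef, inv_inv, pow_succ]
  have hMp : M ≤ M ^ (2 * p) := le_self_pow₀ hM1 (by omega)
  obtain ⟨hm, hfn⟩ := hf.mono (b := a + δ) ha.1
  have hθn : ∀ θ ∈ Icc (0 : ℝ) 1, ∀ A : ESeq d, ‖(θ : ℂ) • A‖ ≤ ‖A‖ := fun θ hθ A => by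
    rw [norm_smul, Complex.norm_real, Real.norm_of_nonneg hθ.1]
    exact mul_le_of_le_one_left (norm_nonneg _) hθ.2
  have hMn : ∀ A : ESeq d, ‖(M : ℂ) • A‖ = M * ‖A‖ := fun A => by
    rw [norm_smul, Complex.norm_real, Real.norm_of_nonneg hM0.le]
  have hNM : nonlinE s c p ((M : ℂ) • g) = ((δ⁻¹ : ℝ) : ℂ) • n := by
    rw [nonlinE_smul hs, hδinv, Complex.norm_real, Real.norm_of_nonneg hM0.le]
    push_cast; rfl
  have hwn : ∀ θ ∈ Icc (0 : ℝ) 1, ∀ w : ESeq d, ‖w‖ ≤ R →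
      ‖w + (M : ℂ) • g + (θ : ℂ) • (-n)‖ ≤ M * (R + ‖g‖ + ‖n‖) := fun θ hθ w hw => by
    have h1 := norm_add₃_le (a := w) (b := (M : ℂ) • g) (c := (θ : ℂ) • (-n))
    have h2 := hθn θ hθ (-n)
    rw [norm_neg] at h2
    rw [hMn] at h1
    nlinarith [norm_nonneg n, norm_nonneg g]
  have hmono : ∀ x : ℝ, 0 ≤ x → x ≤ M * (2 * K) → C * x ^ (2 * p) ≤ M ^ (2 * p) * L := by
    intro x hx0 hx
    calc C * x ^ (2 * p) ≤ C * (M * (2 * K)) ^ (2 * p) := by gcongr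
      _ = M ^ (2 * p) * L := by rw [hL, mul_pow]; ring
  obtain ⟨U, hU, hUa, hUb⟩ := exists_modeSol (c := c) (p := p) hs hν hγ hδ (hd1.trans hδ₁1) hm hfn
    (v + e) ((M : ℂ) • g) (-n) ((M : ℂ) • l₀) l₁ 0
    (fun k => by
      rw [lp.coeFn_smul, lp.coeFn_smul, Pi.smul_apply, Pi.smul_apply, linE_apply hν hγ, smul_eq_mul,
        smul_eq_mul]; ring)
    (fun k => by rw [← hneg]; exact linE_apply hν hγ _ k)
    (by rw [hg, ← inclE_smul]; exact tsum_wt_inclE_ne_top _)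
    (by rw [← hneg]; exact tsum_wt_inclE_ne_top _) hR0
    (q := M ^ (2 * p) * B) (L := M ^ (2 * p) * L) (by positivity) (by positivity)
    (fun t ht => hduh a ha δ ⟨hδ, hd1⟩ t ht)
    (fun θ hθ w hw => by
      -- Since B(Mg) = n/δ exactly, the profile derivative -n/δ removes the leading part of the
      -- nonlinearity. The remaining difference is O(M^{2p}), because its arguments are at bounded
      -- distance.
      have h1 : (M : ℂ) • l₀ + (θ : ℂ) • l₁ + nonlinE s c p (w + (M : ℂ) • g + (θ : ℂ) • (-n)) +
          ((δ⁻¹ : ℝ) : ℂ) • (-n) - 0 = ((M : ℂ) • l₀ + (θ : ℂ) • l₁) +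
          (nonlinE s c p (w + (M : ℂ) • g + (θ : ℂ) • (-n)) - nonlinE s c p ((M : ℂ) • g)) := by
        rw [hNM, smul_neg ((δ⁻¹ : ℝ) : ℂ) n, sub_zero, sub_eq_add_neg, add_assoc (_ + _)]
      rw [h1]
      have h2 := hlip (w + (M : ℂ) • g + (θ : ℂ) • (-n)) ((M : ℂ) • g)
      have h3 : ‖w + (M : ℂ) • g + (θ : ℂ) • (-n) - (M : ℂ) • g‖ ≤ K := by
        have : w + (M : ℂ) • g + (θ : ℂ) • (-n) - (M : ℂ) • g = w + (θ : ℂ) • (-n) := by abel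
        rw [this]
        have h4 := hθn θ hθ (-n)
        rw [norm_neg] at h4
        have h5 := norm_add_le w ((θ : ℂ) • (-n))
        rw [hK]
        linarith [norm_nonneg n, norm_nonneg g]
      have h4 := hmono (‖w + (M : ℂ) • g + (θ : ℂ) • (-n)‖ + ‖(M : ℂ) • g‖) (by positivity) (by
        rw [hMn]
        have := hwn θ hθ w hw
        have h0 : M * (2 * K) - (M * (R + ‖g‖ + ‖n‖) + M * ‖g‖) = M * (R + 2 * ‖g‖ + 3 * ‖n‖) := by
          rw [hK]; ring
        have h00 : 0 ≤ M * (R + 2 * ‖g‖ + 3 * ‖n‖) := by positivity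
        linarith)
      have h5 : ‖nonlinE s c p (w + (M : ℂ) • g + (θ : ℂ) • (-n)) - nonlinE s c p ((M : ℂ) • g)‖ ≤
          M ^ (2 * p) * L * K := h2.trans (mul_le_mul h4 h3 (norm_nonneg _) (by positivity))
      have h6 : ‖(M : ℂ) • l₀ + (θ : ℂ) • l₁‖ ≤ M ^ (2 * p) * (‖l₀‖ + ‖l₁‖) := by
        refine (norm_add_le _ _).trans ?_
        rw [hMn, mul_add]
        have h7 := hθn θ hθ l₁
        have h8 : ‖l₁‖ ≤ M ^ (2 * p) * ‖l₁‖ :=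
          le_mul_of_one_le_left (norm_nonneg _) (hM1.trans hMp)
        have h9 := mul_le_mul_of_nonneg_right hMp (norm_nonneg l₀)
        linarith
      refine (norm_add_le _ _).trans ((add_le_add h6 h5).trans_eq ?_)
      rw [hB]; ring)
    (fun θ hθ w w' hw hw' => by
      have h2 := hlip (w + (M : ℂ) • g + (θ : ℂ) • (-n)) (w' + (M : ℂ) • g + (θ : ℂ) • (-n))
      rw [add_sub_add_right_eq_sub, add_sub_add_right_eq_sub] at h2
      refine h2.trans ?_
      refine mul_le_mul_of_nonneg_right (hmono _ (by positivity) ?_) (norm_nonneg _)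
      have h3 := hwn θ hθ w hw
      have h4 := hwn θ hθ w' hw'
      have h0 : M * (2 * K) - 2 * (M * (R + ‖g‖ + ‖n‖)) = M * (2 * ‖g‖ + 2 * ‖n‖) := by
        rw [hK]; ring
      have h00 : 0 ≤ M * (2 * ‖g‖ + 2 * ‖n‖) := by positivity
      linarith)
    (by rw [← mul_assoc, hδpow, one_div_mul_eq_div]; exact hML)
    (by
      rw [← mul_assoc, hδpow, one_div_mul_eq_div]
      have := norm_add_le v e
      linarith)
  rw [← mul_assoc, hδpow, one_div_mul_eq_div] at hUb
  refine ⟨U (a + δ), ?_, SimpleFunc.const ℝ 0, U, fun t => H.zero_mem, ?_, hUa, rfl⟩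
  · have h1 := hsg δ ⟨hδ, hd2⟩
    have h2 := norm_sgE_le hν hγ hδ.le e
    rw [sgE_add hν hγ hδ.le] at hUb
    have h3 : U (a + δ) - (v + e + (M : ℂ) • g - n) =
        (U (a + δ) - (sgE ν γ δ v + sgE ν γ δ e + (M : ℂ) • g + -n)) +
        ((sgE ν γ δ v - v) + (sgE ν γ δ e - e)) := by abel
    rw [h3]
    have h4 := norm_add_le (U (a + δ) - (sgE ν γ δ v + sgE ν γ δ e + (M : ℂ) • g + -n))
        ((sgE ν γ δ v - v) + (sgE ν γ δ e - e))
    have h5 := norm_add_le (sgE ν γ δ v - v) (sgE ν γ δ e - e)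
    have h6 := norm_sub_le (sgE ν γ δ e) e
    linarith
  · have h1 : (fun τ k => f τ k + κ ((SimpleFunc.const ℝ (0 : L2T d)) τ) k) =
        fun τ k => f τ k + (0 : ESeq d) k := by
      ext τ k
      have := hκ 0 0 k
      rw [zero_smul, zero_mul] at this
      rw [SimpleFunc.const_apply, this]
      rfl
    rw [h1]
    exact hU

/-- Three phases: steer by Mg, evolve freely for time M^{-(2p+1)}, steer by -Mg. -/
theorem Steer.neg_nonlin (hs : d < 2 * s) (hp : 1 ≤ p) (hν : 0 < ν) (hγ : 0 ≤ γ) (hf : LocForce f)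
    (hκ : ∀ (z : ℂ) (ζ : L2T d) k, κ (z • ζ) k = z * κ ζ k) {G : ESeq d}
    (hG : ∀ μ : ℂ, Steer ν γ c p s f κ H (μ • inclE G)) :
    Steer ν γ c p s f κ H (-nonlinE s c p (inclE G)) := by
  intro a ha v ε hε T₀ hT₀
  -- M must be fixed before the duration T₁ of the first phase is known. Forcing T₁ < 1 below places
  -- the start of the second phase in [0, a + 1].
  obtain ⟨M₀, hM₀, hM⟩ := exists_traj_nonlin (c := c) (H := H) hs hp hν hγ hf hκ G v
    (A := a + 1) (ε := ε / 8) (by linarith) (by positivity)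
  set M := M₀ + 3 / T₀ with hMdef
  have h3 : 0 < 3 / T₀ := by positivity
  have hM1 : 1 ≤ M := by linarith
  have hM0 : 0 < M := by linarith
  set δ := (M ^ (2 * p + 1))⁻¹ with hδdef
  have hδ : 0 < δ := by positivity
  have hδT : δ < T₀ / 3 := by
    have h1 : δ ≤ M⁻¹ := inv_anti₀ hM0 (le_self_pow₀ hM1 (by omega))
    refine h1.trans_lt ?_
    rw [inv_lt_comm₀ hM0 (by positivity), inv_div]
    linarith
  obtain ⟨T₁, hT₁, v₁, hv₁, htr₁⟩ := hG M a ha v (min 1 (ε / 8)) (by positivity)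
    (min 1 (T₀ / 3)) (by positivity)
  have hT₁1 : T₁ < 1 := hT₁.2.trans_le (min_le_left _ _)
  have hT₁3 : T₁ < T₀ / 3 := hT₁.2.trans_le (min_le_right _ _)
  have hT₁0 := hT₁.1
  set e := v₁ - v - (M : ℂ) • inclE G with he
  have he1 : ‖e‖ ≤ 1 := hv₁.le.trans (min_le_left _ _)
  have he2 : ‖e‖ < ε / 8 := hv₁.trans_le (min_le_right _ _)
  obtain ⟨v₂, hv₂, htr₂⟩ := hM M (by linarith) (a + T₁) ⟨by linarith, by linarith⟩ e he1
  have hv₁e : v + e + (M : ℂ) • inclE G = v₁ := by rw [he]; abel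
  rw [hv₁e] at hv₂ htr₂
  obtain ⟨T₃, hT₃, v₃, hv₃, htr₃⟩ := hG (-M) (a + T₁ + δ) (by linarith) v₂ (ε / 8) (by positivity)
    (T₀ / 3) (by positivity)
  refine ⟨T₁ + δ + T₃, ⟨by linarith [hT₃.1], by linarith [hT₃.2]⟩, v₃, ?_, ?_⟩
  · have h1 : v₃ - v - -nonlinE s c p (inclE G) = (v₃ - v₂ - (-M : ℂ) • inclE G) +
        ((v₂ - (v₁ - nonlinE s c p (inclE G))) + e) := by
      rw [he, neg_smul]; abel
    rw [h1]
    have h2 := norm_add_le (v₃ - v₂ - (-M : ℂ) • inclE G)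
      ((v₂ - (v₁ - nonlinE s c p (inclE G))) + e)
    have h4 := norm_add_le (v₂ - (v₁ - nonlinE s c p (inclE G))) e
    linarith
  · rw [← add_assoc, ← add_assoc]
    exact (htr₁.trans hs hf ha (by linarith) (by linarith) htr₂).trans hs hf ha (by linarith)
      (by linarith [hT₃.1]) htr₃

/-- Keep the argument of z and take the (2p+1)-th root of its modulus. By homogeneity of B, the
single displacement -B(g) then yields all complex multiples of B(g). -/
theorem exists_pow_mul_eq (p : ℕ) (z : ℂ) : ∃ μ : ℂ, ((‖μ‖ ^ (2 * p) : ℝ) : ℂ) * μ = z := by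
  by_cases hz : z = 0
  · exact ⟨0, by simp [hz]⟩
  have hz' : 0 < ‖z‖ := norm_pos_iff.2 hz
  set ρ : ℝ := ‖z‖ ^ ((2 * p + 1 : ℕ) : ℝ)⁻¹ with hρ
  have hρ0 : 0 < ρ := by positivity
  have hρp : ρ ^ (2 * p + 1) = ‖z‖ := Real.rpow_inv_natCast_pow hz'.le (by omega)
  refine ⟨((ρ / ‖z‖ : ℝ) : ℂ) * z, ?_⟩
  have h1 : ‖((ρ / ‖z‖ : ℝ) : ℂ) * z‖ = ρ := by
    rw [norm_mul, Complex.norm_real, Real.norm_of_nonneg (by positivity)]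
    field_simp
  rw [h1, ← mul_assoc, ← Complex.ofReal_mul]
  have h2 : ρ ^ (2 * p) * (ρ / ‖z‖) = 1 := by
    rw [← mul_div_assoc, ← pow_succ, hρp, div_self hz'.ne']
  rw [h2, Complex.ofReal_one, one_mul]

theorem Steer.smul_nonlin (hs : d < 2 * s) (hp : 1 ≤ p) (hν : 0 < ν) (hγ : 0 ≤ γ) (hf : LocForce f)
    (hκ : ∀ (z : ℂ) (ζ : L2T d) k, κ (z • ζ) k = z * κ ζ k) {G : ESeq d}
    (hG : ∀ μ : ℂ, Steer ν γ c p s f κ H (μ • inclE G)) (z : ℂ) :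
    Steer ν γ c p s f κ H (z • nonlinE s c p (inclE G)) := by
  obtain ⟨μ, hμ⟩ := exists_pow_mul_eq p (-z)
  have h := Steer.neg_nonlin (c := c) (H := H) (G := μ • G) hs hp hν hγ hf hκ (fun μ' => by
    rw [inclE_smul, smul_smul]; exact hG _)
  rwa [inclE_smul, nonlinE_smul hs, hμ, neg_smul, neg_neg] at h

end

/-! ### Smooth functions on the torus -/

theorem torusMk_add {d : ℕ} (x y : Fin d → ℝ) : torusMk d (x + y) = torusMk d x + torusMk d y := rfl

theorem torusMk_zero {d : ℕ} : torusMk d 0 = 0 := rfl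

theorem isOpenQuotientMap_torusMk (d : ℕ) : IsOpenQuotientMap (torusMk d) :=
  IsOpenQuotientMap.piMap fun _ => QuotientAddGroup.isOpenQuotientMap_mk

theorem TorusSmooth.continuous {d : ℕ} {f : Torus d → ℝ} (hf : TorusSmooth f) : Continuous f :=
  (isOpenQuotientMap_torusMk d).isQuotientMap.continuous_iff.2 (ContDiff.continuous hf)

/-- The translation of length `t` in direction `i`. -/
noncomputable def shift {d : ℕ} (i : Fin d) (t : ℝ) : Torus d := torusMk d (t • Pi.single i 1)

/-- The partial derivative of a function on the torus. -/
noncomputable def pd {d : ℕ} (i : Fin d) (f : Torus d → ℝ) (x : Torus d) : ℝ :=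
  deriv (fun t => f (x + shift i t)) 0

theorem TorusSmooth.hasDerivAt_lift {d : ℕ} {f : Torus d → ℝ} (hf : TorusSmooth f) (i : Fin d)
    (x : Fin d → ℝ) (t : ℝ) : HasDerivAt (fun t => f (torusMk d x + shift i t))
      (fderiv ℝ (fun y => f (torusMk d y)) (x + t • Pi.single i 1) (Pi.single i 1)) t := by
  have h1 : HasFDerivAt (fun y => f (torusMk d y))
      (fderiv ℝ (fun y => f (torusMk d y)) (x + t • Pi.single i 1)) (x + t • Pi.single i 1) :=
    (ContDiff.differentiable hf (by simp)).differentiableAt.hasFDerivAt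
  have h2 : HasDerivAt (fun t : ℝ => x + t • (Pi.single i 1 : Fin d → ℝ)) (Pi.single i 1) t := by
    simpa using ((hasDerivAt_id t).smul_const (Pi.single i 1 : Fin d → ℝ)).const_add x
  exact h1.comp_hasDerivAt t h2

theorem TorusSmooth.pd_mk {d : ℕ} {f : Torus d → ℝ} (hf : TorusSmooth f) (i : Fin d)
    (x : Fin d → ℝ) : pd i f (torusMk d x) =
      fderiv ℝ (fun y => f (torusMk d y)) x (Pi.single i 1) := by
  have := (hf.hasDerivAt_lift i x 0).deriv
  rwa [zero_smul, add_zero] at this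

theorem TorusSmooth.hasDerivAt {d : ℕ} {f : Torus d → ℝ} (hf : TorusSmooth f) (i : Fin d)
    (x : Torus d) (t : ℝ) : HasDerivAt (fun t => f (x + shift i t)) (pd i f (x + shift i t)) t := by
  obtain ⟨y, rfl⟩ := (isOpenQuotientMap_torusMk d).surjective x
  have h := hf.hasDerivAt_lift i y t
  rw [shift, ← torusMk_add, hf.pd_mk]
  exact h

theorem TorusSmooth.smooth_pd {d : ℕ} {f : Torus d → ℝ} (hf : TorusSmooth f) (i : Fin d) :
    TorusSmooth (pd i f) := by
  unfold TorusSmooth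
  simp only [hf.pd_mk]
  exact (ContDiff.fderiv_right hf (by simp)).clm_apply contDiff_const

theorem torusChar_add_arg {d : ℕ} (k : Fin d → ℤ) (x y : Torus d) :
    torusChar k (x + y) = torusChar k x * torusChar k y := by
  simp only [torusChar, Pi.add_apply, fourier_apply, smul_add, AddCircle.toCircle_add,
    Circle.coe_mul, Finset.prod_mul_distrib]

theorem torusChar_shift {d : ℕ} (k : Fin d → ℤ) (i : Fin d) (t : ℝ) :
    torusChar k (shift i t) = Complex.exp (Complex.I * k i * t) := by
  rw [torusChar, Finset.prod_eq_single i]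
  · have : shift i t i = ((t : ℝ) : AddCircle (2 * Real.pi)) := by simp [shift, torusMk]
    rw [this, fourier_coe_apply]
    congr 1
    have : (Real.pi : ℂ) ≠ 0 := Complex.ofReal_ne_zero.2 Real.pi_ne_zero
    push_cast
    field_simp
  · intro j _ hj
    have : shift i t j = 0 := by simp [shift, torusMk, hj]
    rw [this, fourier_eval_zero]
  · simp

theorem integral_shift {d : ℕ} (f : Torus d → ℝ) (k : Fin d → ℤ) (i : Fin d) (t : ℝ) :
    ∫ x, (f (x + shift i t) : ℂ) * starRingEnd ℂ (torusChar k x) =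
      Complex.exp (Complex.I * k i * t) * ∫ x, (f x : ℂ) * starRingEnd ℂ (torusChar k x) := by
  rw [← integral_add_right_eq_self (fun x => (f x : ℂ) * starRingEnd ℂ (torusChar k x)) (shift i t),
    ← integral_const_mul]
  congr 1; ext x
  rw [torusChar_add_arg, map_mul, torusChar_shift]
  have : Complex.exp (Complex.I * k i * t) *
      starRingEnd ℂ (Complex.exp (Complex.I * k i * t)) = 1 := by
    rw [← Complex.exp_conj, ← Complex.exp_add]
    simp
  linear_combination (-(f (x + shift i t) : ℂ) * starRingEnd ℂ (torusChar k x)) * this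

theorem TorusSmooth.integrable {d : ℕ} {f : Torus d → ℝ} (hf : TorusSmooth f) :
    Integrable fun x => (f x : ℂ) :=
  (Continuous.integrable_of_hasCompactSupport (by have := hf.continuous; fun_prop)
    (HasCompactSupport.of_compactSpace _))

/-- Translating f multiplies its coefficient by a phase (`integral_shift`). Differentiating both
sides at t = 0 replaces integration by parts. -/
theorem TorusSmooth.coeff_pd {d : ℕ} {f : Torus d → ℝ} (hf : TorusSmooth f) (i : Fin d)
    (k : Fin d → ℤ) : coeff (fun x => (pd i f x : ℂ)) k =
      Complex.I * k i * coeff (fun x => (f x : ℂ)) k := by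
  obtain ⟨C, hC⟩ := isCompact_univ.exists_bound_of_continuousOn (hf.smooth_pd i).continuous.continuousOn
  have hsh : shift i 0 = (0 : Torus d) := by simp [shift, torusMk_zero]
  have hF : ∀ t : ℝ, Continuous fun x => (f (x + shift i t) : ℂ) * starRingEnd ℂ (torusChar k x) :=
    fun t => by
      have h1 := hf.continuous
      have h2 := continuous_torusChar k
      exact (Complex.continuous_ofReal.comp (h1.comp (continuous_id.add continuous_const))).mul
        (Complex.continuous_conj.comp h2)
  have hF' : Continuous fun x => (pd i f (x + shift i 0) : ℂ) * starRingEnd ℂ (torusChar k x) := by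
    have h1 := (hf.smooth_pd i).continuous
    have h2 := continuous_torusChar k
    exact (Complex.continuous_ofReal.comp (h1.comp (continuous_id.add continuous_const))).mul
      (Complex.continuous_conj.comp h2)
  have h := (hasDerivAt_integral_of_dominated_loc_of_deriv_le (μ := (volume : Measure (Torus d)))
    (F := fun (t : ℝ) x => (f (x + shift i t) : ℂ) * starRingEnd ℂ (torusChar k x))
    (F' := fun (t : ℝ) x => (pd i f (x + shift i t) : ℂ) * starRingEnd ℂ (torusChar k x))
    (x₀ := 0) (bound := fun _ => C) (s := univ) univ_mem
    (Eventually.of_forall fun t => (hF t).aestronglyMeasurable)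
    ((hF 0).integrable_of_hasCompactSupport (HasCompactSupport.of_compactSpace _))
    hF'.aestronglyMeasurable
    (ae_of_all _ fun x t _ => by
      rw [norm_mul, RCLike.norm_conj, norm_torusChar, mul_one, Complex.norm_real]
      exact hC _ (mem_univ _))
    (integrable_const _)
    (ae_of_all _ fun x t _ => ((hf.hasDerivAt i x t).ofReal_comp).mul_const _)).2
  have h2 : HasDerivAt (fun t : ℝ => Complex.exp (Complex.I * k i * t) *
      ∫ x, (f x : ℂ) * starRingEnd ℂ (torusChar k x))
      (Complex.I * k i * ∫ x, (f x : ℂ) * starRingEnd ℂ (torusChar k x)) 0 := by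
    have h3 : HasDerivAt (fun t : ℝ => Complex.I * k i * (t : ℂ)) (Complex.I * k i * 1) 0 :=
      (hasDerivAt_id (0 : ℝ)).ofReal_comp.const_mul _
    have h4 := h3.cexp.mul_const (∫ x, (f x : ℂ) * starRingEnd ℂ (torusChar k x))
    simpa using h4
  have hfun : (fun t : ℝ => ∫ x, (f (x + shift i t) : ℂ) * starRingEnd ℂ (torusChar k x)) =
      fun t : ℝ => Complex.exp (Complex.I * k i * t) *
        ∫ x, (f x : ℂ) * starRingEnd ℂ (torusChar k x) := funext fun t => integral_shift f k i t
  rw [hfun] at h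
  have h5 := h.unique h2
  simp only [hsh, add_zero] at h5
  rw [coeff, coeff, h5]
  ring

/-- The operator `1 - Δ`. -/
noncomputable def bessel {d : ℕ} (f : Torus d → ℝ) (x : Torus d) : ℝ := f x - ∑ i, pd i (pd i f) x

theorem TorusSmooth.smooth_bessel {d : ℕ} {f : Torus d → ℝ} (hf : TorusSmooth f) :
    TorusSmooth (bessel f) := by
  refine ContDiff.sub hf (ContDiff.sum fun i _ => ?_)
  exact (hf.smooth_pd i).smooth_pd i

theorem TorusSmooth.coeff_bessel {d : ℕ} {f : Torus d → ℝ} (hf : TorusSmooth f) (k : Fin d → ℤ) :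
    coeff (fun x => (bessel f x : ℂ)) k = (wt k : ℂ) ^ 2 * coeff (fun x => (f x : ℂ)) k := by
  have h1 : ∀ i, coeff (fun x => (pd i (pd i f) x : ℂ)) k =
      -((k i : ℂ) ^ 2) * coeff (fun x => (f x : ℂ)) k := fun i => by
    rw [(hf.smooth_pd i).coeff_pd, hf.coeff_pd]
    linear_combination ((k i : ℂ) ^ 2 * coeff (fun x => (f x : ℂ)) k) * Complex.I_sq
  have h2 : coeff (fun x => ∑ i, (pd i (pd i f) x : ℂ)) k =
      ∑ i, coeff (fun x => (pd i (pd i f) x : ℂ)) k := by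
    simp only [coeff, Finset.sum_mul]
    rw [integral_finsetSum _ fun i _ => integrable_mul_torusChar ((hf.smooth_pd i).smooth_pd i).integrable k,
      Finset.mul_sum]
  have h3 : (fun x => (bessel f x : ℂ)) =
      fun x => (f x : ℂ) + (-1 : ℂ) * ∑ i, (pd i (pd i f) x : ℂ) := by
    ext x
    simp only [bessel]
    push_cast; ring
  rw [h3, coeff_add hf.integrable, coeff_const_mul, h2]
  · simp only [h1]
    rw [← Complex.ofReal_pow, wt_sq, ← Finset.sum_mul, freqSq]
    push_cast
    rw [Finset.sum_neg_distrib]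
    ring
  · exact (integrable_finsetSum _ fun i _ => ((hf.smooth_pd i).smooth_pd i).integrable).const_mul _

/-- Applying 1 - Δ r times gives a bounded function, so the coefficients decay like wt^{-2r}, and
wt^{-r} is square-summable. Hence χ has coordinates in H^{s+2}, and multiplication by it stays
there. -/
theorem TorusSmooth.tsum_coeff_ne_top {d : ℕ} {f : Torus d → ℝ} (hf : TorusSmooth f) {r : ℕ}
    (hr : d < 2 * r) : ∑' k, ‖(wt k : ℂ) ^ r * coeff (fun x => (f x : ℂ)) k‖ₑ ^ 2 ≠ ∞ := by
  have hit : ∀ n : ℕ, TorusSmooth (bessel^[n] f) ∧ ∀ k,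
      coeff (fun x => ((bessel^[n] f) x : ℂ)) k =
        (wt k : ℂ) ^ (2 * n) * coeff (fun x => (f x : ℂ)) k := by
    intro n
    induction n with
    | zero => exact ⟨hf, fun k => by simp⟩
    | succ n ih =>
      rw [Function.iterate_succ_apply']
      refine ⟨ih.1.smooth_bessel, fun k => ?_⟩
      rw [ih.1.coeff_bessel, ih.2]
      ring
  obtain ⟨h1, h2⟩ := hit r
  obtain ⟨C, hC⟩ := isCompact_univ.exists_bound_of_continuousOn h1.continuous.continuousOn
  have h3 : ∀ k : Fin d → ℤ, ‖(wt k : ℂ) ^ r * coeff (fun x => (f x : ℂ)) k‖ₑ ^ 2 ≤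
      ENNReal.ofReal C ^ 2 * ENNReal.ofReal ((wt k)⁻¹ ^ r) ^ 2 := fun k => by
    rw [← mul_pow]
    refine pow_le_pow_left' ?_ 2
    have hw := wt_pos k
    have h4 := norm_coeff_le (f := fun x => ((bessel^[r] f) x : ℂ)) (C := C)
      (fun x => by rw [Complex.norm_real]; exact hC x (mem_univ _)) k
    rw [h2] at h4
    have hC0 : 0 ≤ C := (norm_nonneg _).trans h4
    rw [← ofReal_norm, ← ENNReal.ofReal_mul hC0]
    refine ENNReal.ofReal_le_ofReal ?_
    have h5 : (wt k : ℂ) ^ r * coeff (fun x => (f x : ℂ)) k =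
        ((wt k : ℂ) ^ (2 * r) * coeff (fun x => (f x : ℂ)) k) * ((wt k : ℂ)⁻¹ ^ r) := by
      have := wt_ne_zero k
      rw [two_mul, pow_add, inv_pow]
      field_simp
    rw [h5, norm_mul, norm_pow, norm_inv, Complex.norm_real, Real.norm_of_nonneg hw.le]
    gcongr
  refine ne_top_of_le_ne_top ?_ (ENNReal.tsum_le_tsum h3)
  rw [ENNReal.tsum_mul_left, ← wtSum]
  have := wtSum_ne_top hr
  finiteness

/-! ### Sobolev norms in Fourier coordinates -/

theorem sobolevENorm_sq {d : ℕ} (r : ℕ) (f : L2T d) :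
    sobolevENorm r f ^ 2 = ∑' k, ‖(wt k : ℂ) ^ r * coeff f k‖ₑ ^ 2 := by
  have e : ∀ a : ℝ≥0∞, (a ^ (1 / 2 : ℝ)) ^ 2 = a := fun a => by
    rw [← ENNReal.rpow_natCast, ← ENNReal.rpow_mul]; norm_num
  rw [sobolevENorm, e]
  congr 1; ext1 k
  rw [enorm_mul, mul_pow, ← wt_sq, ← pow_mul, enorm_pow, ← ofReal_norm (wt k : ℂ),
    Complex.norm_real, Real.norm_of_nonneg (wt_pos k).le, ← pow_mul, mul_comm r 2,
    ENNReal.ofReal_pow (wt_pos k).le]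

theorem MemSobolev.tsum_ne_top {d r : ℕ} {f : L2T d} (hf : MemSobolev r f) :
    ∑' k, ‖(wt k : ℂ) ^ r * coeff f k‖ₑ ^ 2 ≠ ∞ := by
  rw [← sobolevENorm_sq]
  exact ENNReal.pow_ne_top (ne_of_lt hf)

theorem toL2_Phi_enc_of_mem {d r : ℕ} (hr : d < 2 * r) {f : L2T d} (hf : MemSobolev r f) :
    toL2 d (Phi r (enc r f)) = f := toL2_Phi_enc hr hf.tsum_ne_top

theorem toL2_injective (d : ℕ) : Function.Injective (toL2 d) :=
  ContinuousMap.toLp_injective (p := 2) (𝕜 := ℂ) volume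

theorem toL2_eq_iff {d : ℕ} (f : C(Torus d, ℂ)) (g : L2T d) : toL2 d f = g ↔ g =ᵐ[volume] f := by
  constructor
  · rintro rfl; exact coeFn_toL2 f
  · intro h; exact Lp.ext ((coeFn_toL2 f).trans h.symm)

/-- The Fourier coordinates in `H^s` of the source term `χ ζ`. -/
noncomputable def ctlSeq {d : ℕ} (χ : Torus d → ℝ) (s : ℕ) (ζ : L2T d) (k : Fin d → ℤ) : ℂ :=
  (wt k : ℂ) ^ s * coeff (fun x => (χ x : ℂ) * ζ x) k

theorem ctlSeq_smul {d : ℕ} (χ : Torus d → ℝ) (s : ℕ) (z : ℂ) (ζ : L2T d) (k : Fin d → ℤ) :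
    ctlSeq χ s (z • ζ) k = z * ctlSeq χ s ζ k := by
  have h : coeff (fun x => (χ x : ℂ) * (z • ζ : L2T d) x) k =
      coeff (fun x => z * ((χ x : ℂ) * ζ x)) k := by
    refine coeff_congr ?_ k
    filter_upwards [Lp.coeFn_smul z ζ] with x hx
    rw [hx, Pi.smul_apply, smul_eq_mul]; ring
  rw [ctlSeq, ctlSeq, h, coeff_const_mul]; ring

/-- The Fourier coordinates in `H^s` of the forcing term `h`. -/
noncomputable def forceSeq {d : ℕ} (h : ℝ → L2T d) (s : ℕ) (τ : ℝ) (k : Fin d → ℤ) : ℂ :=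
  (wt k : ℂ) ^ s * coeff (h τ) k

theorem locForce_forceSeq {d s : ℕ} (hs : 1 ≤ s) {h : ℝ → L2T d}
    (hh : ∀ T : ℝ, 0 < T → MemL2Sobolev T (s - 1) h) : LocForce (forceSeq h s) := by
  intro T hT
  obtain ⟨h1, h2⟩ := hh T hT
  have hm : ForceMeas 0 T (forceSeq h s) := fun k =>
    ((continuous_coeff_L2 k).comp_aestronglyMeasurable h1).const_mul _
  refine ⟨hm, ?_⟩
  simp only [sobolevENorm_sq] at h2
  refine ne_top_of_le_ne_top h2.ne ?_
  rw [lintegral_tsum]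
  · refine ENNReal.tsum_le_tsum fun k => ?_
    rw [← lintegral_const_mul' _ _ (by finiteness)]
    refine lintegral_mono fun τ => ?_
    rw [← mul_pow]
    refine pow_le_pow_left' ?_ 2
    have hw : ‖(wt k : ℂ)‖ₑ = ENNReal.ofReal (wt k) := by
      rw [← ofReal_norm, Complex.norm_real, Real.norm_of_nonneg (wt_pos k).le]
    obtain ⟨n, rfl⟩ : ∃ n, s = n + 1 := ⟨s - 1, by omega⟩
    rw [forceSeq, Nat.add_sub_cancel, pow_succ', mul_assoc, enorm_mul, hw, ← mul_assoc,
      mul_comm (ENNReal.ofReal _), ofReal_wt_mul_inv, one_mul]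
  · exact fun k => ((((continuous_coeff_L2 k).comp_aestronglyMeasurable h1).const_mul _).enorm).pow_const 2

/-! ### Lifting the saturating sequence -/

section Lift

variable {d : ℕ} {ν γ c : ℝ} {p s : ℕ} {f : ℝ → (Fin d → ℤ) → ℂ} {χ : Torus d → ℝ}
  {H : Submodule ℂ (L2T d)}

/-- `g` belongs to `H^{s+2}`, and all the multiples of `χ^n g` with `n = (2p+1)^m` can be realized
as displacements. -/
def Lifted (ν γ c : ℝ) (p s : ℕ) (f : ℝ → (Fin d → ℤ) → ℂ) (χ : Torus d → ℝ)
    (H : Submodule ℂ (L2T d)) (m : ℕ) (g : L2T d) : Prop :=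
  ∃ G F : ESeq d, toL2 d (Phi (s + 2) G) = g ∧
    (∀ x, Phi (s + 2) F x = (χ x : ℂ) ^ (2 * p + 1) ^ m * Phi (s + 2) G x) ∧
    ∀ μ : ℂ, Steer ν γ c p s f (ctlSeq χ s) H (μ • inclE F)

theorem lifted_of_mem (hs : d < 2 * s) (hν : 0 < ν) (hγ : 0 ≤ γ) (hf : LocForce f)
    (hχ : TorusSmooth χ) (hH : ∀ g ∈ H, MemSobolev (s + 2) g) {ζ : L2T d} (hζ : ζ ∈ H) :
    Lifted ν γ c p s f χ H 0 ζ := by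
  have hs2 : d < 2 * (s + 2) := by omega
  have hrep := toL2_Phi_enc_of_mem hs2 (hH ζ hζ)
  let χC : C(Torus d, ℂ) := ⟨fun x => (χ x : ℂ), Complex.continuous_ofReal.comp hχ.continuous⟩
  have hX : Phi (s + 2) (enc (s + 2) χC) = χC := Phi_enc hs2 (hχ.tsum_coeff_ne_top hs2)
  set G := enc (s + 2) ζ with hG
  set F := mulE (s + 2) (enc (s + 2) χC) G with hF
  have hPF : Phi (s + 2) F = χC * Phi (s + 2) G := by rw [hF, Phi_mulE hs2, hX]
  have hcoord : ∀ k, ctlSeq χ s ζ k = inclE F k := fun k => by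
    have h1 := coeff_Phi hs (inclE F) k
    rw [Phi_inclE hs, hPF] at h1
    have h2 : coeff (fun x => (χ x : ℂ) * ζ x) k = coeff (χC * Phi (s + 2) G : C(Torus d, ℂ)) k := by
      refine coeff_congr ?_ k
      filter_upwards [(toL2_eq_iff _ _).1 hrep] with x hx
      rw [hx]; rfl
    rw [ctlSeq, h2, h1, mul_div_cancel₀ _ (pow_ne_zero s (wt_ne_zero k))]
  refine ⟨G, F, hrep, fun x => ?_, fun μ => ?_⟩
  · rw [pow_zero, pow_one, hPF]; rfl
  · rw [← inclE_smul]
    refine steer_control hs hν hγ hf (ctlSeq_smul χ s) (H.smul_mem μ hζ) fun k => ?_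
    rw [ctlSeq_smul, hcoord, inclE_smul]; rfl

theorem continuous_nonlin (c : ℝ) (p : ℕ) : Continuous (nonlin c p) := by
  unfold nonlin; fun_prop

/-- Induction on the level through B(χ^n ζ) = χ^{(2p+1)n} B(ζ). The power of χ depends on the level
alone, so it is common to all the functions combined in a span. -/
theorem lifted_of_mem_satSeq (hs : d < 2 * s) (hp : 1 ≤ p) (hν : 0 < ν) (hγ : 0 ≤ γ)
    (hf : LocForce f) (hχ : TorusSmooth χ) (hχ0 : ∀ x, 0 ≤ χ x)
    (hH : ∀ g ∈ H, MemSobolev (s + 2) g) (m : ℕ) :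
    ∀ g ∈ satSeq c p H m, Lifted ν γ c p s f χ H m g := by
  have hs2 : d < 2 * (s + 2) := by omega
  induction m with
  | zero => exact fun g hg => lifted_of_mem hs hν hγ hf hχ hH hg
  | succ m ih =>
    intro g hg
    rw [satSeq] at hg
    induction hg using Submodule.span_induction with
    | mem g hg =>
      obtain ⟨ζ, hζ, hgζ⟩ := hg
      obtain ⟨G, F, hG, hF, hst⟩ := ih ζ hζ
      refine ⟨nonlinE (s + 2) c p G, nonlinE (s + 2) c p F, ?_, fun x => ?_, fun μ => ?_⟩
      · rw [toL2_eq_iff]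
        filter_upwards [hgζ, (toL2_eq_iff _ _).1 hG] with x hx1 hx2
        rw [hx1, hx2, Phi_nonlinE hs2]
      · rw [Phi_nonlinE hs2, Phi_nonlinE hs2, hF, nonlin_mul, norm_pow, Complex.norm_real,
          Real.norm_of_nonneg (hχ0 x), pow_succ (2 * p + 1), pow_mul]
        push_cast
        ring
      · rw [inclE_nonlinE hs]
        exact Steer.smul_nonlin hs hp hν hγ hf (ctlSeq_smul χ s) hst μ
    | zero =>
      obtain ⟨G, F, hG, hF, hst⟩ := ih 0 (Submodule.zero_mem _)
      refine ⟨0, 0, ?_, fun x => ?_, fun μ => ?_⟩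
      · have : Phi (s + 2) (0 : ESeq d) = 0 := by simpa using Phi_smul hs2 0 (0 : ESeq d)
        rw [this, map_zero]
      · have : Phi (s + 2) (0 : ESeq d) = 0 := by simpa using Phi_smul hs2 0 (0 : ESeq d)
        simp [this]
      · have h1 := hst 0
        have h2 := inclE_smul 0 (0 : ESeq d)
        rw [zero_smul, zero_smul] at h2
        rw [zero_smul] at h1
        rwa [h2, smul_zero]
    | add g₁ g₂ _ _ h₁ h₂ =>
      obtain ⟨G₁, F₁, hG₁, hF₁, hst₁⟩ := h₁
      obtain ⟨G₂, F₂, hG₂, hF₂, hst₂⟩ := h₂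
      refine ⟨G₁ + G₂, F₁ + F₂, ?_, fun x => ?_, fun μ => ?_⟩
      · rw [Phi_add hs2, map_add, hG₁, hG₂]
      · rw [Phi_add hs2, Phi_add hs2, ContinuousMap.add_apply, ContinuousMap.add_apply, hF₁, hF₂,
          mul_add]
      · rw [inclE_add, smul_add]
        exact (hst₁ μ).add hs hf (hst₂ μ)
    | smul z g _ h =>
      obtain ⟨G, F, hG, hF, hst⟩ := h
      refine ⟨z • G, z • F, ?_, fun x => ?_, fun μ => ?_⟩
      · rw [Phi_smul hs2, map_smul, hG]
      · rw [Phi_smul hs2, Phi_smul hs2, ContinuousMap.smul_apply, ContinuousMap.smul_apply, hF,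
          smul_eq_mul, smul_eq_mul]
        ring
      · rw [inclE_smul, smul_smul]
        exact hst _

end Lift

/-! ### Polarization -/

open Polynomial in
-- Lagrange interpolation at the nodes 0, …, N - 1: a single set of weights extracts the linear
-- coefficient of every such polynomial.
theorem exists_coeff_one_weights (N : ℕ) : ∃ w : Fin N → ℂ, ∀ q : ℂ[X], q.degree < N →
    q.coeff 1 = ∑ i, w i * q.eval ((i : ℕ) : ℂ) := by
  have hinj : Set.InjOn (fun i : Fin N => ((i : ℕ) : ℂ)) (Finset.univ : Finset (Fin N)) := by
    intro i _ j _ h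
    exact Fin.ext (Nat.cast_injective h)
  refine ⟨fun i => (Lagrange.basis Finset.univ (fun i : Fin N => ((i : ℕ) : ℂ)) i).coeff 1,
    fun q hq => ?_⟩
  have h := Lagrange.eq_interpolate hinj (f := q) (by simpa using hq)
  rw [Lagrange.interpolate_apply] at h
  conv_lhs => rw [h]
  rw [finsetSum_coeff]
  refine Finset.sum_congr rfl fun i _ => ?_
  rw [coeff_C_mul, mul_comm]

open Polynomial in
-- For real t, B(1 + tz) = ic (1 + tz)^{p+1} (1 + t z̄)^p is a polynomial of degree at most 2p + 1
-- in t, so 2p + 2 nodes extract its linear coefficient, with weights independent of z and hence of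
-- the point x.
theorem exists_polarization (c : ℝ) (p : ℕ) : ∃ w : Fin (2 * p + 2) → ℂ, ∀ z : ℂ,
    ∑ i, w i * nonlin c p (1 + ((i : ℕ) : ℂ) * z) =
      Complex.I * c * ((p + 1) * z + p * starRingEnd ℂ z) := by
  obtain ⟨w, hw⟩ := exists_coeff_one_weights (2 * p + 2)
  refine ⟨w, fun z => ?_⟩
  let q : ℂ[X] := C (Complex.I * c) * ((1 + C z * X) ^ (p + 1) * (1 + C (starRingEnd ℂ z) * X) ^ p)
  have hdeg : q.degree < (2 * p + 2 : ℕ) := by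
    have h1 : ∀ a : ℂ, (1 + C a * X : ℂ[X]).natDegree ≤ 1 := fun a => by
      rw [add_comm, ← C_1]; exact natDegree_linear_le
    have h2 : q.natDegree ≤ 2 * p + 1 := by
      refine (natDegree_C_mul_le _ _).trans (natDegree_mul_le.trans ?_)
      have h3 := natDegree_pow_le_of_le (p + 1) (h1 z)
      have h4 := natDegree_pow_le_of_le p (h1 (starRingEnd ℂ z))
      omega
    refine degree_le_natDegree.trans_lt ?_
    exact_mod_cast Nat.lt_succ_of_le h2
  have h := hw q hdeg
  have hev : ∀ i : Fin (2 * p + 2), q.eval ((i : ℕ) : ℂ) = nonlin c p (1 + ((i : ℕ) : ℂ) * z) := by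
    intro i
    have hn : ((‖1 + ((i : ℕ) : ℂ) * z‖ ^ (2 * p) : ℝ) : ℂ) =
        (1 + z * ((i : ℕ) : ℂ)) ^ p * (1 + starRingEnd ℂ z * ((i : ℕ) : ℂ)) ^ p := by
      rw [pow_mul, ← Complex.normSq_eq_norm_sq, Complex.ofReal_pow, ← Complex.mul_conj, mul_pow]
      simp only [map_add, map_mul, map_one, Complex.conj_natCast]
      ring
    rw [nonlin, hn]
    simp only [q, eval_mul, eval_C, eval_pow, eval_add, eval_one, eval_X]
    ring
  simp only [hev] at h
  rw [← h]
  have hc : q.coeff 1 = (derivative q).eval 0 := by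
    rw [← coeff_zero_eq_eval_zero, coeff_derivative]; simp
  rw [hc]
  simp only [q, derivative_mul, derivative_C, derivative_pow, derivative_add, derivative_one,
    derivative_X, eval_add, eval_mul, eval_C, eval_pow, eval_one, eval_X, zero_mul, zero_add,
    mul_zero, add_zero, mul_one, one_pow]
  push_cast
  ring

section Sat

variable {d : ℕ} {c : ℝ} {p : ℕ} {H : Submodule ℂ (L2T d)}

theorem toL2_nonlin_mem {m : ℕ} {u v : C(Torus d, ℂ)} (hu : toL2 d u ∈ satSeq c p H m)
    (hv : ∀ x, v x = nonlin c p (u x)) : toL2 d v ∈ satSeq c p H (m + 1) := by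
  refine Submodule.subset_span ⟨toL2 d u, hu, ?_⟩
  filter_upwards [coeFn_toL2 u, coeFn_toL2 v] with x h1 h2
  rw [h2, hv, h1]

theorem one_mem_satSeq (hc : c ≠ 0) (h1 : toL2 d 1 ∈ H) (m : ℕ) : toL2 d 1 ∈ satSeq c p H m := by
  induction m with
  | zero => exact h1
  | succ m ih =>
    have h := toL2_nonlin_mem (v := (Complex.I * (c : ℂ)) • 1) ih fun x => by simp [nonlin]
    rw [map_smul] at h
    exact (Submodule.smul_mem_iff _ (mul_ne_zero Complex.I_ne_zero (Complex.ofReal_ne_zero.2 hc))).1 h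

/-- Since 1 and u lie in H'_m, the polarization combinations of B(1 + iωu) over the nodes i lie in
H'_{m+1}. Taking ω = 1 and ω = √-1 eliminates the conjugate and leaves a nonzero multiple of u. The
lifting ties the power of χ to the level, so this monotonicity is what allows that power to grow
with the function fixed. -/
theorem mem_satSeq_succ (hc : c ≠ 0) (h1 : toL2 d 1 ∈ H) {m : ℕ} {u : C(Torus d, ℂ)}
    (hu : toL2 d u ∈ satSeq c p H m) : toL2 d u ∈ satSeq c p H (m + 1) := by
  obtain ⟨w, hw⟩ := exists_polarization c p
  have hS : ∀ ω : ℂ, ∃ S : C(Torus d, ℂ), toL2 d S ∈ satSeq c p H (m + 1) ∧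
      ∀ x, S x = Complex.I * c * ((p + 1) * (ω * u x) + p * starRingEnd ℂ (ω * u x)) := by
    intro ω
    let B : Fin (2 * p + 2) → C(Torus d, ℂ) := fun i =>
      ⟨fun x => nonlin c p (1 + ((i : ℕ) : ℂ) * (ω * u x)),
        (continuous_nonlin c p).comp (by fun_prop)⟩
    refine ⟨∑ i, w i • B i, ?_, fun x => ?_⟩
    · rw [map_sum]
      refine Submodule.sum_mem _ fun i _ => ?_
      rw [map_smul]
      refine Submodule.smul_mem _ _ ?_
      refine toL2_nonlin_mem (u := 1 + (((i : ℕ) : ℂ) * ω) • u) ?_ fun x => ?_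
      · rw [map_add, map_smul]
        exact Submodule.add_mem _ (one_mem_satSeq hc h1 m) (Submodule.smul_mem _ _ hu)
      · simp [B, mul_assoc]
    · rw [← hw (ω * u x)]
      simp [B]
  obtain ⟨S₁, hS₁, hS₁x⟩ := hS 1
  obtain ⟨S₂, hS₂, hS₂x⟩ := hS Complex.I
  have hcomb : S₁ + (-Complex.I) • S₂ = (2 * (p + 1) * (Complex.I * c) : ℂ) • u := by
    ext x
    simp only [ContinuousMap.add_apply, ContinuousMap.smul_apply, smul_eq_mul, hS₁x, hS₂x, map_mul,
      Complex.conj_I, one_mul]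
    linear_combination (-(Complex.I * c * (p + 1) * u x) + Complex.I * c * p * starRingEnd ℂ (u x)) *
      Complex.I_sq
  have hmem : toL2 d (S₁ + (-Complex.I) • S₂) ∈ satSeq c p H (m + 1) := by
    rw [map_add, map_smul]
    exact Submodule.add_mem _ hS₁ (Submodule.smul_mem _ _ hS₂)
  rw [hcomb, map_smul] at hmem
  refine (Submodule.smul_mem_iff _ ?_).1 hmem
  have hp1 : (p : ℂ) + 1 ≠ 0 := Nat.cast_add_one_ne_zero p
  exact mul_ne_zero (mul_ne_zero two_ne_zero hp1)
    (mul_ne_zero Complex.I_ne_zero (Complex.ofReal_ne_zero.2 hc))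

theorem mem_satSeq_of_le (hc : c ≠ 0) (h1 : toL2 d 1 ∈ H) {m n : ℕ} (hmn : m ≤ n) {u : C(Torus d, ℂ)}
    (hu : toL2 d u ∈ satSeq c p H m) : toL2 d u ∈ satSeq c p H n := by
  induction n, hmn using Nat.le_induction with
  | base => exact hu
  | succ n _ ih => exact mem_satSeq_succ hc h1 ih

end Sat

/-! ### Uniqueness -/

/-- Gronwall's inequality, applied to the primitive of φ, which is differentiable once φ is extended
continuously by `clip`. -/
theorem eq_zero_of_le_mul_integral {φ : ℝ → ℝ} {a b K : ℝ} (hφ : ContinuousOn φ (Icc a b))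
    (h0 : ∀ t ∈ Icc a b, 0 ≤ φ t) (h : ∀ t ∈ Icc a b, φ t ≤ K * ∫ τ in a..t, φ τ) :
    ∀ t ∈ Icc a b, φ t = 0 := by
  intro t ht
  have hab := ht.1.trans ht.2
  have hψ : Continuous fun t => φ (clip a b t) :=
    hφ.comp_continuous (continuous_clip a b) fun t => clip_mem hab t
  have hi : ∀ x ∈ Icc a b, ∫ τ in a..x, φ (clip a b τ) = ∫ τ in a..x, φ τ := fun x hx =>
    intervalIntegral.integral_congr fun τ hτ => by
      rw [uIcc_of_le hx.1] at hτ
      simp only [clip_of_mem (Icc_subset_Icc_right hx.2 hτ)]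
  have hd : ∀ x, HasDerivAt (fun x => ∫ τ in a..x, φ (clip a b τ)) (φ (clip a b x)) x := fun x =>
    intervalIntegral.integral_hasDerivAt_right (hψ.intervalIntegrable _ _)
      (hψ.stronglyMeasurableAtFilter _ _) hψ.continuousAt
  have hy : ∀ x ∈ Icc a b, ∫ τ in a..x, φ (clip a b τ) = 0 := by
    refine eq_zero_of_abs_deriv_le_mul_abs_self_of_eq_zero_right (K := |K|)
      (fun x _ => (hd x).continuousAt.continuousWithinAt)
      (fun x _ => (hd x).hasDerivWithinAt) (by simp) fun x hx => ?_
    have hx' := Ico_subset_Icc_self hx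
    rw [hi x hx', clip_of_mem hx', Real.norm_of_nonneg (h0 x hx'), Real.norm_eq_abs, ← abs_mul]
    exact (h x hx').trans (le_abs_self _)
  have h1 := h t ht
  rw [← hi t ht, hy t ht, mul_zero] at h1
  exact h1.antisymm (h0 t ht)

theorem eq_duhamel_of_eq_integral {a b : ℝ} {l : ℂ} {z g : ℝ → ℂ} (hz : ContinuousOn z (Icc a b))
    (hg : ContinuousOn g (Icc a b))
    (h : ∀ t ∈ Icc a b, z t = ∫ τ in a..t, (-(l * z τ) + g τ)) :
    ∀ t ∈ Icc a b, z t = duhamel l a g t := by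
  intro t ht
  have hab := ht.1.trans ht.2
  have hgi : ∀ x ∈ Icc a b, IntervalIntegrable g volume a x := fun x hx =>
    ContinuousOn.intervalIntegrable (by rw [uIcc_of_le hx.1]; exact hg.mono (Icc_subset_Icc_right hx.2))
  have hD := continuousOn_duhamel hab (hgi b (right_mem_Icc.2 hab)) l
  have hw : ∀ x ∈ Icc a b, z x - duhamel l a g x = ∫ τ in a..x, -l * (z τ - duhamel l a g τ) := by
    intro x hx
    have hs : uIcc a x ⊆ Icc a b := by rw [uIcc_of_le hx.1]; exact Icc_subset_Icc_right hx.2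
    have h1 := mild_eq_integral hx.1 (hgi x hx) l 0
    simp only [mul_zero, zero_add] at h1
    rw [h x hx, h1, ← intervalIntegral.integral_sub]
    · congr 1; ext τ; ring
    · exact ContinuousOn.intervalIntegrable (by have := hz.mono hs; have := hg.mono hs; fun_prop)
    · exact ContinuousOn.intervalIntegrable (by have := hD.mono hs; have := hg.mono hs; fun_prop)
  have h2 := eq_zero_of_le_mul_integral (φ := fun x => ‖z x - duhamel l a g x‖) (K := ‖l‖)
    (hz.sub hD).norm (fun _ _ => norm_nonneg _) (fun x hx => ?_) t ht
  · exact sub_eq_zero.1 (norm_eq_zero.1 h2)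
  · rw [hw x hx]
    refine (intervalIntegral.norm_integral_le_integral_norm hx.1).trans_eq ?_
    rw [← intervalIntegral.integral_const_mul]
    simp only [norm_mul, norm_neg]

/-- The symbol is unbounded in k, so a direct estimate of the integrated equation would not sum over
modes. Each mode of U - V is first rewritten by Duhamel, where the forcing has cancelled and the
kernel has modulus at most 1; summing the squares then gives a Gronwall inequality for ‖U - V‖². -/
theorem IsModeSol.unique {d s p : ℕ} {ν γ c a b : ℝ} (hs : d < 2 * s) (hν : 0 < ν) (hγ : 0 ≤ γ)
    {F : ℝ → (Fin d → ℤ) → ℂ} (hF : ∀ k, IntervalIntegrable (fun τ => F τ k) volume a b)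
    {U V : ℝ → ESeq d} (hU : IsModeSol ν γ c p s a b F U) (hV : IsModeSol ν γ c p s a b F V)
    (h0 : U a = V a) : ∀ t ∈ Icc a b, U t = V t := by
  intro t ht
  have hab := ht.1.trans ht.2
  set G : ℝ → ESeq d := fun τ => nonlinE s c p (V τ) - nonlinE s c p (U τ) with hGdef
  have hcN := continuous_nonlinE (d := d) hs c p
  have hG : Continuous G := (hcN.comp hV.cont).sub (hcN.comp hU.cont)
  have hint : ∀ {W : ℝ → ESeq d}, Continuous W → ∀ k, ∀ x ∈ Icc a b, IntervalIntegrable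
      (fun τ => -(symb ν γ k * W τ k) - nonlinE s c p (W τ) k + F τ k) volume a x := by
    intro W hW k x hx
    have h1 := continuous_coord hW k
    have h2 := continuous_coord (hcN.comp hW) k
    refine IntervalIntegrable.add (Continuous.intervalIntegrable ?_ _ _) ((hF k).mono_set ?_)
    · exact ((continuous_const.mul h1).neg).sub h2
    · rw [uIcc_of_le hx.1, uIcc_of_le hab]; exact Icc_subset_Icc_right hx.2
  have hmild : ∀ k, ∀ x ∈ Icc a b, (U x - V x) k = duhamel (symb ν γ k) a (fun τ => G τ k) x := by
    intro k
    refine eq_duhamel_of_eq_integral (z := fun x => (U x - V x) k)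
      (continuous_coord (hU.cont.sub hV.cont) k).continuousOn
      (continuous_coord hG k).continuousOn fun x hx => ?_
    rw [lp.coeFn_sub, Pi.sub_apply, hU.eqn k x hx, hV.eqn k x hx, h0, add_sub_add_left_eq_sub,
      ← intervalIntegral.integral_sub (hint hU.cont k x hx) (hint hV.cont k x hx)]
    congr 1; ext τ
    simp only [hGdef, lp.coeFn_sub, Pi.sub_apply]
    ring
  obtain ⟨C, hC0, hC⟩ := norm_nonlinE_sub_le (d := d) hs c p
  obtain ⟨R, hR⟩ := isCompact_Icc.exists_bound_of_continuousOn (s := Icc a b)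
    (f := fun τ => ‖U τ‖ + ‖V τ‖) (hU.cont.norm.add hV.cont.norm).continuousOn
  set L := C * R ^ (2 * p) with hL
  have hGle : ∀ τ ∈ Icc a b, ‖G τ‖ ≤ L * ‖U τ - V τ‖ := fun τ hτ => by
    rw [hGdef, norm_sub_rev]
    refine (hC _ _).trans ?_
    rw [hL]
    have := (le_abs_self _).trans (hR τ hτ)
    gcongr
  have hzc : Continuous fun τ => ‖U τ - V τ‖ ^ 2 := (hU.cont.sub hV.cont).norm.pow 2
  have hfin := eq_zero_of_le_mul_integral (φ := fun τ => ‖U τ - V τ‖ ^ 2) (a := a) (b := b)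
    (K := (b - a) * L ^ 2) hzc.continuousOn
    (fun _ _ => by positivity) (fun x hx => ?_) t ht
  · exact sub_eq_zero.1 (norm_eq_zero.1 (pow_eq_zero_iff two_ne_zero |>.1 hfin))
  · have hR0 : 0 ≤ b - a := by linarith
    have hxa : x ∈ Icc a x := right_mem_Icc.2 hx.1
    have key : ‖U x - V x‖ₑ ^ 2 ≤ ENNReal.ofReal (x - a) * ∫⁻ τ in Icc a x, ‖G τ‖ₑ ^ 2 := by
      rw [enorm_sq_eq_tsum]
      simp only [enorm_sq_eq_tsum (G _)]
      rw [lintegral_tsum fun k => ((continuous_coord hG k).aestronglyMeasurable.enorm.pow_const 2),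
        ← ENNReal.tsum_mul_left]
      refine ENNReal.tsum_le_tsum fun k => ?_
      rw [hmild k x hx]
      exact enorm_duhamel_sq_le_length_mul (symb_re_nonneg hν hγ k) hxa
        (continuous_coord hG k).aestronglyMeasurable
    have h2 : ∫⁻ τ in Icc a x, ‖G τ‖ₑ ^ 2 ≤
        ENNReal.ofReal (∫ τ in a..x, L ^ 2 * ‖U τ - V τ‖ ^ 2) := by
      rw [intervalIntegral.integral_of_le hx.1, ← integral_Icc_eq_integral_Ioc,
        ofReal_integral_eq_lintegral_ofReal]
      · refine setLIntegral_mono' measurableSet_Icc fun τ hτ => ?_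
        rw [← ofReal_norm, ← ENNReal.ofReal_pow (norm_nonneg _), ← mul_pow]
        exact ENNReal.ofReal_le_ofReal
          (pow_le_pow_left₀ (norm_nonneg _) (hGle τ (Icc_subset_Icc_right hx.2 hτ)) 2)
      · exact (continuous_const.mul hzc).continuousOn.integrableOn_Icc
      · exact ae_of_all _ fun τ => by positivity
    have hI : 0 ≤ ∫ τ in a..x, ‖U τ - V τ‖ ^ 2 :=
      intervalIntegral.integral_nonneg hx.1 fun _ _ => by positivity
    have h3 := key.trans (mul_le_mul_right h2 _)
    rw [intervalIntegral.integral_const_mul, ← ofReal_norm, ← ENNReal.ofReal_pow (norm_nonneg _),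
      ← ENNReal.ofReal_mul (by linarith [hx.1]), ENNReal.ofReal_le_ofReal_iff (by
        have := sub_nonneg.2 hx.1; positivity)] at h3
    refine h3.trans ?_
    rw [← mul_assoc]
    gcongr
    exact hx.2

/-! ### Mode solutions and solutions -/

theorem coeff_source {d : ℕ} {χ : Torus d → ℝ} (hχ : Continuous χ) (h η : ℝ → L2T d) (s : ℕ) (τ : ℝ)
    (k : Fin d → ℤ) : coeff (source χ h η τ) k =
      (forceSeq h s τ k + ctlSeq χ s (η τ) k) / (wt k : ℂ) ^ s := by
  have hb : Integrable fun x => (χ x : ℂ) * η τ x := by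
    obtain ⟨C, hC⟩ := isCompact_univ.exists_bound_of_continuousOn
      (Complex.continuous_ofReal.comp hχ).continuousOn
    exact (integrable_L2T (η τ)).bdd_mul
      (Complex.continuous_ofReal.comp hχ).aestronglyMeasurable
      (ae_of_all _ fun x => hC x (mem_univ x))
  rw [forceSeq, ctlSeq, ← mul_add, ← coeff_add (integrable_L2T (h τ)) hb,
    mul_div_cancel_left₀ _ (pow_ne_zero s (wt_ne_zero k))]
  rfl

theorem coeff_nonlin_toL2 {d s : ℕ} (hs : d < 2 * s) (c : ℝ) (p : ℕ) (A : ESeq d) (k : Fin d → ℤ) :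
    coeff (fun x => nonlin c p (toL2 d (Phi s A) x)) k = nonlinE s c p A k / (wt k : ℂ) ^ s := by
  rw [← coeff_Phi hs]
  refine coeff_congr ?_ k
  filter_upwards [coeFn_toL2 (Phi s A)] with x hx
  rw [hx, Phi_nonlinE hs]

theorem coeff_toL2_Phi {d s : ℕ} (hs : d < 2 * s) (A : ESeq d) (k : Fin d → ℤ) :
    coeff (toL2 d (Phi s A)) k = A k / (wt k : ℂ) ^ s := by
  rw [coeff_toL2, coeff_Phi hs]

theorem sobolevENorm_toL2_Phi {d s : ℕ} (hs : d < 2 * s) (A : ESeq d) :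
    sobolevENorm s (toL2 d (Phi s A)) = ‖A‖ₑ := by
  refine (ENNReal.pow_right_strictMono two_ne_zero).injective ?_
  simp only [sobolevENorm_sq, enorm_sq_eq_tsum, coeff_toL2_Phi hs,
    mul_div_cancel₀ _ (pow_ne_zero s (wt_ne_zero _))]

theorem enorm_wt {d : ℕ} (k : Fin d → ℤ) : ‖(wt k : ℂ)‖ₑ = ENNReal.ofReal (wt k) := by
  rw [← ofReal_norm, Complex.norm_real, Real.norm_of_nonneg (wt_pos k).le]

theorem sobolevENorm_succ_sq {d s : ℕ} (hs : d < 2 * s) (A : ESeq d) :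
    sobolevENorm (s + 1) (toL2 d (Phi s A)) ^ 2 =
      ∑' k, ENNReal.ofReal (wt k) ^ 2 * ‖A k‖ₑ ^ 2 := by
  rw [sobolevENorm_sq]
  congr 1; ext1 k
  rw [coeff_toL2_Phi hs, pow_succ' (wt k : ℂ), mul_assoc,
    mul_div_cancel₀ _ (pow_ne_zero s (wt_ne_zero k)), enorm_mul, enorm_wt, mul_pow]

section Bridge

variable {d s p : ℕ} {ν γ c T : ℝ} {χ : Torus d → ℝ} {h η : ℝ → L2T d}

theorem modes_integrand (hs : d < 2 * s) (hχ : Continuous χ) (A : ESeq d) (τ : ℝ) (k : Fin d → ℤ) :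
    -((((ν : ℂ) + Complex.I) * (freqSq k : ℂ) + (γ : ℂ)) * coeff (toL2 d (Phi s A)) k)
        - coeff (fun x => nonlin c p (toL2 d (Phi s A) x)) k + coeff (source χ h η τ) k =
      (-(symb ν γ k * A k) - nonlinE s c p A k + (forceSeq h s τ k + ctlSeq χ s (η τ) k)) /
        (wt k : ℂ) ^ s := by
  rw [coeff_nonlin_toL2 hs, coeff_source hχ h η s, coeff_toL2_Phi hs, symb]
  ring

theorem IsModeSol.isSolution (hs : d < 2 * s) (hχ : Continuous χ) {U : ℝ → ESeq d}
    (hU : IsModeSol ν γ c p s 0 T (fun τ k => forceSeq h s τ k + ctlSeq χ s (η τ) k) U) :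
    IsSolution ν γ c p s T (toL2 d (Phi s (U 0))) (source χ h η)
      fun t => toL2 d (Phi s (U t)) where
  mem := by
    refine ⟨⟨fun t _ => ?_, fun t₀ _ => ?_⟩, ?_, ?_⟩
    · rw [MemSobolev, sobolevENorm_toL2_Phi hs]; exact enorm_lt_top
    · simp only [← map_sub, ← Phi_sub hs, sobolevENorm_toL2_Phi hs]
      have h1 : Continuous fun t => ‖U t - U t₀‖ₑ := (hU.cont.sub continuous_const).enorm
      have h2 := (h1.tendsto t₀).mono_left (nhdsWithin_le_nhds (s := Icc 0 T))
      rwa [sub_self, enorm_zero] at h2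
    · exact (((toL2 d).continuous.comp (PhiCLM hs).continuous).comp
        hU.cont).aestronglyMeasurable
    · simp only [sobolevENorm_succ_sq hs]
      exact hU.reg.lt_top
  init := rfl
  eqn k t ht := by
    simp only [modes_integrand hs hχ, intervalIntegral.integral_div]
    rw [coeff_toL2_Phi hs, coeff_toL2_Phi hs, hU.eqn k t ht, add_div]

theorem IsSolution.exists_modeSol (hs : d < 2 * s) (hχ : Continuous χ) (hT : 0 ≤ T) {u₀ : L2T d}
    {v : ℝ → L2T d} (hv : IsSolution ν γ c p s T u₀ (source χ h η) v) :
    ∃ V, IsModeSol ν γ c p s 0 T (fun τ k => forceSeq h s τ k + ctlSeq χ s (η τ) k) V ∧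
      ∀ t ∈ Icc 0 T, toL2 d (Phi s (V t)) = v t := by
  have hrep : ∀ t, toL2 d (Phi s (enc s (v (clip 0 T t)))) = v (clip 0 T t) := fun t =>
    toL2_Phi_enc_of_mem hs (hv.mem.1.1 _ (clip_mem hT t))
  have hrep' : ∀ t ∈ Icc 0 T, toL2 d (Phi s (enc s (v (clip 0 T t)))) = v t := fun t ht => by
    rw [hrep, clip_of_mem ht]
  -- Outside [0, T] v is arbitrary, whereas a mode solution is continuous on the whole line; hence
  -- the composition with `clip`.
  refine ⟨fun t => enc s (v (clip 0 T t)), ⟨?_, ?_, fun k t ht => ?_⟩, hrep'⟩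
  · refine ContinuousOn.comp_continuous (g := fun t => enc s (v t)) (s := Icc 0 T) (fun t₀ ht₀ => ?_)
      (continuous_clip 0 T) (clip_mem hT)
    rw [ContinuousWithinAt, tendsto_iff_edist_tendsto_0]
    refine (hv.mem.1.2 t₀ ht₀).congr' ?_
    filter_upwards [self_mem_nhdsWithin] with t ht
    rw [edist_eq_enorm_sub, ← sobolevENorm_toL2_Phi hs, Phi_sub hs, map_sub,
      toL2_Phi_enc_of_mem hs (hv.mem.1.1 _ ht), toL2_Phi_enc_of_mem hs (hv.mem.1.1 _ ht₀)]
  · simp only [← sobolevENorm_succ_sq hs]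
    refine ne_of_lt (lt_of_eq_of_lt ?_ hv.mem.2.2)
    exact setLIntegral_congr_fun measurableSet_Icc fun t ht => by simp only [hrep' t ht]
  · have h0 := hrep' 0 (left_mem_Icc.2 hT)
    have h1 := hv.eqn k t ht
    rw [← hv.init, ← h0, ← hrep' t ht, coeff_toL2_Phi hs, coeff_toL2_Phi hs,
      intervalIntegral.integral_congr (g := fun τ => (-(symb ν γ k * enc s (v (clip 0 T τ)) k) -
        nonlinE s c p (enc s (v (clip 0 T τ))) k + (forceSeq h s τ k + ctlSeq χ s (η τ) k)) /
        (wt k : ℂ) ^ s) (fun τ hτ => ?_), intervalIntegral.integral_div, ← add_div,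
      div_left_inj' (pow_ne_zero s (wt_ne_zero k))] at h1
    · exact h1
    · rw [uIcc_of_le ht.1] at hτ
      simp only [← hrep' τ (Icc_subset_Icc_right ht.2 hτ)]
      exact modes_integrand hs hχ _ τ k

theorem IsModeSol.isUniqueSolution (hs : d < 2 * s) (hν : 0 < ν) (hγ : 0 ≤ γ) (hχ : Continuous χ)
    (hT : 0 ≤ T)
    (hF : ∀ k, IntervalIntegrable (fun τ => forceSeq h s τ k + ctlSeq χ s (η τ) k) volume 0 T)
    {U : ℝ → ESeq d}
    (hU : IsModeSol ν γ c p s 0 T (fun τ k => forceSeq h s τ k + ctlSeq χ s (η τ) k) U) :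
    IsUniqueSolution ν γ c p s T (toL2 d (Phi s (U 0))) (source χ h η)
      fun t => toL2 d (Phi s (U t)) := by
  refine ⟨hU.isSolution hs hχ, fun v hv t ht => ?_⟩
  obtain ⟨V, hV, hVv⟩ := hv.exists_modeSol hs hχ hT
  have h0 : U 0 = V 0 := Phi_injective hs (toL2_injective d (by
    rw [hVv 0 (left_mem_Icc.2 hT), hv.init]))
  simp only [← hVv t ht, hU.unique hs hν hγ hF hV h0 t ht]

end Bridge

theorem MemSobolev.mono {d r q : ℕ} (hrq : r ≤ q) {f : L2T d} (hf : MemSobolev q f) :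
    MemSobolev r f := by
  refine lt_of_le_of_lt ?_ hf
  unfold sobolevENorm
  gcongr with k
  have := freqSq_nonneg k
  exact le_add_of_nonneg_right this

theorem SimpleFunc.memL2Sobolev {d r : ℕ} (T : ℝ) (η : SimpleFunc ℝ (L2T d))
    (h : ∀ t, MemSobolev r (η t)) : MemL2Sobolev T r η := by
  refine ⟨η.stronglyMeasurable.aestronglyMeasurable, ?_⟩
  have h1 : (η.map fun f => sobolevENorm r f ^ 2).lintegral (volume.restrict (Icc 0 T)) < ∞ := by
    rw [SimpleFunc.lintegral]
    refine ENNReal.sum_lt_top.2 fun y hy => ?_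
    obtain ⟨t, rfl⟩ := SimpleFunc.mem_range.1 hy
    exact ENNReal.mul_lt_top (ENNReal.pow_lt_top (h t)) (measure_lt_top _ _)
  rwa [← SimpleFunc.lintegral_eq_lintegral] at h1

theorem SimpleFunc.memL2Sub {d : ℕ} (T : ℝ) {H : Submodule ℂ (L2T d)} (η : SimpleFunc ℝ (L2T d))
    (h : ∀ t, η t ∈ H) : MemL2Sub H T η :=
  ⟨η.memLp_of_isFiniteMeasure 2 _, ae_of_all _ h⟩

/-- Trajectories in Fourier coordinates provide controls and unique solutions. -/
theorem Traj.exists_isUniqueSolution {d s p : ℕ} {ν γ c T : ℝ} {χ : Torus d → ℝ} {h : ℝ → L2T d}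
    {H : Submodule ℂ (L2T d)} (hs : d < 2 * s) (hν : 0 < ν) (hγ : 0 ≤ γ) (hχ : Continuous χ)
    (hf : LocForce (forceSeq h s)) (hH : ∀ g ∈ H, MemSobolev (s + 2) g) (hT : 0 ≤ T) {v v' : ESeq d}
    (ht : Traj ν γ c p s (forceSeq h s) (ctlSeq χ s) H 0 T v v') :
    ∃ η : ℝ → L2T d, MemL2Sobolev T (s - 1) η ∧ MemL2Sub H T η ∧
      ∃ u : ℝ → L2T d, IsUniqueSolution ν γ c p s T (toL2 d (Phi s v)) (source χ h η) u ∧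
        u T = toL2 d (Phi s v') := by
  obtain ⟨η, U, hη, hU, rfl, rfl⟩ := ht
  exact ⟨η, SimpleFunc.memL2Sobolev T η fun t => (hH _ (hη t)).mono (by omega),
    SimpleFunc.memL2Sub T η hη, fun t => toL2 d (Phi s (U t)),
    hU.isUniqueSolution hs hν hγ hχ hT fun k => (hf.intervalIntegrable le_rfl hT k).add
      (simpleFunc_intervalIntegrable η (ctlSeq χ s · k) 0 T), rfl⟩

/-! ### Approximate controllability -/

theorem IsSaturatingOn.exists_eLpNorm_lt {d p : ℕ} {c : ℝ} {H : Submodule ℂ (L2T d)} {A : Set (Torus d)}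
    (hA : IsSaturatingOn c p H A) {w : Torus d → ℂ} (hw : MemLp w 2 volume) {ε : ℝ} (hε : 0 < ε) :
    ∃ j, ∃ g ∈ satSeq c p H j,
      eLpNorm (fun x => g x - w x) 2 (volume.restrict A) < ENNReal.ofReal ε := by
  have hw' : MemLp w 2 (volume.restrict A) := hw.restrict A
  obtain ⟨w', hd, j, g, hg, hwg⟩ := Metric.dense_iff.1 hA (hw'.toLp w) ε hε
  refine ⟨j, g, hg, ?_⟩
  rw [Metric.mem_ball, dist_eq_norm, ← ENNReal.ofReal_lt_ofReal_iff hε, ofReal_norm, Lp.enorm_def] at hd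
  refine lt_of_eq_of_lt (eLpNorm_congr_ae ?_) hd
  filter_upwards [hwg, hw'.coeFn_toLp, Lp.coeFn_sub w' (hw'.toLp w)] with x h1 h2 h3
  rw [h3, Pi.sub_apply, h1, h2]

/-- The limit of the powers of χ sees all of Λ, so g must also be small on Λ \ O. If that set is
null there is nothing to ask; otherwise density on Λ is applied to the function equal to w on O and
to 0 off O. -/
theorem exists_near_indicator {d p : ℕ} {c : ℝ} {H : Submodule ℂ (L2T d)} {Λ O : Set (Torus d)}
    (hΛ : MeasurableSet Λ) (hO : MeasurableSet O) (hsub : O ⊆ Λ)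
    (h : volume (Λ \ O) = 0 ∨ IsSaturatingOn c p H Λ) (hsat : IsSaturatingOn c p H O)
    (w : L2T d) {ε : ℝ} (hε : 0 < ε) :
    ∃ j, ∃ g ∈ satSeq c p H j,
      eLpNorm (fun x => Λ.indicator (fun y => g y) x - O.indicator (fun y => w y) x) 2 volume
        < ENNReal.ofReal ε := by
  have hw : MemLp (O.indicator fun y => w y) 2 volume := (Lp.memLp w).indicator hO
  have key : ∃ j, ∃ g ∈ satSeq c p H j,
      eLpNorm (fun x => g x - O.indicator (fun y => w y) x) 2 (volume.restrict Λ)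
        < ENNReal.ofReal ε := by
    rcases h with h | h
    · have he : (Λ : Set (Torus d)) =ᵐ[volume] O :=
        (ae_le_set.2 h).antisymm hsub.eventuallyLE
      rw [Measure.restrict_congr_set he]
      exact hsat.exists_eLpNorm_lt hw hε
    · exact h.exists_eLpNorm_lt hw hε
  obtain ⟨j, g, hg, hlt⟩ := key
  refine ⟨j, g, hg, ?_⟩
  rw [← eLpNorm_indicator_eq_eLpNorm_restrict hΛ] at hlt
  refine lt_of_eq_of_lt (congrArg (fun f => eLpNorm f 2 volume) ?_) hlt
  ext x
  by_cases hx : x ∈ Λ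
  · simp [hx]
  · have hx' : x ∉ O := fun h => hx (hsub h)
    simp [hx, hx']

/-- Dominated convergence: the powers of ρ tend pointwise to the indicator of {ρ = 1}. -/
theorem tendsto_eLpNorm_pow_mul {d : ℕ} {ρ : Torus d → ℝ} (hρ : Continuous ρ) (h0 : ∀ x, 0 ≤ ρ x)
    (h1 : ∀ x, ρ x ≤ 1) (Γ : C(Torus d, ℂ)) :
    Tendsto (fun n : ℕ => eLpNorm (fun x => (ρ x : ℂ) ^ n * Γ x - {x | ρ x = 1}.indicator Γ x) 2
      volume) atTop (𝓝 0) := by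
  have hm : MeasurableSet {x | ρ x = 1} := (isClosed_eq hρ continuous_const).measurableSet
  have hmeas : ∀ n : ℕ, Measurable fun x => (ρ x : ℂ) ^ n * Γ x - {x | ρ x = 1}.indicator Γ x :=
    fun n => (by fun_prop : Continuous fun x => (ρ x : ℂ) ^ n * Γ x).measurable.sub
      (Γ.continuous.measurable.indicator hm)
  have hbound : ∀ (n : ℕ) x, ‖(ρ x : ℂ) ^ n * Γ x - {x | ρ x = 1}.indicator Γ x‖ ≤ 2 * ‖Γ‖ := by
    intro n x
    have h2 : ‖(ρ x : ℂ) ^ n * Γ x‖ ≤ ‖Γ‖ := by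
      rw [norm_mul, norm_pow, Complex.norm_real, Real.norm_of_nonneg (h0 x)]
      exact (mul_le_of_le_one_left (norm_nonneg _) (pow_le_one₀ (h0 x) (h1 x))).trans
        (Γ.norm_coe_le_norm x)
    refine (norm_sub_le _ _).trans ?_
    have := (norm_indicator_le_norm_self (s := {x | ρ x = 1}) Γ x).trans (Γ.norm_coe_le_norm x)
    linarith
  have hlim : ∀ x, Tendsto (fun n : ℕ => (ρ x : ℂ) ^ n * Γ x - {x | ρ x = 1}.indicator Γ x) atTop
      (𝓝 0) := by
    intro x
    by_cases hx : ρ x = 1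
    · have hx' : x ∈ {x | ρ x = 1} := hx
      simp [hx]
    · have hx' : x ∉ {x | ρ x = 1} := hx
      have h3 : ‖(ρ x : ℂ)‖ < 1 := by
        rw [Complex.norm_real, Real.norm_of_nonneg (h0 x)]; exact lt_of_le_of_ne (h1 x) hx
      simpa [indicator_of_notMem hx'] using (tendsto_pow_atTop_nhds_zero_of_norm_lt_one h3).mul_const (Γ x)
  have hlint : Tendsto (fun n : ℕ =>
      ∫⁻ x, ‖(ρ x : ℂ) ^ n * Γ x - {x | ρ x = 1}.indicator Γ x‖ₑ ^ (2 : ℝ)) atTop (𝓝 0) := by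
    have := tendsto_lintegral_of_dominated_convergence (μ := (volume : Measure (Torus d)))
      (F := fun (n : ℕ) x => ‖(ρ x : ℂ) ^ n * Γ x - {x | ρ x = 1}.indicator Γ x‖ₑ ^ (2 : ℝ))
      (f := fun _ => 0) (fun _ => ENNReal.ofReal (2 * ‖Γ‖) ^ (2 : ℝ))
      (fun n => (hmeas n).enorm.pow_const _)
      (fun n => ae_of_all _ fun x => by
        simp only
        rw [← ofReal_norm]
        gcongr
        exact hbound n x)
      (by rw [lintegral_const]; finiteness)
      (ae_of_all _ fun x => by
        have h4 := ((ENNReal.continuous_rpow_const (y := 2)).tendsto _).comp (hlim x).enorm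
        simpa [Function.comp_def] using h4)
    simpa using this
  have h5 := ((ENNReal.continuous_rpow_const (y := 1 / 2)).tendsto _).comp hlint
  rw [ENNReal.zero_rpow_of_pos (by norm_num)] at h5
  refine h5.congr fun n => ?_
  rw [eLpNorm_eq_lintegral_rpow_enorm_toReal two_ne_zero ENNReal.ofNat_ne_top]
  simp

theorem approxControllableOn_interior_maxSet {d s p : ℕ} (hd : 1 ≤ d) (hs : d < 2 * s) (hp : 1 ≤ p)
    {ν γ c : ℝ} (hν : 0 < ν) (hγ : 0 ≤ γ) (hc : c ≠ 0) {χ : Torus d → ℝ} (hχ : TorusSmooth χ)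
    (hχ0 : ∀ x, 0 ≤ χ x) (hχne : ∃ x, χ x ≠ 0) {h : ℝ → L2T d}
    (hh : ∀ T : ℝ, 0 < T → MemL2Sobolev T (s - 1) h) {H : Submodule ℂ (L2T d)}
    (hH : ∀ g ∈ H, MemSobolev (s + 2) g) (hH1 : toL2 d 1 ∈ H)
    (hΛ : volume (maxSet χ \ interior (maxSet χ)) = 0 ∨ IsSaturatingOn c p H (maxSet χ))
    (hsat : IsSaturatingOn c p H (interior (maxSet χ))) :
    ApproxControllableOn ν γ c p s χ h H (interior (maxSet χ)) := by
  intro ε hε T₀ hT₀ u₀ hu₀ u₁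
  have hs2 : d < 2 * (s + 2) := by omega
  have hχc := hχ.continuous
  set M : ℝ := ⨆ y, χ y with hM
  have hle : ∀ x, χ x ≤ M := le_ciSup (isCompact_range hχc).bddAbove
  have hM0 : 0 < M := by
    obtain ⟨x, hx⟩ := hχne
    exact ((hχ0 x).lt_of_ne' hx).trans_le (hle x)
  have hclosed : IsClosed (maxSet χ) := isClosed_eq hχc continuous_const
  have hΛρ : {x | χ x / M = 1} = maxSet χ := by
    ext x; exact div_eq_one_iff_eq hM0.ne'
  have hε3 : 0 < ε / 3 := by positivity
  obtain ⟨j, g, hg, hgε⟩ := exists_near_indicator hclosed.measurableSet isOpen_interior.measurableSet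
    interior_subset hΛ hsat u₁ hε3
  have hf := locForce_forceSeq (s := s) (by omega) hh
  have hlift := lifted_of_mem_satSeq (c := c) hs hp hν hγ hf hχ hχ0 hH
  -- Lifting at level j serves only to provide a continuous representative Γ of g. N depends on Γ,
  -- and only then is the level m ≥ j chosen at which g is lifted again.
  obtain ⟨G₀, -, hG₀, -⟩ := hlift j g hg
  set Γ := Phi (s + 2) G₀ with hΓ
  have htend := tendsto_eLpNorm_pow_mul (ρ := fun x => χ x / M) (hχc.div_const M)
    (fun x => div_nonneg (hχ0 x) hM0.le) (fun x => (div_le_one hM0).2 (hle x)) Γ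
  obtain ⟨N, hN⟩ := eventually_atTop.1 (htend.eventually_lt_const (ENNReal.ofReal_pos.2 hε3))
  set m := max j N with hm
  set n := (2 * p + 1) ^ m with hn
  have hNn : N ≤ n := (le_max_right j N).trans (Nat.lt_pow_self (by omega)).le
  obtain ⟨G, F, hG, hF, hsteer⟩ := hlift m g (by
    rw [← hG₀] at hg ⊢
    exact mem_satSeq_of_le hc hH1 (le_max_left j N) hg)
  have hGΓ : Phi (s + 2) G = Γ := toL2_injective d (hG.trans hG₀.symm)
  set L : ESeq d →L[ℂ] L2T d := (toL2 d).comp (PhiCLM hs) with hL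
  -- Steering is accurate in H^s; the norm of the embedding L converts this to L². Adding 1 avoids
  -- dividing by 0.
  have hε' : 0 < ε / 3 / (‖L‖ + 1) := by positivity
  -- The multiple M⁻ⁿ normalizes χ by its maximum: the displacement is (χ/M)ⁿ Γ.
  obtain ⟨T, hT, v', hv', htraj⟩ := hsteer ((M : ℂ) ^ n)⁻¹ 0 le_rfl (enc s u₀) _ hε' T₀ hT₀
  rw [zero_add] at htraj
  obtain ⟨η, hη1, hη2, u, hu, huT⟩ :=
    htraj.exists_isUniqueSolution hs hν hγ hχc hf hH hT.1.le
  rw [toL2_Phi_enc_of_mem hs hu₀] at hu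
  refine ⟨T, hT, η, hη1, hη2, u, hu, ?_⟩
  set B := v' - enc s u₀ - ((M : ℂ) ^ n)⁻¹ • inclE F with hB
  have hLB : L B = u T - u₀ - toL2 d (((M : ℂ) ^ n)⁻¹ • Phi (s + 2) F) := by
    have e : ∀ A, L A = toL2 d (Phi s A) := fun _ => rfl
    rw [hB, map_sub, map_sub, e, e, e, toL2_Phi_enc_of_mem hs hu₀, ← huT, Phi_smul hs, Phi_inclE hs]
  have hLε : eLpNorm (L B) 2 volume < ENNReal.ofReal (ε / 3) := by
    rw [← Lp.enorm_def, ← ofReal_norm, ENNReal.ofReal_lt_ofReal_iff hε3]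
    refine (L.le_opNorm B).trans_lt ?_
    rw [lt_div_iff₀ (by positivity)] at hv'
    nlinarith [norm_nonneg B]
  -- The three errors, each below ε/3: steering, replacing (χ/M)ⁿ by the indicator of Λ, and
  -- approximating the target by g on Λ.
  have hae : (fun x => u T x - u₀ x - (interior (maxSet χ)).indicator (fun y => u₁ y) x) =ᵐ[volume]
      (⇑(L B) + fun x => (((χ x / M : ℝ) : ℂ) ^ n * Γ x - {x | χ x / M = 1}.indicator Γ x)) +
        fun x => (maxSet χ).indicator (fun y => g y) x -
          (interior (maxSet χ)).indicator (fun y => u₁ y) x := by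
    have hg' := (toL2_eq_iff _ _).1 hG₀
    filter_upwards [Lp.coeFn_sub (u T - u₀) (toL2 d (((M : ℂ) ^ n)⁻¹ • Phi (s + 2) F)),
      Lp.coeFn_sub (u T) u₀, coeFn_toL2 (((M : ℂ) ^ n)⁻¹ • Phi (s + 2) F), hg'] with x h1 h2 h3 h4
    rw [hΛρ]
    have e1 : (maxSet χ).indicator (fun y => g y) x = (maxSet χ).indicator Γ x := by
      by_cases hx : x ∈ maxSet χ
      · rw [indicator_of_mem hx, indicator_of_mem hx, h4]
      · rw [indicator_of_notMem hx, indicator_of_notMem hx]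
    rw [Pi.add_apply, Pi.add_apply, hLB, h1, Pi.sub_apply, h2, Pi.sub_apply, h3, e1,
      ContinuousMap.smul_apply, hF, hGΓ, smul_eq_mul]
    push_cast
    rw [div_pow]
    ring
  have hmeas1 : AEStronglyMeasurable
      (fun x => (((χ x / M : ℝ) : ℂ) ^ n * Γ x - {x | χ x / M = 1}.indicator Γ x)) volume := by
    rw [hΛρ]
    exact (by fun_prop : Continuous fun x => ((χ x / M : ℝ) : ℂ) ^ n * Γ x).aestronglyMeasurable.sub
      (Γ.continuous.aestronglyMeasurable.indicator hclosed.measurableSet)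
  have hmeas2 : AEStronglyMeasurable (fun x => (maxSet χ).indicator (fun y => g y) x -
      (interior (maxSet χ)).indicator (fun y => u₁ y) x) volume :=
    ((Lp.aestronglyMeasurable g).indicator hclosed.measurableSet).sub
      ((Lp.aestronglyMeasurable u₁).indicator isOpen_interior.measurableSet)
  rw [eLpNorm_congr_ae hae]
  have hLm := Lp.aestronglyMeasurable (L B)
  refine (eLpNorm_add_le (hLm.add hmeas1) hmeas2 (by norm_num)).trans_lt ?_
  refine (add_le_add_left (eLpNorm_add_le hLm hmeas1 (by norm_num)) _).trans_lt ?_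
  have hsum : ENNReal.ofReal ε =
      ENNReal.ofReal (ε / 3) + ENNReal.ofReal (ε / 3) + ENNReal.ofReal (ε / 3) := by
    rw [← ENNReal.ofReal_add hε3.le hε3.le, ← ENNReal.ofReal_add (by linarith) hε3.le]
    congr 1; ring
  rw [hsum]
  exact ENNReal.add_lt_add (ENNReal.add_lt_add hLε (hN n hNn)) hgε

theorem toL2_one (d : ℕ) : toL2 d 1 = Lp.const 2 (volume : Measure (Torus d)) (1 : ℂ) :=
  (toL2_eq_iff _ _).2 (Lp.coeFn_const _ _ _)

end CGL

theorem theorem3p5 (d : ℕ) (hd : 1 ≤ d) (s : ℕ) (hs : (d : ℝ) / 2 < (s : ℝ))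
    (p : ℕ) (hp : 1 ≤ p) (ν γ c : ℝ) (hν : 0 < ν) (hγ : 0 ≤ γ) (hc : 0 < c)
    (χ : CGL.Torus d → ℝ) (hχ_smooth : CGL.TorusSmooth χ) (hχ_nonneg : ∀ x, 0 ≤ χ x)
    (hχ_ne : ∃ x, χ x ≠ 0)
    (h : ℝ → CGL.L2T d) (hh : ∀ T : ℝ, 0 < T → CGL.MemL2Sobolev T (s - 1) h)
    (H : Submodule ℂ (CGL.L2T d)) (hH_fin : FiniteDimensional ℂ H)
    (hH_mem : ∀ f ∈ H, CGL.MemSobolev (s + 2) f)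
    (hH_conj : ∀ f ∈ H, star f ∈ H)
    (hH_one : Lp.const 2 (volume : Measure (CGL.Torus d)) (1 : ℂ) ∈ H)
    (hO : (interior (CGL.maxSet χ)).Nonempty)
    (hΛ : volume (CGL.maxSet χ \ interior (CGL.maxSet χ)) = 0 ∨
      CGL.IsSaturatingOn c p H (CGL.maxSet χ))
    (hsat : CGL.IsSaturatingOn c p H (interior (CGL.maxSet χ))) :
    CGL.ApproxControllableOn ν γ c p s χ h H (interior (CGL.maxSet χ)) := by
  have hs' : d < 2 * s := by
    have : (d : ℝ) < 2 * s := by linarith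
    exact_mod_cast this
  refine CGL.approxControllableOn_interior_maxSet hd hs' hp hν hγ hc.ne' hχ_smooth hχ_nonneg hχ_ne
    hh hH_mem ?_ hΛ hsat
  rwa [CGL.toL2_one]
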